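/- Let $\nu,c_0,c_1,\lambda>0$ and $w_d\ge 0$. Write $(\cdot,\cdot)$ and $\|\cdot\|=\|\cdot\|_0$ for the inner product and norm of $L^2(0,1)$, $\|v\|_1=(\|v\|^2+\|v_x\|^2)^{1/2}$, and $|||v|||=(v(0)^2+v(1)^2+\|v_x\|^2)^{1/2}$ for $v\in H^1(0,1)$. For $\mu>0$ consider the BBM-Burgers equation with nonlinear Neumann feedback control $$w_t-\mu w_{xxt}-\nu w_{xx}+(1+w_d)w_x+ww_x=0 \text{ in } (0,1)\times(0,\infty),\quad w_x(i,t)=K_i(w(i,t))\ (i=0,1),\quad w(\cdot,0)=w_0,$$ $$K_0(s)=\tfrac1\nu\Big((c_0+1+w_d)s+\tfrac{2}{9c_0}s^3\Big),\qquad K_1(s)=-\tfrac1\nu\Big((c_1+1+w_d)s+\tfrac{2}{9c_1}s^3\Big).$$ A weak solution is a function $w:[0,\infty)\to H^1(0,1)$ with $w(0)=w_0$ and $w_t\in L^2(0,T;H^1)$ for all $T>0$ such that for almost all $t>0$ and all $\chi\in H^1(0,1)$ $$(w_t,\chi)+\mu(w_{xt},\chi_x)+\nu(w_x,\chi_x)+(1+w_d)(w_x,\chi)+(ww_x,\chi)+\frac{\mu}{\nu}\sum_{i=0}^1\Big((c_i+1+w_d)+\frac{2}{3c_i}w(i,t)^2\Big)w_t(i,t)\chi(i)$$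 $$+\sum_{i=0}^1\Big((c_i+1+w_d)w(i,t)+\frac{2}{9c_i}w(i,t)^3\Big)\chi(i)=0. \qquad (1)$$ For a partition $0=x_0<\dots<x_N=1$ ($N\ge1$) with $h=\max_j(x_j-x_{j-1})$ let $V_h\subset H^1(0,1)$ be the space of continuous functions that are affine on each $(x_{j-1},x_j)$. A semidiscrete solution is a continuous $w_h:[0,\infty)\to V_h$, differentiable for $t>0$, that satisfies (1) with $w_h$ in place of $w$ for all $t>0$ and all $\chi\in V_h$, and whose initial value is the projection of $w_0$ onto $V_h$, i.e. $((w_0-w_h(0))_x,\chi_x)+\lambda(w_0-w_h(0),\chi)=0$ for all $\chi\in V_h$ ($\lambda=1$ is the usual $H^1$ projection). **Theorem.** Let $w_0\in H^2(0,1)$. (a) For every $\mu>0$ there is a constant $C>0$, which may depend on $\mu,\nu,w_d,c_0,c_1,\lambda,w_0$ but not on the partition (in particular not on $h$), nor on $t$ or $\alpha$, such that for the weak solution $w$ (that is, for every weak solution), for every partition and semidiscrete solution $w_h$, for all $t\ge0$ and all $$0\le\alpha\le\frac12\min\Big\{\frac{\nu}{\mu+1},\ \frac{\nu}{2\mu+\nu},\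 \frac{\nu(1+c_i+w_d)}{\nu+(1+c_i+w_d)\mu}\ (i=0,1)\Big\}$$ one has $$\|(w-w_h)(t)\|_r\le C\mu^{-1/2}h^{2-r}e^{-\alpha t}\quad(r=0,1),\qquad |||(w-w_h)(t)|||\le C\,h\,e^{-\alpha t}.$$ (b) If moreover $w_0$ satisfies the boundary conditions, $w_{0x}(i)=K_i(w_0(i))$ for $i=0,1$, then for every $M>0$ the constant $C$ can be chosen independently of $\mu\in(0,M]$. -/

import Mathlib

open MeasureTheory Set
open scoped ContDiff

noncomputable section

namespace BBMB

/-! ### The spaces `L²(0,1)`, `H¹(0,1)`, `H²(0,1)` -/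

/-- Lebesgue measure on `(0,1)`. -/
abbrev unitMeasure : Measure ℝ := volume.restrict (Ioo (0 : ℝ) 1)

/-- `L²(0,1)`. -/
abbrev L2 : Type := Lp ℝ 2 unitMeasure

/-- Test functions on `(0,1)`: smooth, with compact support contained in `(0,1)`. -/
structure IsTest (φ : ℝ → ℝ) : Prop where
  smooth : ContDiff ℝ ∞ φ
  compact : HasCompactSupport φ
  support : tsupport φ ⊆ Ioo (0 : ℝ) 1

/-- `g` is the weak (distributional) derivative of `v` on `(0,1)`. -/
def IsWeakDeriv (v g : L2) : Prop :=
  ∀ φ : ℝ → ℝ, IsTest φ →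
    ∫ x, v x * deriv φ x ∂unitMeasure = -∫ x, g x * φ x ∂unitMeasure

theorem IsTest.memLp {φ : ℝ → ℝ} (h : IsTest φ) : MemLp φ 2 unitMeasure :=
  (h.smooth.continuous.memLp_of_hasCompactSupport h.compact).restrict _

theorem IsTest.memLp_deriv {φ : ℝ → ℝ} (h : IsTest φ) : MemLp (deriv φ) 2 unitMeasure :=
  ((h.smooth.continuous_deriv (by simp)).memLp_of_hasCompactSupport h.compact.deriv).restrict _

theorem integral_mul_eq_inner {ψ : ℝ → ℝ} (h : MemLp ψ 2 unitMeasure) (v : L2) :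
    ∫ x, v x * ψ x ∂unitMeasure = inner ℝ (h.toLp ψ) v := by
  rw [L2.inner_def]
  refine integral_congr_ae ?_
  filter_upwards [h.coeFn_toLp] with x hx
  simp [hx]

theorem isWeakDeriv_iff (v g : L2) :
    IsWeakDeriv v g ↔ ∀ (φ : ℝ → ℝ) (h : IsTest φ),
      inner ℝ (h.memLp_deriv.toLp _) v + inner ℝ (h.memLp.toLp _) g = 0 := by
  refine forall₂_congr fun φ h => ?_
  rw [integral_mul_eq_inner h.memLp_deriv, integral_mul_eq_inner h.memLp, eq_neg_iff_add_eq_zero]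

/-- `H¹(0,1)`: the pairs `(v, v')` in `L² × L²` with `v'` the weak derivative of `v`. As a subspace
of the Hilbert sum `L² ⊕ L²` it carries the standard norm `(‖v‖² + ‖v'‖²)^{1/2}`. -/
def H1 : Submodule ℝ (WithLp 2 (L2 × L2)) where
  carrier := {p | IsWeakDeriv p.fst p.snd}
  zero_mem' := by
    simp [isWeakDeriv_iff]
  add_mem' := by
    intro p q hp hq
    simp only [mem_ofPred_eq, isWeakDeriv_iff] at hp hq ⊢
    intro φ h
    have h1 := hp φ h
    have h2 := hq φ h
    simp only [WithLp.add_fst, WithLp.add_snd, inner_add_right]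
    linarith
  smul_mem' := by
    intro c p hp
    simp only [mem_ofPred_eq, isWeakDeriv_iff] at hp ⊢
    intro φ h
    have h1 := hp φ h
    simp only [WithLp.smul_fst, WithLp.smul_snd, inner_smul_right]
    rw [← mul_add, h1, mul_zero]

theorem isClosed_H1 : IsClosed (H1 : Set (WithLp 2 (L2 × L2))) := by
  have : (H1 : Set (WithLp 2 (L2 × L2))) = ⋂ (φ : ℝ → ℝ) (h : IsTest φ),
      {p | inner ℝ (h.memLp_deriv.toLp _) p.fst + inner ℝ (h.memLp.toLp _) p.snd = (0 : ℝ)} := by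
    ext p
    simp only [mem_iInter, mem_ofPred_eq]
    exact isWeakDeriv_iff _ _
  rw [this]
  refine isClosed_iInter fun φ => isClosed_iInter fun h => isClosed_eq ?_ continuous_const
  have h1 : Continuous fun p : WithLp 2 (L2 × L2) => p.fst :=
    (WithLp.fstL 2 ℝ L2 L2).continuous
  have h2 : Continuous fun p : WithLp 2 (L2 × L2) => p.snd :=
    (WithLp.sndL 2 ℝ L2 L2).continuous
  exact (continuous_const.inner h1).add (continuous_const.inner h2)

instance : CompleteSpace H1 := isClosed_H1.completeSpace_coe

/-- The underlying `L²` function of an element of `H¹(0,1)`. -/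
def val (v : H1) : L2 := v.1.fst

/-- The weak derivative `v_x` of `v ∈ H¹(0,1)`. -/
def dx (v : H1) : L2 := v.1.snd

/-- The boundary value `v(0)`, written through `∫₀¹ (1 - x) v'(x) dx = -v(0) + ∫₀¹ v(x) dx`. -/
def at0 (v : H1) : ℝ := ∫ x, (val v x - (1 - x) * dx v x) ∂unitMeasure

/-- The boundary value `v(1)`, written through `∫₀¹ x v'(x) dx = v(1) - ∫₀¹ v(x) dx`. -/
def at1 (v : H1) : ℝ := ∫ x, (val v x + x * dx v x) ∂unitMeasure

theorem absCont_of_contDiff {f : ℝ → ℝ} (hf : ContDiff ℝ 1 f) (a b : ℝ) :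
    AbsolutelyContinuousOnInterval f a b :=
  hf.contDiffOn.absolutelyContinuousOnInterval

theorem setIntegral_unit (f : ℝ → ℝ) :
    ∫ x, f x ∂unitMeasure = ∫ x in (0 : ℝ)..1, f x := by
  rw [intervalIntegral.integral_of_le zero_le_one, integral_Ioc_eq_integral_Ioo]

theorem intervalIntegrable_L2 (g : L2) : IntervalIntegrable g volume 0 1 := by
  rw [intervalIntegrable_iff_integrableOn_Ioo_of_le zero_le_one]
  exact (Lp.memLp g).integrable (by norm_num)

/-- Integration by parts against the primitive of an `L²` function. -/
theorem integral_primitive_mul_deriv (g : L2) {f : ℝ → ℝ} (hf : ContDiff ℝ 1 f) :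
    ∫ x in (0 : ℝ)..1, (∫ y in (0 : ℝ)..x, g y) * deriv f x =
      (∫ y in (0 : ℝ)..1, g y) * f 1 - ∫ x in (0 : ℝ)..1, g x * f x := by
  have hg := intervalIntegrable_L2 g
  have hac := hg.absolutelyContinuousOnInterval_intervalIntegral (c := 0) (by simp)
  rw [hac.integral_mul_deriv_eq_deriv_mul (absCont_of_contDiff hf 0 1)]
  have : ∫ x in (0 : ℝ)..1, deriv (fun x => ∫ y in (0 : ℝ)..x, g y) x * f x =
      ∫ x in (0 : ℝ)..1, g x * f x := by
    refine intervalIntegral.integral_congr_ae ?_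
    filter_upwards [hg.ae_hasDerivAt_integral] with x hx hx'
    rw [(hx (uIoc_subset_uIcc hx') 0 (by simp)).deriv]
  rw [this]
  simp

/-- If all integrals against derivatives of test functions vanish, the function is constant. -/
theorem ae_const_of_integral_deriv {u : ℝ → ℝ} (hu : Integrable u unitMeasure)
    (h : ∀ φ : ℝ → ℝ, IsTest φ → ∫ x, u x * deriv φ x ∂unitMeasure = 0) :
    ∃ c : ℝ, ∀ᵐ x ∂unitMeasure, u x = c := by
  obtain ⟨b, hb⟩ : ∃ b : ContDiffBump (1 / 2 : ℝ), b.rOut = 1 / 4 :=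
    ⟨⟨1 / 8, 1 / 4, by norm_num, by norm_num⟩, rfl⟩
  set ψ : ℝ → ℝ := b.normed volume with hψ
  have ψint : ∫ x, ψ x = 1 := b.integral_normed
  have ψs : tsupport ψ ⊆ Icc (1 / 4 : ℝ) (3 / 4) := by
    rw [hψ, b.tsupport_normed_eq, hb, Real.closedBall_eq_Icc]
    norm_num
  have ψtest : IsTest ψ :=
    ⟨b.contDiff_normed, b.hasCompactSupport_normed,
      ψs.trans (Icc_subset_Ioo (by norm_num) (by norm_num))⟩
  have bddmul : ∀ φ : ℝ → ℝ, Continuous φ → HasCompactSupport φ →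
      Integrable (fun x => u x * φ x) unitMeasure := by
    intro φ hc hs
    obtain ⟨C, hC⟩ := hc.bounded_above_of_compact_support hs
    exact hu.mul_bdd (c := C) hc.aestronglyMeasurable (Filter.Eventually.of_forall hC)
  refine ⟨∫ x, u x * ψ x ∂unitMeasure, ?_⟩
  set c := ∫ x, u x * ψ x ∂unitMeasure with hc
  have key : ∀ φ : ℝ → ℝ, ContDiff ℝ ∞ φ → HasCompactSupport φ → tsupport φ ⊆ Ioo (0 : ℝ) 1 →
      ∫ x, φ x • (Ioo (0 : ℝ) 1).indicator (fun x => u x - c) x = 0 := by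
    intro φ h1 h2 h3
    set m := ∫ x, φ x with hm
    set θ : ℝ → ℝ := fun x => φ x - m * ψ x with hθ
    have θc : Continuous θ := h1.continuous.sub (continuous_const.mul ψtest.smooth.continuous)
    have θs : ContDiff ℝ ∞ θ := h1.sub (contDiff_const.mul ψtest.smooth)
    have θcs : HasCompactSupport θ := h2.sub (ψtest.compact.mul_left (f := fun _ => m))
    have θint : Integrable θ := θc.integrable_of_hasCompactSupport θcs
    have θ0 : ∫ x, θ x = 0 := by
      rw [hθ, integral_sub (h1.continuous.integrable_of_hasCompactSupport h2)
        ((ψtest.smooth.continuous.integrable_of_hasCompactSupport ψtest.compact).const_mul _),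
        integral_const_mul, ψint, ← hm]
      ring
    -- a compact interval inside `(0,1)` carrying `θ`
    obtain ⟨p, q, hp, hpq, hq, hsub⟩ : ∃ p q : ℝ, 0 < p ∧ p ≤ q ∧ q < 1 ∧
        ∀ x, x ∉ Icc p q → θ x = 0 := by
      have hK : IsCompact (tsupport φ ∪ Icc (1 / 4 : ℝ) (3 / 4)) := h2.isCompact.union isCompact_Icc
      have hne : (tsupport φ ∪ Icc (1 / 4 : ℝ) (3 / 4)).Nonempty :=
        ⟨1 / 2, Or.inr ⟨by norm_num, by norm_num⟩⟩
      have hin : tsupport φ ∪ Icc (1 / 4 : ℝ) (3 / 4) ⊆ Ioo 0 1 :=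
        union_subset h3 (Icc_subset_Ioo (by norm_num) (by norm_num))
      refine ⟨sInf _, sSup _, (hin (hK.sInf_mem hne)).1, ?_, (hin (hK.sSup_mem hne)).2, ?_⟩
      · exact csInf_le_csSup hne hK.bddBelow hK.bddAbove
      · intro x hx
        have hx' : x ∉ tsupport φ ∪ Icc (1 / 4 : ℝ) (3 / 4) := fun hmem =>
          hx ⟨csInf_le hK.bddBelow hmem, le_csSup hK.bddAbove hmem⟩
        have e1 : φ x = 0 := image_eq_zero_of_notMem_tsupport fun hmem => hx' (Or.inl hmem)
        have e2 : ψ x = 0 := image_eq_zero_of_notMem_tsupport fun hmem => hx' (Or.inr (ψs hmem))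
        simp [hθ, e1, e2]
    set Θ : ℝ → ℝ := fun x => ∫ y in (0 : ℝ)..x, θ y with hΘ
    have hder : ∀ x, HasDerivAt Θ (θ x) x := fun x =>
      intervalIntegral.integral_hasDerivAt_right (θc.intervalIntegrable _ _)
        (θc.stronglyMeasurableAtFilter _ _) θc.continuousAt
    have hderiv : deriv Θ = θ := funext fun x => (hder x).deriv
    have Θz : ∀ x, x ∉ Icc p q → Θ x = 0 := by
      intro x hx
      rw [mem_Icc, not_and_or, not_le, not_le] at hx
      rcases hx with hx | hx
      · refine (intervalIntegral.integral_congr (g := fun _ => (0 : ℝ)) ?_).trans (by simp)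
        intro y hy
        refine hsub y fun hy' => ?_
        rcases le_total 0 x with h0 | h0
        · rw [uIcc_of_le h0] at hy
          linarith [hy.2, hy'.1]
        · rw [uIcc_of_ge h0] at hy
          linarith [hy.2, hy'.1]
      · have : Θ x = ∫ y, θ y := by
          rw [hΘ]
          refine intervalIntegral.integral_eq_integral_of_support_subset ?_
          intro y hy
          have : y ∈ Icc p q := by
            by_contra hn
            exact hy (hsub y hn)
          exact ⟨by linarith [this.1], by linarith [this.2]⟩
        rw [this, θ0]
    have Θsupp : tsupport Θ ⊆ Icc p q :=
      closure_minimal (fun x hx => by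
        by_contra hn
        exact hx (Θz x hn)) isClosed_Icc
    have Θtest : IsTest Θ := by
      refine ⟨?_, ?_, Θsupp.trans (Icc_subset_Ioo hp hq)⟩
      · rw [contDiff_infty_iff_deriv, hderiv]
        exact ⟨fun x => (hder x).differentiableAt, θs⟩
      · exact isCompact_Icc.of_isClosed_subset (isClosed_tsupport _) Θsupp
    have h0 := h Θ Θtest
    rw [hderiv] at h0
    have e3 : ∫ x, φ x • (Ioo (0 : ℝ) 1).indicator (fun x => u x - c) x =
        ∫ x, (u x - c) * φ x ∂unitMeasure := by
      rw [← integral_indicator measurableSet_Ioo]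
      refine integral_congr_ae (Filter.Eventually.of_forall fun x => ?_)
      by_cases hx : x ∈ Ioo (0 : ℝ) 1 <;> simp [hx, mul_comm]
    have e4 : ∫ x, φ x ∂unitMeasure = m := by
      rw [hm]
      refine setIntegral_eq_integral_of_forall_compl_eq_zero fun x hx => ?_
      exact image_eq_zero_of_notMem_tsupport fun hmem => hx (h3 hmem)
    have i1 := bddmul φ h1.continuous h2
    have i2 := bddmul ψ ψtest.smooth.continuous ψtest.compact
    have i3 : Integrable φ unitMeasure :=
      (h1.continuous.integrable_of_hasCompactSupport h2).restrict
    have e5 : ∫ x, u x * θ x ∂unitMeasure = ∫ x, u x * φ x ∂unitMeasure - m * c := by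
      have : ∀ x, u x * θ x = u x * φ x - m * (u x * ψ x) := fun x => by
        simp only [hθ]
        ring
      simp_rw [this]
      rw [integral_sub i1 (i2.const_mul m), integral_const_mul]
    have e6 : ∫ x, (u x - c) * φ x ∂unitMeasure = ∫ x, u x * φ x ∂unitMeasure - c * m := by
      simp_rw [sub_mul]
      rw [integral_sub i1 (i3.const_mul c), integral_const_mul, e4]
    rw [e3, e6]
    linarith
  have hloc : LocallyIntegrableOn ((Ioo (0 : ℝ) 1).indicator fun x => u x - c) (Ioo 0 1) := by
    refine Integrable.locallyIntegrable ?_ |>.locallyIntegrableOn _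
    rw [integrable_indicator_iff measurableSet_Ioo]
    exact hu.sub (integrable_const c)
  have := isOpen_Ioo.ae_eq_zero_of_integral_contDiff_smul_eq_zero hloc key
  rw [ae_restrict_iff' measurableSet_Ioo]
  filter_upwards [this] with x hx hx'
  have := hx hx'
  rw [indicator_of_mem hx'] at this
  linarith

/-- Every `v ∈ H¹(0,1)` has a continuous representative, which is the primitive of `v_x` and whose
values at the end points are `at0 v` and `at1 v`. -/
theorem exists_rep (v : H1) : ∃ f : ℝ → ℝ, ContinuousOn f (Icc 0 1) ∧
    (∀ᵐ x ∂unitMeasure, val v x = f x) ∧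
    (∀ x ∈ Icc (0 : ℝ) 1, f x = f 0 + ∫ y in (0 : ℝ)..x, dx v y) ∧
    f 0 = at0 v ∧ f 1 = at1 v := by
  set g : L2 := dx v with hg
  have gi := intervalIntegrable_L2 g
  set F : ℝ → ℝ := fun x => ∫ y in (0 : ℝ)..x, g y with hF
  have Fc : ContinuousOn F (Icc 0 1) := by
    have := (gi.absolutelyContinuousOnInterval_intervalIntegral (c := 0) (by simp)).continuousOn
    rwa [uIcc_of_le zero_le_one] at this
  have Fi : Integrable F unitMeasure := (Fc.integrableOn_Icc).mono_set Ioo_subset_Icc_self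
  have vi : Integrable (val v) unitMeasure := (Lp.memLp (val v)).integrable (by norm_num)
  have gI : Integrable g unitMeasure := (Lp.memLp g).integrable (by norm_num)
  obtain ⟨c, hc⟩ := ae_const_of_integral_deriv (vi.sub Fi) (by
    intro φ hφ
    obtain ⟨C, hC⟩ := (hφ.smooth.continuous_deriv (by simp)).bounded_above_of_compact_support
      hφ.compact.deriv
    have hm := (hφ.smooth.continuous_deriv (by simp)).aestronglyMeasurable (μ := unitMeasure)
    have i1 := vi.mul_bdd (c := C) hm (Filter.Eventually.of_forall hC)
    have i2 := Fi.mul_bdd (c := C) hm (Filter.Eventually.of_forall hC)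
    simp only [Pi.sub_apply, sub_mul]
    rw [integral_sub i1 i2]
    have e1 : ∫ x, val v x * deriv φ x ∂unitMeasure = -∫ x, g x * φ x ∂unitMeasure := v.2 φ hφ
    have e2 := integral_primitive_mul_deriv g (hφ.smooth.of_le (by simp))
    have e3 : φ 1 = 0 := image_eq_zero_of_notMem_tsupport fun hmem =>
      lt_irrefl _ (hφ.support hmem).2
    rw [e1, setIntegral_unit, setIntegral_unit (fun x => F x * deriv φ x), e2, e3]
    ring)
  have hv : ∀ᵐ x ∂unitMeasure, val v x = c + F x := by
    filter_upwards [hc] with x hx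
    simp only [Pi.sub_apply] at hx
    linarith
  have F0 : F 0 = 0 := by simp [hF]
  have xb : ∀ᵐ x : ℝ ∂unitMeasure, ‖x‖ ≤ 1 := by
    filter_upwards [ae_restrict_mem measurableSet_Ioo] with x hx
    rw [Real.norm_eq_abs, abs_le]
    constructor <;> linarith [hx.1, hx.2]
  have xi : Integrable (fun x => x * g x) unitMeasure :=
    gI.bdd_mul continuous_id.aestronglyMeasurable xb
  have iv : ∫ x, val v x ∂unitMeasure = c + ∫ x, F x ∂unitMeasure := by
    rw [integral_congr_ae hv, integral_add (integrable_const c) Fi]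
    simp
  have iF : ∫ x, F x ∂unitMeasure = F 1 - ∫ x, x * g x ∂unitMeasure := by
    have := integral_primitive_mul_deriv g (f := fun x => x) contDiff_id
    simp only [deriv_id'', mul_one] at this
    rw [setIntegral_unit, setIntegral_unit, this]
    simp only [hF, mul_comm]
  have ig : ∫ x, g x ∂unitMeasure = F 1 := setIntegral_unit _
  refine ⟨fun x => c + F x, continuousOn_const.add Fc, hv, fun x _ => by simp [hF], ?_, ?_⟩
  · have : at0 v = (∫ x, val v x ∂unitMeasure) - (∫ x, g x ∂unitMeasure)
        + ∫ x, x * g x ∂unitMeasure := by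
      have e := integral_add (vi.sub gI) xi
      simp only [Pi.sub_apply] at e
      rw [← integral_sub vi gI, ← e]
      refine integral_congr_ae (Filter.Eventually.of_forall fun x => ?_)
      simp only [← hg]
      ring
    rw [this, iv, iF, ig]
    simp only [F0]
    ring
  · have : at1 v = (∫ x, val v x ∂unitMeasure) + ∫ x, x * g x ∂unitMeasure := by
      rw [← integral_add vi xi]
      rfl
    rw [this, iv, iF]
    ring

/-- `v ∈ H²(0,1)` with derivative `u = v_x ∈ H¹(0,1)`. -/
def HasH2Deriv (v u : H1) : Prop := val u = dx v

/-- The norm `|||v||| = (v(0)² + v(1)² + ‖v_x‖²)^{1/2}`. -/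
def tnorm (v : H1) : ℝ := √(at0 v ^ 2 + at1 v ^ 2 + ‖dx v‖ ^ 2)

/-! ### The controlled problem -/

/-- The boundary nonlinearity `(c + 1 + w_d) s + (2 / (9c)) s³`. -/
def bdry (wd c s : ℝ) : ℝ := (c + 1 + wd) * s + 2 / (9 * c) * s ^ 3

/-- The feedback law `K₀`. -/
def K0 (ν wd c0 s : ℝ) : ℝ := 1 / ν * bdry wd c0 s

/-- The feedback law `K₁`. -/
def K1 (ν wd c1 s : ℝ) : ℝ := -(1 / ν * bdry wd c1 s)

/-- The left-hand side of the weak formulation, with `w = w(t)`, `z = w_t(t)` and test function `χ`: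
`(z,χ) + μ(z_x,χ_x) + ν(w_x,χ_x) + (1+w_d)(w_x,χ) + (w w_x,χ)`
`+ (μ/ν) ∑_{i=0,1} ((c_i+1+w_d) z(i) + (2/(3c_i)) w(i)² z(i)) χ(i)`
`+ ∑_{i=0,1} ((c_i+1+w_d) w(i) + (2/(9c_i)) w(i)³) χ(i)`. -/
def weakForm (μ ν wd c0 c1 : ℝ) (w z χ : H1) : ℝ :=
  inner ℝ (val z) (val χ) + μ * inner ℝ (dx z) (dx χ) + ν * inner ℝ (dx w) (dx χ)
    + (1 + wd) * inner ℝ (dx w) (val χ) + (∫ x, val w x * dx w x * val χ x ∂unitMeasure)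
    + μ / ν *
      (((c0 + 1 + wd) * at0 z + 2 / (3 * c0) * at0 w ^ 2 * at0 z) * at0 χ
        + ((c1 + 1 + wd) * at1 z + 2 / (3 * c1) * at1 w ^ 2 * at1 z) * at1 χ)
    + (bdry wd c0 (at0 w) * at0 χ + bdry wd c1 (at1 w) * at1 χ)

/-- `w` is a weak solution on `[0,∞)` with initial value `w0`: `w(t) ∈ H¹`, `w_t = z ∈ L²(0,T;H¹)`
for all `T`, `w(0) = w0`, and the weak formulation holds for almost all `t > 0`. -/
def IsWeakSolution (μ ν wd c0 c1 : ℝ) (w0 : H1) (w : ℝ → H1) : Prop :=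
  ∃ z : ℝ → H1,
    (∀ T : ℝ, 0 < T → MemLp z 2 (volume.restrict (Ioo 0 T))) ∧
    (∀ t : ℝ, 0 ≤ t → w t = w0 + ∫ s in (0 : ℝ)..t, z s) ∧
    ∀ᵐ t ∂volume.restrict (Ioi (0 : ℝ)), ∀ χ : H1, weakForm μ ν wd c0 c1 (w t) (z t) χ = 0

/-- `w0 ∈ H²` satisfies the boundary conditions `w0_x(0) = K₀(w0(0))`, `w0_x(1) = K₁(w0(1))`. -/
def IsCompatible (ν wd c0 c1 : ℝ) (w0 : H1) : Prop :=
  ∃ u : H1, HasH2Deriv w0 u ∧ at0 u = K0 ν wd c0 (at0 w0) ∧ at1 u = K1 ν wd c1 (at1 w0)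

/-- The largest admissible decay rate. -/
def alphaMax (μ ν wd c0 c1 : ℝ) : ℝ :=
  1 / 2 * min (min (ν / (μ + 1)) (ν / (2 * μ + ν)))
    (min (ν * (1 + c0 + wd) / (ν + (1 + c0 + wd) * μ))
      (ν * (1 + c1 + wd) / (ν + (1 + c1 + wd) * μ)))

/-! ### The semidiscrete finite element method -/

/-- A partition `0 = x_0 < x_1 < ⋯ < x_N = 1`, `N ≥ 1`. -/
structure Mesh where
  N : ℕ
  pos : 0 < N
  node : Fin (N + 1) → ℝ
  strictMono : StrictMono node
  first : node 0 = 0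
  last : node (Fin.last N) = 1

/-- The mesh parameter `h = max_j (x_j - x_{j-1})`. -/
def Mesh.h (m : Mesh) : ℝ := ⨆ j : Fin m.N, (m.node j.succ - m.node j.castSucc)

/-- `V_h`: the `v ∈ H¹(0,1)` whose continuous representative is affine on each mesh interval. -/
def Mesh.V (m : Mesh) : Set H1 :=
  {v | ∃ f : ℝ → ℝ, ContinuousOn f (Icc 0 1) ∧ (∀ᵐ x ∂unitMeasure, val v x = f x) ∧
    ∀ j : Fin m.N, ∃ a b : ℝ, ∀ x ∈ Ioo (m.node j.castSucc) (m.node j.succ), f x = a + b * x}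

/-- `p ∈ V_h` is the projection of `v ∈ H¹` onto `V_h` for the inner product
`(v_x,χ_x) + lam (v,χ)`; `lam = 1` is the standard inner product of `H¹`. -/
def IsProjection (lam : ℝ) (m : Mesh) (v p : H1) : Prop :=
  p ∈ m.V ∧ ∀ χ ∈ m.V,
    inner ℝ (dx (v - p)) (dx χ) + lam * inner ℝ (val (v - p)) (val χ) = 0

/-- `wh : [0,∞) → V_h` solves the semidiscrete problem, its initial value being the projection of
`w0` onto `V_h`. -/
structure IsSemidiscrete (μ ν wd c0 c1 lam : ℝ) (w0 : H1) (m : Mesh) (wh : ℝ → H1) : Prop where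
  mem : ∀ t : ℝ, 0 ≤ t → wh t ∈ m.V
  continuousOn : ContinuousOn wh (Ici 0)
  differentiableAt : ∀ t : ℝ, 0 < t → DifferentiableAt ℝ wh t
  initial : IsProjection lam m w0 (wh 0)
  equation : ∀ t : ℝ, 0 < t → ∀ χ ∈ m.V, weakForm μ ν wd c0 c1 (wh t) (deriv wh t) χ = 0

/-- The three error bounds with constant `C`, for all weak solutions with initial value `w0`, all
meshes and semidiscrete solutions, all admissible rates `α` and all times `t ≥ 0`. The norm of the
type `H1` is `‖·‖_1`, and `‖val v‖` is the `L²` norm of `v`. -/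
def ErrorBounds (μ ν wd c0 c1 lam : ℝ) (w0 : H1) (C : ℝ) : Prop :=
  ∀ w : ℝ → H1, IsWeakSolution μ ν wd c0 c1 w0 w →
  ∀ (m : Mesh) (wh : ℝ → H1), IsSemidiscrete μ ν wd c0 c1 lam w0 m wh →
  ∀ α : ℝ, 0 ≤ α → α ≤ alphaMax μ ν wd c0 c1 → ∀ t : ℝ, 0 ≤ t →
    ‖val (w t - wh t)‖ ≤ C * (1 / √μ * m.h ^ 2 * Real.exp (-α * t)) ∧
    ‖w t - wh t‖ ≤ C * (1 / √μ * m.h * Real.exp (-α * t)) ∧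
    tnorm (w t - wh t) ≤ C * (m.h * Real.exp (-α * t))

end BBMB

end

noncomputable section

namespace BBMB

/-! ### Calculus in `H¹(0,1)` -/

/-! Write `z = w_t` and split `w - w_h = η + ζ`, where `η` is the nodal interpolation error of `w`
and `ζ` lies in `V_h`. In one dimension the nodal interpolant is also the projection in the H¹
seminorm (`Mesh.inner_dx_intErr`), and it is exact at 0 and 1. Hence `η` drops out of the `ν`-term,
the `μ`-term and all boundary terms of the error equation (`difference_identity`); it survives only
in `(η_t, χ)` and in convective terms, collected in `remainder`.

Spatial regularity. The equation says that the flux `μ w_xt + ν w_x` has weak derivative `w_t + (1 +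
w_d) w_x + w w_x` (`exists_flux`). So `μ η_t + ν η` is the interpolation error of an H² function: it
is of order h² in L² and of order h in the H¹ seminorm, with constants that do not degenerate as `μ
→ 0` (`interp_flux_le`). In turn `η` solves a relaxation equation in time driven by this small
quantity (`relaxation_le`, `relaxation_bound`). No bound on `w_xx` is needed for positive times.

Decay. The cubic feedback absorbs the boundary flux of convection (`cube_le`). Testing with the
state gives exponential decay in an integrated sense, and testing with the time derivative gives it
pointwise. Both tests are admissible for `w` and for `w_h` (`traj_bounds`). Every Gronwall argument
carries the weight `exp (2αt)` and has a growth coefficient that is integrable over all times, so no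
constant depends on `t` (`gronwall_weighted`). Bounds for `w_t` come from comparing `w` with its
time shifts (`shift_stability`, `deriv_stability`). They involve `μ` through the initial size of
`w_t`, which compatible data bound uniformly in `μ` (`IsCompatible.initial_deriv_le`).

Error. For the H¹ estimate, an energy and a potential of `ζ` plus a multiple of `μ‖η_x‖²` satisfy a
Gronwall inequality with source of order h²; here `‖η_t‖ ≤ h‖w_xt‖` is good enough. For the L²
estimate that bound loses a power of h. So `(η, ζ)` is added to the energy, which trades `(η_t, ζ)`
for `(η, ζ_t)`. The latter is absorbed by `μ‖ζ_t‖²`, which `μ` times the potential inequality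
supplies; the price is `‖η‖²/μ`, and this is the origin of the factor `μ^{-1/2}`
(`weakFunctional_dissipation`). -/

/-- The continuous representative of `v ∈ H¹(0,1)`. -/
def rep (v : H1) (x : ℝ) : ℝ := at0 v + ∫ y in (0 : ℝ)..x, dx v y

theorem val_ae_eq_rep (v : H1) : ∀ᵐ x ∂unitMeasure, val v x = rep v x := by
  obtain ⟨f, -, h1, h2, h3, -⟩ := exists_rep v
  filter_upwards [h1, ae_restrict_mem measurableSet_Ioo] with x hx hx'
  rw [hx, h2 x (Ioo_subset_Icc_self hx'), h3, rep]

@[simp] theorem rep_zero (v : H1) : rep v 0 = at0 v := by simp [rep]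

@[simp] theorem rep_one (v : H1) : rep v 1 = at1 v := by
  obtain ⟨f, -, -, h2, h3, h4⟩ := exists_rep v
  rw [← h4, h2 1 (by simp), h3, rep]

theorem rep_absCont (v : H1) : AbsolutelyContinuousOnInterval (rep v) 0 1 := by
  have h := (intervalIntegrable_L2 (dx v)).absolutelyContinuousOnInterval_intervalIntegral
    (c := 0) (by simp)
  have := (absCont_of_contDiff (f := fun _ => at0 v) contDiff_const 0 1).add h
  exact this

theorem rep_continuousOn (v : H1) : ContinuousOn (rep v) (Icc 0 1) := by
  simpa using (rep_absCont v).continuousOn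

theorem rep_hasDerivAt (v : H1) : ∀ᵐ x : ℝ, x ∈ uIcc (0 : ℝ) 1 → HasDerivAt (rep v) (dx v x) x := by
  filter_upwards [(intervalIntegrable_L2 (dx v)).ae_hasDerivAt_integral] with x hx hx'
  exact (hx hx' 0 (by simp)).const_add _

theorem ae_unit_iff {p : ℝ → Prop} :
    (∀ᵐ x ∂unitMeasure, p x) ↔ ∀ᵐ x : ℝ, x ∈ uIoc (0 : ℝ) 1 → p x := by
  rw [uIoc_of_le zero_le_one, ← ae_restrict_iff' measurableSet_Ioc, unitMeasure,
    restrict_Ioo_eq_restrict_Ioc]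

theorem integrable_sq_L2 (g : L2) : IntervalIntegrable (fun x => g x ^ 2) volume 0 1 := by
  rw [intervalIntegrable_iff_integrableOn_Ioo_of_le zero_le_one]
  exact (Lp.memLp g).integrable_sq

theorem norm_sq_eq_integral (g : L2) : ‖g‖ ^ 2 = ∫ x in (0 : ℝ)..1, g x ^ 2 := by
  rw [← real_inner_self_eq_norm_sq, L2.inner_def, setIntegral_unit]
  simp [pow_two]

theorem inner_eq_integral (g k : L2) : inner ℝ g k = ∫ x in (0 : ℝ)..1, g x * k x := by
  rw [L2.inner_def, setIntegral_unit]
  simp [mul_comm]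

/-- Cauchy–Schwarz against the constant 1, from the nonnegativity of the integral of `((b - a) g -
m)²`. The factor is the length of the interval, which later becomes a power of `h`. -/
theorem sq_integral_le (g : L2) {a b : ℝ} (ha : 0 ≤ a) (hab : a ≤ b) (hb : b ≤ 1) :
    (∫ x in a..b, g x) ^ 2 ≤ (b - a) * ∫ x in a..b, g x ^ 2 := by
  rcases hab.eq_or_lt with rfl | hlt
  · simp
  have hsub : uIcc a b ⊆ uIcc 0 1 := by
    rw [uIcc_of_le hab, uIcc_of_le zero_le_one]
    exact Icc_subset_Icc ha hb
  have i1 := (intervalIntegrable_L2 g).mono_set hsub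
  have i2 := (integrable_sq_L2 g).mono_set hsub
  set m := ∫ x in a..b, g x with hm
  have h0 : 0 ≤ ∫ x in a..b, ((b - a) * g x - m) ^ 2 :=
    intervalIntegral.integral_nonneg hab fun x _ => sq_nonneg _
  have h1 : ∫ x in a..b, ((b - a) * g x - m) ^ 2 =
      (b - a) ^ 2 * (∫ x in a..b, g x ^ 2) - 2 * (b - a) * m * m + m ^ 2 * (b - a) := by
    have : ∀ x, ((b - a) * g x - m) ^ 2 =
        (b - a) ^ 2 * g x ^ 2 - 2 * (b - a) * m * g x + m ^ 2 := fun x => by ring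
    simp_rw [this]
    rw [intervalIntegral.integral_add ((i2.const_mul _).sub (i1.const_mul _)) (by simp),
      intervalIntegral.integral_sub (i2.const_mul _) (i1.const_mul _),
      intervalIntegral.integral_const_mul, intervalIntegral.integral_const_mul]
    simp [← hm, mul_comm]
  rw [h1] at h0
  have h2 : 0 ≤ (b - a) * ((b - a) * (∫ x in a..b, g x ^ 2) - m ^ 2) := by nlinarith
  have := nonneg_of_mul_nonneg_right h2 (by linarith)
  linarith

/-- The square of `|||v|||`. -/
def tsq (v : H1) : ℝ := at0 v ^ 2 + at1 v ^ 2 + ‖dx v‖ ^ 2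

theorem tsq_nonneg (v : H1) : 0 ≤ tsq v := by unfold tsq; positivity

theorem tnorm_sq (v : H1) : tnorm v ^ 2 = tsq v := Real.sq_sqrt (tsq_nonneg v)

theorem integral_sq_mono (g : L2) {a b : ℝ} (ha : 0 ≤ a) (hab : a ≤ b) (hb : b ≤ 1) :
    ∫ x in a..b, g x ^ 2 ≤ ‖g‖ ^ 2 := by
  rw [norm_sq_eq_integral]
  exact intervalIntegral.integral_mono_interval ha hab hb
    (Filter.Eventually.of_forall fun x => sq_nonneg _) (integrable_sq_L2 g)

/-- The one-dimensional Sobolev embedding, from `v(x) = v(0) + ∫₀ˣ v_x`. Products with an H¹ factor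
are controlled through this supremum bound. -/
theorem rep_sq_le (v : H1) {x : ℝ} (hx : x ∈ Icc (0 : ℝ) 1) : rep v x ^ 2 ≤ 2 * tsq v := by
  have h1 := sq_integral_le (dx v) le_rfl hx.1 hx.2
  have h2 := integral_sq_mono (dx v) le_rfl hx.1 hx.2
  have h3 : 0 ≤ ∫ y in (0 : ℝ)..x, dx v y ^ 2 :=
    intervalIntegral.integral_nonneg hx.1 fun x _ => sq_nonneg _
  have h4 : (∫ y in (0 : ℝ)..x, dx v y) ^ 2 ≤ ‖dx v‖ ^ 2 := by nlinarith [hx.1, hx.2]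
  unfold rep tsq
  nlinarith [sq_nonneg (at0 v - ∫ y in (0 : ℝ)..x, dx v y), sq_nonneg (at1 v)]

theorem val_sq_le (v : H1) : ∀ᵐ x ∂unitMeasure, val v x ^ 2 ≤ 2 * tsq v := by
  filter_upwards [val_ae_eq_rep v, ae_restrict_mem measurableSet_Ioo] with x hx hx'
  rw [hx]
  exact rep_sq_le v (Ioo_subset_Icc_self hx')

theorem abs_val_le (v : H1) : ∀ᵐ x ∂unitMeasure, |val v x| ≤ √2 * tnorm v := by
  filter_upwards [val_sq_le v] with x hx
  refine abs_le_of_sq_le_sq ?_ (by unfold tnorm; positivity)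
  rw [mul_pow, tnorm_sq]
  simpa using hx

/-- Integrating the derivative of a product of three elements of `H¹(0,1)`. -/
theorem integral_product_rule (u v w : H1) :
    ∫ x in (0 : ℝ)..1, (dx u x * val v x * val w x + val u x * dx v x * val w x
      + val u x * val v x * dx w x) =
      at1 u * at1 v * at1 w - at0 u * at0 v * at0 w := by
  have hac := ((rep_absCont u).fun_mul (rep_absCont v)).fun_mul (rep_absCont w)
  have := hac.integral_deriv_eq_sub
  simp only [rep_one, rep_zero] at this
  rw [← this]
  refine intervalIntegral.integral_congr_ae ?_
  filter_upwards [rep_hasDerivAt u, rep_hasDerivAt v, rep_hasDerivAt w,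
    ae_unit_iff.1 (val_ae_eq_rep u), ae_unit_iff.1 (val_ae_eq_rep v),
    ae_unit_iff.1 (val_ae_eq_rep w)] with x h1 h2 h3 h4 h5 h6 hx
  have hx' := uIoc_subset_uIcc hx
  rw [(((h1 hx').fun_mul (h2 hx')).fun_mul (h3 hx')).deriv, h4 hx, h5 hx, h6 hx]
  ring

theorem integral_product_rule₂ (u v : H1) :
    ∫ x in (0 : ℝ)..1, (dx u x * val v x + val u x * dx v x) =
      at1 u * at1 v - at0 u * at0 v := by
  have hac := (rep_absCont u).fun_mul (rep_absCont v)
  have := hac.integral_deriv_eq_sub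
  simp only [rep_one, rep_zero] at this
  rw [← this]
  refine intervalIntegral.integral_congr_ae ?_
  filter_upwards [rep_hasDerivAt u, rep_hasDerivAt v,
    ae_unit_iff.1 (val_ae_eq_rep u), ae_unit_iff.1 (val_ae_eq_rep v)] with x h1 h2 h4 h5 hx
  have hx' := uIoc_subset_uIcc hx
  rw [((h1 hx').fun_mul (h2 hx')).deriv, h4 hx, h5 hx]

theorem intervalIntegrable_mul_L2 (g k : L2) :
    IntervalIntegrable (fun x => g x * k x) volume 0 1 := by
  rw [intervalIntegrable_iff_integrableOn_Ioo_of_le zero_le_one]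
  exact (Lp.memLp g).integrable_mul (Lp.memLp k)

theorem inner_dx_val_add (u v : H1) :
    inner ℝ (dx u) (val v) + inner ℝ (val u) (dx v) = at1 u * at1 v - at0 u * at0 v := by
  rw [← integral_product_rule₂, inner_eq_integral, inner_eq_integral,
    intervalIntegral.integral_add (intervalIntegrable_mul_L2 _ _) (intervalIntegrable_mul_L2 _ _)]

/-- The Poincaré inequality `‖v‖ ≤ |||v|||`. -/
theorem norm_val_sq_le (v : H1) : ‖val v‖ ^ 2 ≤ tsq v := by
  -- Integrating `((2x - 1) v²)'` produces exactly `v(1)² + v(0)²`, and `|2x - 1| ≤ 1` gives the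
  -- inequality with constant one. The conditions in `Rate` rely on this constant.
  have hl : AbsolutelyContinuousOnInterval (fun x : ℝ => 2 * x - 1) 0 1 :=
    absCont_of_contDiff (by fun_prop) 0 1
  have hac := (hl.fun_mul (rep_absCont v)).fun_mul (rep_absCont v)
  have h0 := hac.integral_deriv_eq_sub
  simp only [rep_one, rep_zero] at h0
  have iv := integrable_sq_L2 (val v)
  have ig := integrable_sq_L2 (dx v)
  have h1 : ∫ x in (0 : ℝ)..1, (val v x ^ 2 - dx v x ^ 2) ≤ at1 v * at1 v + at0 v * at0 v := by
    have e : at1 v * at1 v + at0 v * at0 v =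
      (2 * 1 - 1) * at1 v * at1 v - (2 * 0 - 1) * at0 v * at0 v := by ring
    rw [e, ← h0]
    refine intervalIntegral.integral_mono_ae_restrict zero_le_one (iv.sub ig)
      hac.intervalIntegrable_deriv ?_
    have := ae_unit_iff.2 ((rep_hasDerivAt v).mono fun x hx hx' => hx (uIoc_subset_uIcc hx'))
    have h2 : ∀ᵐ x ∂unitMeasure, val v x ^ 2 - dx v x ^ 2 ≤
        deriv (fun x => (2 * x - 1) * rep v x * rep v x) x := by
      filter_upwards [this, val_ae_eq_rep v, ae_restrict_mem measurableSet_Ioo] with x h3 h4 h5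
      have h6 : HasDerivAt (fun x : ℝ => 2 * x - 1) 2 x := by
        simpa using ((hasDerivAt_id x).const_mul 2).sub_const 1
      rw [((h6.fun_mul h3).fun_mul h3).deriv, ← h4]
      have h7 : (2 * x - 1) ^ 2 ≤ 1 := by nlinarith [h5.1, h5.2]
      nlinarith [sq_nonneg (val v x + (2 * x - 1) * dx v x),
        mul_nonneg (sub_nonneg.2 h7) (sq_nonneg (dx v x))]
    rw [← restrict_Ioo_eq_restrict_Icc]
    exact h2
  rw [intervalIntegral.integral_sub iv ig, ← norm_sq_eq_integral, ← norm_sq_eq_integral] at h1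
  unfold tsq
  nlinarith

/-! ### Value, derivative and traces as bounded linear maps -/

/-- `v ↦ v` as a continuous linear map `H¹ → L²`. -/
def valL : H1 →L[ℝ] L2 := (WithLp.fstL 2 ℝ L2 L2).comp H1.subtypeL

/-- `v ↦ v_x` as a continuous linear map `H¹ → L²`. -/
def dxL : H1 →L[ℝ] L2 := (WithLp.sndL 2 ℝ L2 L2).comp H1.subtypeL

@[simp] theorem valL_apply (v : H1) : valL v = val v := rfl
@[simp] theorem dxL_apply (v : H1) : dxL v = dx v := rfl

theorem norm_sq_H1 (v : H1) : ‖v‖ ^ 2 = ‖val v‖ ^ 2 + ‖dx v‖ ^ 2 :=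
  WithLp.prod_norm_sq_eq_of_L2 (v : WithLp 2 (L2 × L2))

theorem norm_val_le (v : H1) : ‖val v‖ ≤ ‖v‖ :=
  abs_le_of_sq_le_sq' (by nlinarith [norm_sq_H1 v, sq_nonneg ‖dx v‖]) (norm_nonneg v) |>.2

theorem norm_dx_le (v : H1) : ‖dx v‖ ≤ ‖v‖ :=
  abs_le_of_sq_le_sq' (by nlinarith [norm_sq_H1 v, sq_nonneg ‖val v‖]) (norm_nonneg v) |>.2

theorem memLp_of_continuous {f : ℝ → ℝ} (hf : ContinuousOn f (Icc 0 1)) : MemLp f 2 unitMeasure := by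
  obtain ⟨C, hC⟩ := isCompact_Icc.exists_bound_of_continuousOn hf
  have hm : AEStronglyMeasurable f unitMeasure :=
    (hf.mono Ioo_subset_Icc_self).aestronglyMeasurable measurableSet_Ioo
  refine MemLp.of_bound hm C ?_
  filter_upwards [ae_restrict_mem measurableSet_Ioo] with x hx
  exact hC x (Ioo_subset_Icc_self hx)

/-- A continuous function as an element of `L²(0,1)`. -/
def ofCont (f : ℝ → ℝ) (hf : ContinuousOn f (Icc 0 1)) : L2 := (memLp_of_continuous hf).toLp f

theorem ofCont_ae {f : ℝ → ℝ} (hf : ContinuousOn f (Icc 0 1)) :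
    ∀ᵐ x ∂unitMeasure, ofCont f hf x = f x := (memLp_of_continuous hf).coeFn_toLp

theorem inner_ofCont {f : ℝ → ℝ} (hf : ContinuousOn f (Icc 0 1)) (g : L2) :
    inner ℝ (ofCont f hf) g = ∫ x, f x * g x ∂unitMeasure := by
  rw [L2.inner_def]
  refine integral_congr_ae ?_
  filter_upwards [ofCont_ae hf] with x hx
  simp [hx, mul_comm]

/-- The trace `v ↦ v(0)`. -/
def at0L : H1 →L[ℝ] ℝ :=
  (innerSL ℝ (ofCont (fun _ => 1) continuousOn_const)).comp valL
    - (innerSL ℝ (ofCont (fun x => 1 - x) (by fun_prop))).comp dxL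

/-- The trace `v ↦ v(1)`. -/
def at1L : H1 →L[ℝ] ℝ :=
  (innerSL ℝ (ofCont (fun _ => 1) continuousOn_const)).comp valL
    + (innerSL ℝ (ofCont (fun x => x) (by fun_prop))).comp dxL

theorem integrable_cont_mul {f : ℝ → ℝ} (hf : ContinuousOn f (Icc 0 1)) (g : L2) :
    Integrable (fun x => f x * g x) unitMeasure :=
  (memLp_of_continuous hf).integrable_mul (Lp.memLp g)

@[simp] theorem at0L_apply (v : H1) : at0L v = at0 v := by
  have h1 := integrable_cont_mul (f := fun _ => 1) continuousOn_const (val v)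
  have h2 := integrable_cont_mul (f := fun x => 1 - x) (by fun_prop) (dx v)
  simp only [at0L, sub_apply, ContinuousLinearMap.comp_apply, valL_apply,
    dxL_apply, innerSL_apply_apply, inner_ofCont]
  rw [← integral_sub h1 h2]
  simp [at0]

@[simp] theorem at1L_apply (v : H1) : at1L v = at1 v := by
  have h1 := integrable_cont_mul (f := fun _ => 1) continuousOn_const (val v)
  have h2 := integrable_cont_mul (f := fun x => x) (by fun_prop) (dx v)
  simp only [at1L, add_apply, ContinuousLinearMap.comp_apply, valL_apply,
    dxL_apply, innerSL_apply_apply, inner_ofCont]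
  rw [← integral_add h1 h2]
  simp [at1]

@[simp] theorem val_add (u v : H1) : val (u + v) = val u + val v := map_add valL u v
@[simp] theorem val_sub (u v : H1) : val (u - v) = val u - val v := map_sub valL u v
@[simp] theorem val_smul (c : ℝ) (v : H1) : val (c • v) = c • val v := map_smul valL c v
@[simp] theorem dx_add (u v : H1) : dx (u + v) = dx u + dx v := map_add dxL u v
@[simp] theorem dx_sub (u v : H1) : dx (u - v) = dx u - dx v := map_sub dxL u v
@[simp] theorem dx_smul (c : ℝ) (v : H1) : dx (c • v) = c • dx v := map_smul dxL c v
@[simp] theorem val_zero : val 0 = 0 := map_zero valL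
@[simp] theorem dx_zero : dx 0 = 0 := map_zero dxL
@[simp] theorem at0_zero : at0 0 = 0 := by simpa using map_zero at0L
@[simp] theorem at1_zero : at1 0 = 0 := by simpa using map_zero at1L
@[simp] theorem at0_add (u v : H1) : at0 (u + v) = at0 u + at0 v := by simpa using map_add at0L u v
@[simp] theorem at0_sub (u v : H1) : at0 (u - v) = at0 u - at0 v := by simpa using map_sub at0L u v
@[simp] theorem at0_smul (c : ℝ) (v : H1) : at0 (c • v) = c * at0 v := by
  rw [← at0L_apply, map_smul, at0L_apply, smul_eq_mul]
@[simp] theorem at1_add (u v : H1) : at1 (u + v) = at1 u + at1 v := by simpa using map_add at1L u v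
@[simp] theorem at1_sub (u v : H1) : at1 (u - v) = at1 u - at1 v := by simpa using map_sub at1L u v
@[simp] theorem at1_smul (c : ℝ) (v : H1) : at1 (c • v) = c * at1 v := by
  rw [← at1L_apply, map_smul, at1L_apply, smul_eq_mul]

theorem continuous_val : Continuous val := valL.continuous
theorem continuous_dx : Continuous dx := dxL.continuous
theorem continuous_at0 : Continuous at0 := by
  have h := at0L.continuous
  rwa [show (at0L : H1 → ℝ) = at0 from funext at0L_apply] at h
theorem continuous_at1 : Continuous at1 := by
  have h := at1L.continuous
  rwa [show (at1L : H1 → ℝ) = at1 from funext at1L_apply] at h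

theorem continuous_tsq : Continuous tsq :=
  ((continuous_at0.pow 2).add (continuous_at1.pow 2)).add (continuous_dx.norm.pow 2)

/-- Boundedness of the traces. With `norm_sq_le_tsq` it makes the triple norm equivalent to the H¹
norm. -/
theorem exists_tsq_le : ∃ C : ℝ, 0 < C ∧ ∀ v : H1, tsq v ≤ C * ‖v‖ ^ 2 := by
  refine ⟨‖at0L‖ ^ 2 + ‖at1L‖ ^ 2 + 1, by positivity, fun v => ?_⟩
  have h0 := pow_le_pow_left₀ (norm_nonneg _) (at0L.le_opNorm v) 2
  have h1 := pow_le_pow_left₀ (norm_nonneg _) (at1L.le_opNorm v) 2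
  have h2 := pow_le_pow_left₀ (norm_nonneg _) (norm_dx_le v) 2
  simp only [at0L_apply, at1L_apply, Real.norm_eq_abs, sq_abs, mul_pow] at h0 h1
  unfold tsq
  linarith

theorem norm_sq_le_tsq (v : H1) : ‖v‖ ^ 2 ≤ 2 * tsq v := by
  have h1 := norm_val_sq_le v
  have h2 : ‖dx v‖ ^ 2 ≤ tsq v := by
    unfold tsq
    nlinarith [sq_nonneg (at0 v), sq_nonneg (at1 v)]
  rw [norm_sq_H1]
  linarith

/-- The continuous representative is the value at 0 plus the primitive of the derivative. Identities
in H¹, such as the linearity of `primFun`, reduce to these two data. -/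
theorem H1_ext {u v : H1} (h0 : at0 u = at0 v) (h : dx u = dx v) : u = v := by
  have e : ∀ x, rep u x = rep v x := fun x => by simp [rep, h0, h]
  have h1 : at1 u = at1 v := by rw [← rep_one, e, rep_one]
  have h2 : tsq (u - v) = 0 := by simp [tsq, h0, h1, h]
  have h3 := norm_sq_le_tsq (u - v)
  rw [h2] at h3
  have : ‖u - v‖ = 0 := by nlinarith [norm_nonneg (u - v)]
  rwa [norm_eq_zero, sub_eq_zero] at this

/-! ### Multiplication `H¹ × L² → L²` -/

theorem memLp_mul (v : H1) (g : L2) : MemLp (fun x => val v x * g x) 2 unitMeasure := by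
  refine (Lp.memLp g).of_le_mul (c := √2 * tnorm v)
    ((Lp.aestronglyMeasurable _).mul (Lp.aestronglyMeasurable _)) ?_
  filter_upwards [abs_val_le v] with x hx
  rw [norm_mul]
  gcongr
  exact hx

/-- The product of `v ∈ H¹` and `g ∈ L²`. -/
def pmul (v : H1) (g : L2) : L2 := (memLp_mul v g).toLp _

theorem pmul_ae (v : H1) (g : L2) : ∀ᵐ x ∂unitMeasure, pmul v g x = val v x * g x :=
  (memLp_mul v g).coeFn_toLp

theorem norm_pmul_sq_le (v : H1) (g : L2) : ‖pmul v g‖ ^ 2 ≤ 2 * tsq v * ‖g‖ ^ 2 := by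
  rw [norm_sq_eq_integral, norm_sq_eq_integral, ← intervalIntegral.integral_const_mul]
  refine intervalIntegral.integral_mono_ae_restrict zero_le_one (integrable_sq_L2 _)
    ((integrable_sq_L2 _).const_mul _) ?_
  rw [← restrict_Ioo_eq_restrict_Icc]
  filter_upwards [pmul_ae v g, val_sq_le v] with x h1 h2
  rw [h1, mul_pow]
  gcongr

theorem inner_pmul (v : H1) (g k : L2) :
    inner ℝ (pmul v g) k = ∫ x, val v x * g x * k x ∂unitMeasure := by
  rw [L2.inner_def]
  refine integral_congr_ae ?_
  filter_upwards [pmul_ae v g] with x hx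
  simp [hx, mul_comm]

theorem norm_pmul_le (v : H1) (g : L2) : ‖pmul v g‖ ≤ √2 * tnorm v * ‖g‖ := by
  refine abs_le_of_sq_le_sq' ?_ (by unfold tnorm; positivity) |>.2
  rw [mul_pow, mul_pow, tnorm_sq]
  simpa using norm_pmul_sq_le v g

theorem coe_add_ae (g k : L2) : ∀ᵐ x ∂unitMeasure, (g + k) x = g x + k x := Lp.coeFn_add g k
theorem coe_smul_ae (c : ℝ) (g : L2) : ∀ᵐ x ∂unitMeasure, (c • g) x = c * g x :=
  Lp.coeFn_smul c g

/-- Multiplication as a continuous bilinear map. -/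
def mulL : H1 →L[ℝ] L2 →L[ℝ] L2 :=
  LinearMap.mkContinuousOfExistsBound₂
    (LinearMap.mk₂ ℝ pmul
      (fun u v g => by
        refine Lp.ext ?_
        filter_upwards [pmul_ae (u + v) g, pmul_ae u g, pmul_ae v g,
          coe_add_ae (pmul u g) (pmul v g), coe_add_ae (val u) (val v)] with x h1 h2 h3 h4 h5
        rw [h1, h4, h2, h3, val_add, h5]
        ring)
      (fun c v g => by
        refine Lp.ext ?_
        filter_upwards [pmul_ae (c • v) g, pmul_ae v g, coe_smul_ae c (pmul v g),
          coe_smul_ae c (val v)] with x h1 h2 h3 h4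
        rw [h1, h3, h2, val_smul, h4]
        ring)
      (fun v g k => by
        refine Lp.ext ?_
        filter_upwards [pmul_ae v (g + k), pmul_ae v g, pmul_ae v k,
          coe_add_ae (pmul v g) (pmul v k), coe_add_ae g k] with x h1 h2 h3 h4 h5
        rw [h1, h4, h2, h3, h5]
        ring)
      (fun c v g => by
        refine Lp.ext ?_
        filter_upwards [pmul_ae v (c • g), pmul_ae v g, coe_smul_ae c (pmul v g),
          coe_smul_ae c g] with x h1 h2 h3 h4
        rw [h1, h3, h2, h4]
        ring))
    (by
      obtain ⟨C, hC0, hC⟩ := exists_tsq_le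
      refine ⟨√2 * √C, fun v g => (norm_pmul_le v g).trans ?_⟩
      rw [mul_assoc (√2) (√C)]
      refine mul_le_mul_of_nonneg_right
        (mul_le_mul_of_nonneg_left ?_ (Real.sqrt_nonneg 2)) (norm_nonneg g)
      unfold tnorm
      refine (Real.sqrt_le_sqrt (hC v)).trans ?_
      rw [Real.sqrt_mul hC0.le, Real.sqrt_sq (norm_nonneg _)])

theorem pmul_add_left (u v : H1) (g : L2) : pmul (u + v) g = pmul u g + pmul v g := by
  exact DFunLike.congr_fun (map_add mulL u v) g
theorem pmul_sub_right (v : H1) (g k : L2) : pmul v (g - k) = pmul v g - pmul v k :=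
  map_sub (mulL v) g k

theorem pmul_val_comm (u v : H1) : pmul u (val v) = pmul v (val u) := by
  refine Lp.ext ?_
  filter_upwards [pmul_ae u (val v), pmul_ae v (val u)] with x h1 h2
  rw [h1, h2, mul_comm]

theorem inner_pmul_left (v : H1) (g k : L2) : inner ℝ (pmul v g) k = inner ℝ g (pmul v k) := by
  rw [inner_pmul, real_inner_comm, inner_pmul]
  simp only [mul_right_comm]

theorem inner_product_rule (u v w : H1) :
    inner ℝ (pmul v (dx u)) (val w) + inner ℝ (pmul u (dx v)) (val w)
      + inner ℝ (pmul u (val v)) (dx w) =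
      at1 u * at1 v * at1 w - at0 u * at0 v * at0 w := by
  rw [← integral_product_rule, inner_eq_integral, inner_eq_integral, inner_eq_integral,
    ← intervalIntegral.integral_add (intervalIntegrable_mul_L2 _ _) (intervalIntegrable_mul_L2 _ _),
    ← intervalIntegral.integral_add
      ((intervalIntegrable_mul_L2 _ _).add (intervalIntegrable_mul_L2 _ _))
      (intervalIntegrable_mul_L2 _ _)]
  refine intervalIntegral.integral_congr_ae ?_
  filter_upwards [ae_unit_iff.1 (pmul_ae v (dx u)), ae_unit_iff.1 (pmul_ae u (dx v)),
    ae_unit_iff.1 (pmul_ae u (val v))] with x h1 h2 h3 hx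
  rw [h1 hx, h2 hx, h3 hx]
  ring

/-- Since `w² w_x = (w³/3)_x`, nonlinear convection does no work in the interior. Only a cubic
boundary flux remains, which the feedback has to absorb. -/
theorem inner_pmul_dx_self (w : H1) :
    inner ℝ (pmul w (dx w)) (val w) = (at1 w ^ 3 - at0 w ^ 3) / 3 := by
  have h := inner_product_rule w w w
  have e : inner ℝ (pmul w (val w)) (dx w) = inner ℝ (pmul w (dx w)) (val w) := by
    rw [inner_pmul_left, real_inner_comm]
  rw [e] at h
  linarith

theorem inner_dx_val_self (w : H1) : inner ℝ (dx w) (val w) = (at1 w ^ 2 - at0 w ^ 2) / 2 := by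
  have h := inner_dx_val_add w w
  rw [real_inner_comm (dx w) (val w)] at h
  linarith

/-! ### Primitives -/

theorem continuousOn_primitive_L2 (g : L2) :
    ContinuousOn (fun x => ∫ y in (0 : ℝ)..x, g y) (Icc 0 1) := by
  simpa using ((intervalIntegrable_L2 g).absolutelyContinuousOnInterval_intervalIntegral
    (c := 0) (by simp)).continuousOn

theorem isWeakDeriv_primitive (g : L2) :
    IsWeakDeriv (ofCont _ (continuousOn_primitive_L2 g)) g := by
  intro φ hφ
  have h1 : φ 1 = 0 := image_eq_zero_of_notMem_tsupport fun h => lt_irrefl _ (hφ.support h).2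
  have h2 := integral_primitive_mul_deriv g (hφ.smooth.of_le (by simp))
  rw [h1, mul_zero, zero_sub, ← setIntegral_unit, ← setIntegral_unit] at h2
  rw [← h2]
  refine integral_congr_ae ?_
  filter_upwards [ofCont_ae (continuousOn_primitive_L2 g)] with x hx
  rw [hx]

/-- The primitive of `g ∈ L²` vanishing at `0`. -/
def primFun (g : L2) : H1 :=
  ⟨WithLp.toLp 2 (ofCont _ (continuousOn_primitive_L2 g), g), isWeakDeriv_primitive g⟩

@[simp] theorem dx_primFun (g : L2) : dx (primFun g) = g := rfl

instance : NeZero unitMeasure := ⟨by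
  rw [Ne, Measure.restrict_eq_zero]
  simp⟩

@[simp] theorem at0_primFun (g : L2) : at0 (primFun g) = 0 := by
  have h : ∀ᵐ x ∂unitMeasure, at0 (primFun g) = 0 := by
    filter_upwards [val_ae_eq_rep (primFun g), ofCont_ae (continuousOn_primitive_L2 g)] with x h1 h2
    have h3 : val (primFun g) x = ∫ y in (0 : ℝ)..x, g y := h2
    rw [rep, dx_primFun, h3] at h1
    linarith
  exact h.exists.choose_spec

theorem at1_primFun (g : L2) : at1 (primFun g) = ∫ y in (0 : ℝ)..1, g y := by
  rw [← rep_one]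
  simp [rep]

theorem tsq_primFun_le (g : L2) : tsq (primFun g) ≤ 2 * ‖g‖ ^ 2 := by
  have h1 := sq_integral_le g le_rfl zero_le_one le_rfl
  rw [← norm_sq_eq_integral] at h1
  simp only [tsq, at0_primFun, at1_primFun, dx_primFun]
  linarith

/-- `primFun` as a continuous linear map. -/
def primL : L2 →L[ℝ] H1 :=
  LinearMap.mkContinuousOfExistsBound
    { toFun := primFun
      map_add' := fun g k => H1_ext (by simp) (by simp)
      map_smul' := fun c g => H1_ext (by simp) (by simp) }
    ⟨2, fun g => by
      refine abs_le_of_sq_le_sq' ?_ (by positivity) |>.2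
      have h1 := tsq_primFun_le g
      have h2 := norm_sq_le_tsq (primFun g)
      calc ‖primFun g‖ ^ 2 ≤ (2 * ‖g‖) ^ 2 := by linarith
        _ = _ := rfl⟩

@[simp] theorem primL_apply (g : L2) : primL g = primFun g := rfl

/-! ### Piecewise constant functions and interpolation -/

namespace Mesh

variable (m : Mesh)

/-- The nodes, indexed by the natural numbers. -/
def pt (k : ℕ) : ℝ := m.node ⟨min k m.N, by omega⟩

theorem pt_castSucc (j : Fin m.N) : m.node j.castSucc = m.pt j := by
  unfold pt
  congr 1
  ext
  simp [j.2.le]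

theorem pt_succ (j : Fin m.N) : m.node j.succ = m.pt (j + 1) := by
  unfold pt
  congr 1
  ext
  simp [Nat.succ_le_of_lt j.2]

theorem pt_zero : m.pt 0 = 0 := by
  rw [← m.first]
  unfold pt
  congr 1

theorem pt_N : m.pt m.N = 1 := by
  rw [← m.last]
  unfold pt
  congr 1
  ext
  simp

/-- The index is truncated at `N`, so the sequence stays at 1 beyond the last node and is monotone
on all of `ℕ`. -/
theorem pt_mono : Monotone m.pt := fun i j hij =>
  m.strictMono.monotone (by
    rw [Fin.le_def]
    exact min_le_min_right _ hij)

theorem pt_mem (k : ℕ) : m.pt k ∈ Icc (0 : ℝ) 1 := by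
  constructor
  · rw [← m.pt_zero]
    exact m.pt_mono (Nat.zero_le k)
  · rw [← m.last]
    exact m.strictMono.monotone (Fin.le_last _)

theorem pt_sub_le {k : ℕ} (hk : k < m.N) : m.pt (k + 1) - m.pt k ≤ m.h := by
  have h := le_ciSup (f := fun j : Fin m.N => m.node j.succ - m.node j.castSucc)
    (Set.finite_range _).bddAbove ⟨k, hk⟩
  rw [pt_castSucc, pt_succ] at h
  exact h

theorem h_nonneg : 0 ≤ m.h :=
  (sub_nonneg.2 (m.pt_mono (Nat.le_succ 0))).trans (m.pt_sub_le m.pos)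

theorem h_le_one : m.h ≤ 1 := by
  have : Nonempty (Fin m.N) := ⟨⟨0, m.pos⟩⟩
  refine ciSup_le fun j => ?_
  rw [pt_castSucc, pt_succ]
  linarith [(m.pt_mem j).1, (m.pt_mem (j + 1)).2]

theorem uIcc_pt_subset (i j : ℕ) : uIcc (m.pt i) (m.pt j) ⊆ uIcc 0 1 := by
  rw [uIcc_of_le zero_le_one]
  exact (convex_Icc (0 : ℝ) 1).ordConnected.uIcc_subset (m.pt_mem i) (m.pt_mem j)

theorem sum_integral {f : ℝ → ℝ} (hf : IntervalIntegrable f volume 0 1) (k : ℕ) :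
    ∑ i ∈ Finset.range k, ∫ x in m.pt i..m.pt (i + 1), f x = ∫ x in (0 : ℝ)..m.pt k, f x := by
  rw [intervalIntegral.sum_integral_adjacent_intervals, m.pt_zero]
  exact fun i _ => hf.mono_set (m.uIcc_pt_subset _ _)

/-! ### Piecewise constants and the characterisation of `V_h` -/

/-- The indicator of a mesh interval. -/
def ind (k : ℕ) : L2 :=
  indicatorConstLp 2 (measurableSet_Ioo (a := m.pt k) (b := m.pt (k + 1)))
    (measure_ne_top unitMeasure _) (1 : ℝ)

theorem inner_ind (k : ℕ) (g : L2) :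
    inner ℝ (m.ind k) g = ∫ x in m.pt k..m.pt (k + 1), g x := by
  rw [ind, L2.inner_indicatorConstLp_one, Measure.restrict_restrict measurableSet_Ioo,
    intervalIntegral.integral_of_le (m.pt_mono (Nat.le_succ k)), integral_Ioc_eq_integral_Ioo,
    inter_eq_left.2 (Ioo_subset_Ioo (m.pt_mem k).1 (m.pt_mem (k + 1)).2)]

/-- The piecewise constant functions. -/
def PC : Submodule ℝ L2 := Submodule.span ℝ (range fun j : Fin m.N => m.ind j)

instance : FiniteDimensional ℝ m.PC := FiniteDimensional.span_of_finite ℝ (Set.finite_range _)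

theorem ind_mem {k : ℕ} (hk : k < m.N) : m.ind k ∈ m.PC :=
  Submodule.subset_span ⟨⟨k, hk⟩, rfl⟩

theorem integral_eq_zero_of_mem_orthogonal {r : L2} (hr : r ∈ m.PCᗮ) {k : ℕ} (hk : k < m.N) :
    ∫ x in m.pt k..m.pt (k + 1), r x = 0 := by
  rw [← inner_ind]
  exact (Submodule.mem_orthogonal _ _).1 hr _ (m.ind_mem hk)

/-- For the converse, anything orthogonal to all cell indicators has mean zero on each cell, hence
is orthogonal to every piecewise constant `g`. So `g` lies in the double orthogonal complement,
which is `PC` itself because `PC` is finite-dimensional. -/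
theorem mem_PC_iff {g : L2} : g ∈ m.PC ↔ ∀ k < m.N, ∃ b : ℝ,
    ∀ᵐ x ∂unitMeasure, x ∈ Ioo (m.pt k) (m.pt (k + 1)) → g x = b := by
  constructor
  · intro hg k hk
    induction hg using Submodule.span_induction with
    | mem g hg =>
      obtain ⟨j, rfl⟩ := hg
      refine ⟨if (j : ℕ) = k then 1 else 0, ?_⟩
      filter_upwards [indicatorConstLp_coeFn (p := 2) (c := (1 : ℝ))
        (hs := measurableSet_Ioo (a := m.pt j) (b := m.pt (j + 1)))
        (hμs := measure_ne_top unitMeasure _)] with x hx hx'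
      simp only [ind, hx]
      split_ifs with h
      · subst h
        simp [hx']
      · refine indicator_of_notMem (fun hm => ?_) _
        rcases lt_or_gt_of_ne h with h | h
        · linarith [hm.2, hx'.1, m.pt_mono (Nat.succ_le_of_lt h)]
        · linarith [hm.1, hx'.2, m.pt_mono (Nat.succ_le_of_lt h)]
    | zero =>
      refine ⟨0, ?_⟩
      filter_upwards [Lp.coeFn_zero ℝ 2 unitMeasure] with x hx _
      exact hx
    | add g k' _ _ h1 h2 =>
      obtain ⟨b, hb⟩ := h1
      obtain ⟨c, hc⟩ := h2
      refine ⟨b + c, ?_⟩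
      filter_upwards [hb, hc, coe_add_ae g k'] with x h1 h2 h3 h4
      rw [h3, h1 h4, h2 h4]
    | smul c g _ h1 =>
      obtain ⟨b, hb⟩ := h1
      refine ⟨c * b, ?_⟩
      filter_upwards [hb, coe_smul_ae c g] with x h1 h3 h4
      rw [h3, h1 h4]
  · intro h
    rw [← Submodule.orthogonal_orthogonal m.PC, Submodule.mem_orthogonal]
    intro r hr
    rw [inner_eq_integral, ← m.pt_N, ← m.sum_integral (intervalIntegrable_mul_L2 r g)]
    refine Finset.sum_eq_zero fun k hk => ?_
    have hk := Finset.mem_range.1 hk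
    obtain ⟨b, hb⟩ := h k hk
    have h1 : ∫ x in m.pt k..m.pt (k + 1), r x * g x =
        ∫ x in m.pt k..m.pt (k + 1), r x * b := by
      rw [intervalIntegral.integral_of_le (m.pt_mono (Nat.le_succ k)),
        intervalIntegral.integral_of_le (m.pt_mono (Nat.le_succ k)),
        integral_Ioc_eq_integral_Ioo, integral_Ioc_eq_integral_Ioo]
      refine setIntegral_congr_ae measurableSet_Ioo ?_
      filter_upwards [(ae_restrict_iff' measurableSet_Ioo).1 hb] with x hx hx'
      rw [hx (Ioo_subset_Ioo (m.pt_mem k).1 (m.pt_mem (k + 1)).2 hx') hx']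
    rw [h1, intervalIntegral.integral_mul_const, m.integral_eq_zero_of_mem_orthogonal hr hk,
      zero_mul]

theorem rep_add_integral (v : H1) {a b : ℝ} (ha : a ∈ Icc (0 : ℝ) 1) (hb : b ∈ Icc (0 : ℝ) 1) :
    rep v b = rep v a + ∫ y in a..b, dx v y := by
  have hs : ∀ {c d : ℝ}, c ∈ Icc (0 : ℝ) 1 → d ∈ Icc (0 : ℝ) 1 →
      IntervalIntegrable (dx v) volume c d := fun {c d} hc hd =>
    (intervalIntegrable_L2 (dx v)).mono_set (by
      rw [uIcc_of_le (zero_le_one' ℝ)]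
      exact (convex_Icc (0 : ℝ) 1).ordConnected.uIcc_subset hc hd)
  unfold rep
  rw [add_assoc, intervalIntegral.integral_add_adjacent_intervals (hs (by simp) ha) (hs ha hb)]

/-- Affine on each cell means that the weak derivative is constant there. This turns the definition
of `V_h` by continuous representatives into a linear condition on `v_x`. -/
theorem mem_V_iff (v : H1) : v ∈ m.V ↔ dx v ∈ m.PC := by
  rw [mem_PC_iff]
  constructor
  · rintro ⟨f, hf, hv, hj⟩ k hk
    obtain ⟨a, b, hab⟩ := hj ⟨k, hk⟩
    rw [pt_castSucc, pt_succ] at hab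
    refine ⟨b, ?_⟩
    -- Two continuous functions that agree almost everywhere on an open set agree everywhere on it.
    have heq : EqOn (rep v) f (Ioo 0 1) := by
      refine Measure.eqOn_open_of_ae_eq (μ := volume) ?_ isOpen_Ioo
        ((rep_continuousOn v).mono Ioo_subset_Icc_self) (hf.mono Ioo_subset_Icc_self)
      filter_upwards [val_ae_eq_rep v, hv] with x h1 h2
      rw [← h1, h2]
    filter_upwards [ae_unit_iff.2 ((rep_hasDerivAt v).mono fun x hx hx' =>
      hx (uIoc_subset_uIcc hx'))] with x hx hx'
    refine hx.unique ?_
    have h1 : HasDerivAt (fun x => a + b * x) b x := by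
      simpa using ((hasDerivAt_id x).const_mul b).const_add a
    refine h1.congr_of_eventuallyEq ?_
    filter_upwards [isOpen_Ioo.mem_nhds hx'] with y hy
    rw [heq (Ioo_subset_Ioo (m.pt_mem k).1 (m.pt_mem (k + 1)).2 hy), hab y hy]
  · intro h
    refine ⟨rep v, rep_continuousOn v, val_ae_eq_rep v, fun j => ?_⟩
    obtain ⟨b, hb⟩ := h j j.2
    rw [pt_castSucc, pt_succ]
    refine ⟨rep v (m.pt j) - b * m.pt j, b, fun x hx => ?_⟩
    have hx1 : x ∈ Icc (0 : ℝ) 1 :=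
      ⟨(m.pt_mem j).1.trans hx.1.le, hx.2.le.trans (m.pt_mem (j + 1)).2⟩
    rw [rep_add_integral v (m.pt_mem j) hx1]
    have : ∫ y in m.pt j..x, dx v y = ∫ y in m.pt j..x, b := by
      rw [intervalIntegral.integral_of_le hx.1.le, intervalIntegral.integral_of_le hx.1.le,
        integral_Ioc_eq_integral_Ioo, integral_Ioc_eq_integral_Ioo]
      refine setIntegral_congr_ae measurableSet_Ioo ?_
      filter_upwards [(ae_restrict_iff' measurableSet_Ioo).1 hb] with y hy hy'
      exact hy ⟨(m.pt_mem j).1.trans_lt hy'.1, hy'.2.trans_le hx1.2⟩ ⟨hy'.1, hy'.2.trans hx.2⟩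
    rw [this, intervalIntegral.integral_const, smul_eq_mul]
    ring

/-- Cauchy–Schwarz bounds `|v(x) - v(x_k)|²` by `h` times the cell integral of `v_x²`; integrating
over a cell of length at most `h` gives the second factor `h`. -/
theorem integral_sub_node_sq_le (v : H1) {k : ℕ} (hk : k < m.N) :
    ∫ x in m.pt k..m.pt (k + 1), (rep v x - rep v (m.pt k)) ^ 2 ≤
      m.h ^ 2 * ∫ x in m.pt k..m.pt (k + 1), dx v x ^ 2 := by
  have hle := m.pt_mono (Nat.le_succ k)
  have h0 := m.h_nonneg
  set J := ∫ x in m.pt k..m.pt (k + 1), dx v x ^ 2 with hJ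
  have hJ0 : 0 ≤ J := intervalIntegral.integral_nonneg hle fun _ _ => sq_nonneg _
  have hsub : Icc (m.pt k) (m.pt (k + 1)) ⊆ Icc 0 1 :=
    Icc_subset_Icc (m.pt_mem k).1 (m.pt_mem (k + 1)).2
  have hb : ∀ x ∈ Icc (m.pt k) (m.pt (k + 1)), (rep v x - rep v (m.pt k)) ^ 2 ≤ m.h * J := by
    intro x hx
    rw [rep_add_integral v (m.pt_mem k) (hsub hx), add_sub_cancel_left]
    refine (sq_integral_le (dx v) (m.pt_mem k).1 hx.1 (hsub hx).2).trans ?_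
    have h1 : ∫ y in m.pt k..x, dx v y ^ 2 ≤ J :=
      intervalIntegral.integral_mono_interval le_rfl hx.1 hx.2
        (Filter.Eventually.of_forall fun x => sq_nonneg _)
        ((integrable_sq_L2 (dx v)).mono_set (m.uIcc_pt_subset _ _))
    have h2 : x - m.pt k ≤ m.h := by linarith [m.pt_sub_le hk, hx.2]
    exact mul_le_mul h2 h1 (intervalIntegral.integral_nonneg hx.1 fun _ _ => sq_nonneg _) h0
  have hc : ContinuousOn (fun x => (rep v x - rep v (m.pt k)) ^ 2)
      (uIcc (m.pt k) (m.pt (k + 1))) := by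
    rw [uIcc_of_le hle]
    exact (((rep_continuousOn v).mono hsub).sub continuousOn_const).pow 2
  calc _ ≤ ∫ x in m.pt k..m.pt (k + 1), m.h * J :=
        intervalIntegral.integral_mono_on hle hc.intervalIntegrable (by simp) hb
    _ = (m.pt (k + 1) - m.pt k) * (m.h * J) := by
        rw [intervalIntegral.integral_const, smul_eq_mul]
    _ ≤ m.h * (m.h * J) := by
        gcongr
        exact m.pt_sub_le hk
    _ = _ := by ring

/-! ### The nodal interpolation error -/

/-- `v` minus its piecewise affine interpolant, as a continuous linear map. -/
def intErr : H1 →L[ℝ] H1 :=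
  primL.comp ((ContinuousLinearMap.id ℝ L2 - m.PC.starProjection).comp dxL)

theorem dx_intErr (v : H1) : dx (m.intErr v) = dx v - m.PC.starProjection (dx v) := by
  simp [intErr]

theorem dx_intErr_mem (v : H1) : dx (m.intErr v) ∈ m.PCᗮ := by
  rw [dx_intErr]
  exact Submodule.sub_starProjection_mem_orthogonal _

theorem sub_intErr_mem (v : H1) : v - m.intErr v ∈ m.V := by
  rw [mem_V_iff, dx_sub, dx_intErr, sub_sub_cancel]
  exact Submodule.starProjection_apply_mem _ _

@[simp] theorem at0_intErr (v : H1) : at0 (m.intErr v) = 0 := by simp [intErr]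

/-- The derivative of the error is `v_x` minus its L² projection onto piecewise constants, so it has
mean zero on each cell. The error starts at 0 and therefore vanishes at every node. -/
theorem rep_intErr {v : H1} {k : ℕ} (hk : k ≤ m.N) : rep (m.intErr v) (m.pt k) = 0 := by
  rw [rep, at0_intErr, zero_add, ← m.sum_integral (intervalIntegrable_L2 _)]
  refine Finset.sum_eq_zero fun i hi => ?_
  exact m.integral_eq_zero_of_mem_orthogonal (m.dx_intErr_mem v)
    ((Finset.mem_range.1 hi).trans_le hk)

@[simp] theorem at1_intErr (v : H1) : at1 (m.intErr v) = 0 := by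
  rw [← rep_one, ← m.pt_N, m.rep_intErr le_rfl]

/-- Nodal interpolation in one dimension is the projection in the H¹ seminorm. This removes `η_x`
and `η_xt` from the leading terms of the error equation. -/
theorem inner_dx_intErr (v : H1) {χ : H1} (hχ : χ ∈ m.V) :
    inner ℝ (dx (m.intErr v)) (dx χ) = 0 := by
  rw [real_inner_comm]
  exact (Submodule.mem_orthogonal _ _).1 (m.dx_intErr_mem v) _ ((m.mem_V_iff χ).1 hχ)

theorem norm_dx_intErr_le (v : H1) : ‖dx (m.intErr v)‖ ≤ ‖dx v‖ := by
  have h : inner ℝ (m.PC.starProjection (dx v)) (dx (m.intErr v)) = 0 :=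
    (Submodule.mem_orthogonal _ _).1 (m.dx_intErr_mem v) _ (Submodule.starProjection_apply_mem _ _)
  have e : dx v = m.PC.starProjection (dx v) + dx (m.intErr v) := by
    rw [dx_intErr]
    abel
  have h2 := norm_add_sq_real (m.PC.starProjection (dx v)) (dx (m.intErr v))
  rw [← e, h] at h2
  refine abs_le_of_sq_le_sq' ?_ (norm_nonneg _) |>.2
  nlinarith [sq_nonneg ‖m.PC.starProjection (dx v)‖]

/-- The error vanishes at the left node of each cell, so the cell estimate applies with no
subtracted value. -/
theorem norm_val_intErr_le (v : H1) : ‖val (m.intErr v)‖ ≤ m.h * ‖dx (m.intErr v)‖ := by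
  refine abs_le_of_sq_le_sq' ?_ (mul_nonneg m.h_nonneg (norm_nonneg _)) |>.2
  rw [mul_pow, norm_sq_eq_integral, norm_sq_eq_integral (dx _)]
  have e : ∫ x in (0 : ℝ)..1, val (m.intErr v) x ^ 2 = ∫ x in (0 : ℝ)..1, rep (m.intErr v) x ^ 2 := by
    refine intervalIntegral.integral_congr_ae ?_
    filter_upwards [ae_unit_iff.1 (val_ae_eq_rep (m.intErr v))] with x hx hx'
    rw [hx hx']
  have i1 : IntervalIntegrable (fun x => rep (m.intErr v) x ^ 2) volume 0 1 := by
    refine ContinuousOn.intervalIntegrable ?_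
    rw [uIcc_of_le zero_le_one]
    exact (rep_continuousOn _).pow 2
  rw [e]
  have h1 := m.sum_integral i1 m.N
  have h2 := m.sum_integral (integrable_sq_L2 (dx (m.intErr v))) m.N
  rw [m.pt_N] at h1 h2
  rw [← h1, ← h2, Finset.mul_sum]
  refine Finset.sum_le_sum fun k hk => ?_
  have hk := Finset.mem_range.1 hk
  have := m.integral_sub_node_sq_le (m.intErr v) hk
  simpa only [m.rep_intErr hk.le, sub_zero] using this

/-- By orthogonality `‖r‖² = (r, v_x)`. As `r` has mean zero on each cell, `v_x = u` may be replaced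
there by `u - u(x_k)`, which is of order `h`. Young's inequality then absorbs half of `‖r‖²`. -/
theorem norm_dx_intErr_le_of_H2 {v u : H1} (hu : HasH2Deriv v u) :
    ‖dx (m.intErr v)‖ ≤ m.h * ‖dx u‖ := by
  set r := dx (m.intErr v) with hr
  have hsq : ‖r‖ ^ 2 = inner ℝ r (dx v) := by
    have h : inner ℝ r (m.PC.starProjection (dx v)) = 0 := by
      rw [real_inner_comm]
      exact (Submodule.mem_orthogonal _ _).1 (m.dx_intErr_mem v) _
        (Submodule.starProjection_apply_mem _ _)
    have e : dx v = m.PC.starProjection (dx v) + r := by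
      rw [hr, dx_intErr]
      abel
    rw [e, inner_add_right, h, zero_add, real_inner_self_eq_norm_sq]
  have i2 : IntervalIntegrable (fun x => rep u x) volume 0 1 := by
    refine ContinuousOn.intervalIntegrable ?_
    rw [uIcc_of_le zero_le_one]
    exact rep_continuousOn _
  have i3 : IntervalIntegrable (fun x => r x * rep u x) volume 0 1 := by
    refine (intervalIntegrable_L2 r).mul_continuousOn ?_
    rw [uIcc_of_le zero_le_one]
    exact rep_continuousOn _
  have e1 : inner ℝ r (dx v) = ∫ x in (0 : ℝ)..1, r x * rep u x := by
    rw [inner_eq_integral]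
    refine intervalIntegral.integral_congr_ae ?_
    filter_upwards [ae_unit_iff.1 (val_ae_eq_rep u)] with x hx hx'
    rw [← hx hx', hu]
  have key : ∀ k < m.N, ∫ x in m.pt k..m.pt (k + 1), r x * rep u x ≤
      1 / 2 * (∫ x in m.pt k..m.pt (k + 1), r x ^ 2)
        + 1 / 2 * (m.h ^ 2 * ∫ x in m.pt k..m.pt (k + 1), dx u x ^ 2) := by
    intro k hk
    have hle := m.pt_mono (Nat.le_succ k)
    have hs := m.uIcc_pt_subset k (k + 1)
    have j1 := (intervalIntegrable_L2 r).mono_set hs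
    have j2 := (integrable_sq_L2 r).mono_set hs
    have j3 := i3.mono_set hs
    have hc : ContinuousOn (fun x => (rep u x - rep u (m.pt k)) ^ 2)
        (uIcc (m.pt k) (m.pt (k + 1))) := by
      refine ((ContinuousOn.mono ?_ hs).sub continuousOn_const).pow 2
      rw [uIcc_of_le zero_le_one]
      exact rep_continuousOn u
    have j4 := hc.intervalIntegrable (μ := volume)
    calc _ = ∫ x in m.pt k..m.pt (k + 1), (r x * rep u x - r x * rep u (m.pt k)) := by
          rw [intervalIntegral.integral_sub j3 (j1.mul_const _),
            intervalIntegral.integral_mul_const,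
            m.integral_eq_zero_of_mem_orthogonal (m.dx_intErr_mem v) hk]
          ring
      _ ≤ ∫ x in m.pt k..m.pt (k + 1),
            (1 / 2 * r x ^ 2 + 1 / 2 * (rep u x - rep u (m.pt k)) ^ 2) := by
          refine intervalIntegral.integral_mono_on hle (j3.sub (j1.mul_const _))
            ((j2.const_mul _).add (j4.const_mul _)) fun x _ => ?_
          nlinarith [sq_nonneg (r x - (rep u x - rep u (m.pt k)))]
      _ = 1 / 2 * (∫ x in m.pt k..m.pt (k + 1), r x ^ 2)
            + 1 / 2 * ∫ x in m.pt k..m.pt (k + 1), (rep u x - rep u (m.pt k)) ^ 2 := by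
          rw [intervalIntegral.integral_add (j2.const_mul _) (j4.const_mul _),
            intervalIntegral.integral_const_mul, intervalIntegral.integral_const_mul]
      _ ≤ _ := by
          have := m.integral_sub_node_sq_le u hk
          linarith
  have h1 := m.sum_integral i3 m.N
  have h2 := m.sum_integral (integrable_sq_L2 r) m.N
  have h3 := m.sum_integral (integrable_sq_L2 (dx u)) m.N
  rw [m.pt_N] at h1 h2 h3
  have h4 := Finset.sum_le_sum fun k hk => key k (Finset.mem_range.1 hk)
  rw [Finset.sum_add_distrib, ← Finset.mul_sum, ← Finset.mul_sum, ← Finset.mul_sum, h1, h2, h3,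
    ← e1, ← hsq, ← norm_sq_eq_integral, ← norm_sq_eq_integral] at h4
  refine abs_le_of_sq_le_sq' ?_ (mul_nonneg m.h_nonneg (norm_nonneg _)) |>.2
  rw [mul_pow]
  linarith

/-- `V_h` as a closed subspace of `H¹`. -/
def VS : Submodule ℝ H1 := m.PC.comap dxL.toLinearMap

theorem mem_VS (v : H1) : v ∈ m.VS ↔ v ∈ m.V := (m.mem_V_iff v).symm

theorem isClosed_VS : IsClosed (m.VS : Set H1) :=
  (Submodule.closed_of_finiteDimensional m.PC).preimage dxL.continuous

end Mesh

/-! ### Weak solutions are classical in time -/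

/-- The bilinear form `(L u, L v)`. -/
def gram (L : H1 →L[ℝ] L2) : H1 →L[ℝ] H1 →L[ℝ] ℝ :=
  LinearMap.mkContinuous₂
    (LinearMap.mk₂ ℝ (fun u v => inner ℝ (L u) (L v))
      (fun u v χ => by rw [map_add, inner_add_left])
      (fun c u χ => by rw [map_smul, real_inner_smul_left, smul_eq_mul])
      (fun u v χ => by rw [map_add, inner_add_right])
      (fun c u χ => by rw [map_smul, real_inner_smul_right, smul_eq_mul]))
    (‖L‖ * ‖L‖)
    (fun u v => (norm_inner_le_norm _ _).trans (by
      calc ‖L u‖ * ‖L v‖ ≤ (‖L‖ * ‖u‖) * (‖L‖ * ‖v‖) := by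
            gcongr <;> exact L.le_opNorm _
        _ = ‖L‖ * ‖L‖ * ‖u‖ * ‖v‖ := by ring))

@[simp] theorem gram_apply (L : H1 →L[ℝ] L2) (u v : H1) : gram L u v = inner ℝ (L u) (L v) := rfl

/-- The bilinear form multiplying `w_t`. -/
def massForm (μ ν wd c0 c1 : ℝ) (w : H1) : H1 →L[ℝ] H1 →L[ℝ] ℝ :=
  gram valL + μ • gram dxL
    + (μ / ν * ((c0 + 1 + wd) + 2 / (3 * c0) * at0 w ^ 2)) • at0L.smulRight at0L
    + (μ / ν * ((c1 + 1 + wd) + 2 / (3 * c1) * at1 w ^ 2)) • at1L.smulRight at1L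

/-- The part of the weak formulation without time derivative. -/
def loadForm (ν wd c0 c1 : ℝ) (w : H1) : H1 →L[ℝ] ℝ :=
  ν • (innerSL ℝ (dx w)).comp dxL + (1 + wd) • (innerSL ℝ (dx w)).comp valL
    + (innerSL ℝ (pmul w (dx w))).comp valL
    + (bdry wd c0 (at0 w) • at0L + bdry wd c1 (at1 w) • at1L)

theorem massForm_apply (μ ν wd c0 c1 : ℝ) (w z χ : H1) :
    massForm μ ν wd c0 c1 w z χ = inner ℝ (val z) (val χ) + μ * inner ℝ (dx z) (dx χ)
      + μ / ν * ((c0 + 1 + wd) + 2 / (3 * c0) * at0 w ^ 2) * (at0 z * at0 χ)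
      + μ / ν * ((c1 + 1 + wd) + 2 / (3 * c1) * at1 w ^ 2) * (at1 z * at1 χ) := by
  simp [massForm]

theorem loadForm_apply (ν wd c0 c1 : ℝ) (w χ : H1) :
    loadForm ν wd c0 c1 w χ = ν * inner ℝ (dx w) (dx χ) + (1 + wd) * inner ℝ (dx w) (val χ)
      + inner ℝ (pmul w (dx w)) (val χ)
      + (bdry wd c0 (at0 w) * at0 χ + bdry wd c1 (at1 w) * at1 χ) := by
  simp [loadForm]

theorem weakForm_eq_add (μ ν wd c0 c1 : ℝ) (w z χ : H1) :
    weakForm μ ν wd c0 c1 w z χ = massForm μ ν wd c0 c1 w z χ + loadForm ν wd c0 c1 w χ := by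
  rw [massForm_apply, loadForm_apply, weakForm, inner_pmul]
  ring

/-- The boundary contributions to the mass form are nonnegative. The constant `min 1 μ` degenerates
as `μ → 0`, so coercivity serves only existence, uniqueness and continuity of the time derivative,
never an error estimate. -/
theorem massForm_coercive {μ ν wd c0 c1 : ℝ} (hμ : 0 < μ) (hν : 0 < ν) (hwd : 0 ≤ wd)
    (hc0 : 0 < c0) (hc1 : 0 < c1) (w v : H1) :
    min 1 μ * ‖v‖ ^ 2 ≤ massForm μ ν wd c0 c1 w v v := by
  rw [massForm_apply, norm_sq_H1, real_inner_self_eq_norm_sq, real_inner_self_eq_norm_sq]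
  have h1 : 0 ≤ μ / ν * ((c0 + 1 + wd) + 2 / (3 * c0) * at0 w ^ 2) * (at0 v * at0 v) :=
    mul_nonneg (by positivity) (mul_self_nonneg _)
  have h2 : 0 ≤ μ / ν * ((c1 + 1 + wd) + 2 / (3 * c1) * at1 w ^ 2) * (at1 v * at1 v) :=
    mul_nonneg (by positivity) (mul_self_nonneg _)
  have h3 := mul_le_mul_of_nonneg_right (min_le_left 1 μ) (sq_nonneg ‖val v‖)
  have h4 := mul_le_mul_of_nonneg_right (min_le_right 1 μ) (sq_nonneg ‖dx v‖)
  linarith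

/-- For a frozen state `w` the weak formulation is linear in `z`, and Lax–Milgram applies. -/
theorem exists_weakForm_eq_zero {μ ν wd c0 c1 : ℝ} (hμ : 0 < μ) (hν : 0 < ν) (hwd : 0 ≤ wd)
    (hc0 : 0 < c0) (hc1 : 0 < c1) (w : H1) :
    ∃ z : H1, ∀ χ : H1, weakForm μ ν wd c0 c1 w z χ = 0 := by
  have hco : IsCoercive (massForm μ ν wd c0 c1 w) :=
    ⟨min 1 μ, lt_min one_pos hμ, fun v => by
      have := massForm_coercive hμ hν hwd hc0 hc1 w v
      rwa [pow_two, ← mul_assoc] at this⟩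
  refine ⟨hco.continuousLinearEquivOfBilin.symm
    ((InnerProductSpace.toDual ℝ H1).symm (-loadForm ν wd c0 c1 w)), fun χ => ?_⟩
  rw [weakForm_eq_add, ← hco.continuousLinearEquivOfBilin_apply,
    ContinuousLinearEquiv.apply_symm_apply, InnerProductSpace.toDual_symm_apply]
  simp

theorem weakForm_unique {μ ν wd c0 c1 : ℝ} (hμ : 0 < μ) (hν : 0 < ν) (hwd : 0 ≤ wd)
    (hc0 : 0 < c0) (hc1 : 0 < c1) {w z z' : H1} (h : ∀ χ, weakForm μ ν wd c0 c1 w z χ = 0)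
    (h' : ∀ χ, weakForm μ ν wd c0 c1 w z' χ = 0) : z = z' := by
  have h1 := massForm_coercive hμ hν hwd hc0 hc1 w (z - z')
  have h2 := h (z - z')
  have h3 := h' (z - z')
  rw [weakForm_eq_add] at h2 h3
  have h6 : massForm μ ν wd c0 c1 w (z - z') (z - z') = massForm μ ν wd c0 c1 w z (z - z')
      - massForm μ ν wd c0 c1 w z' (z - z') := DFunLike.congr_fun (map_sub _ z z') _
  have h4 : 0 < min 1 μ := lt_min one_pos hμ
  have h5 : ‖z - z'‖ ^ 2 ≤ 0 := by
    by_contra hn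
    nlinarith [mul_pos h4 (not_le.1 hn)]
  rw [← sub_eq_zero, ← norm_eq_zero]
  exact pow_eq_zero_iff two_ne_zero |>.1 (le_antisymm h5 (sq_nonneg _))

theorem continuous_pmul {X : Type*} [TopologicalSpace X] {f : X → H1} {g : X → L2}
    (hf : Continuous f) (hg : Continuous g) : Continuous fun x => pmul (f x) (g x) :=
  mulL.continuous₂.comp (hf.prodMk hg)

/-- The time derivative prescribed by the weak formulation depends continuously on the state. -/
theorem continuous_of_weakForm_eq_zero {μ ν wd c0 c1 : ℝ} (hμ : 0 < μ) (hν : 0 < ν)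
    (hwd : 0 ≤ wd) (hc0 : 0 < c0) (hc1 : 0 < c1) {Φ : H1 → H1}
    (hΦ : ∀ w χ, weakForm μ ν wd c0 c1 w (Φ w) χ = 0) : Continuous Φ := by
  rw [continuous_iff_continuousAt]
  intro w
  set k0 : H1 → ℝ := fun w' => μ / ν * (2 / (3 * c0)) * (at0 w ^ 2 - at0 w' ^ 2) * at0 (Φ w)
    + (bdry wd c0 (at0 w) - bdry wd c0 (at0 w')) with hk0
  set k1 : H1 → ℝ := fun w' => μ / ν * (2 / (3 * c1)) * (at1 w ^ 2 - at1 w' ^ 2) * at1 (Φ w)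
    + (bdry wd c1 (at1 w) - bdry wd c1 (at1 w')) with hk1
  set g : H1 → L2 := fun w' => (1 + wd) • (dx w - dx w') + (pmul w (dx w) - pmul w' (dx w')) with hg
  set k : H1 → L2 := fun w' => ν • (dx w - dx w') with hk
  -- `δ w'` bounds the dual norm of the residual left by `Φ w` in the equation at the state `w'`.
  -- Coercivity at `w'` converts it into a bound on `Φ w' - Φ w`.
  set δ : H1 → ℝ := fun w' => ‖k w'‖ + ‖g w'‖ + |k0 w'| * ‖at0L‖ + |k1 w'| * ‖at1L‖ with hδ
  have hc : Continuous δ := by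
    have h0 := continuous_at0
    have h1 := continuous_at1
    have h2 := continuous_dx
    have h3 : Continuous fun w' : H1 => pmul w' (dx w') := continuous_pmul continuous_id h2
    have h4 : Continuous k0 := by
      unfold k0 bdry
      fun_prop
    have h5 : Continuous k1 := by
      unfold k1 bdry
      fun_prop
    unfold δ g k
    fun_prop
  have h0 : δ w = 0 := by simp [hδ, hk0, hk1, hg, hk]
  have hm : 0 < min 1 μ := lt_min one_pos hμ
  have hb : ∀ w', dist (Φ w') (Φ w) ≤ δ w' / min 1 μ := by
    intro w'
    rw [dist_eq_norm]
    set d := Φ w' - Φ w with hd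
    have h1 := massForm_coercive hμ hν hwd hc0 hc1 w' d
    have h2 := hΦ w' d
    have h3 := hΦ w d
    rw [weakForm_eq_add, massForm_apply, loadForm_apply] at h2 h3
    have h4 : massForm μ ν wd c0 c1 w' d d = inner ℝ (k w') (dx d) + inner ℝ (g w') (val d)
        + k0 w' * at0L d + k1 w' * at1L d := by
      have e1 : val (Φ w') = val (Φ w) + val d := by simp [hd]
      have e2 : dx (Φ w') = dx (Φ w) + dx d := by simp [hd]
      have e3 : at0 (Φ w') = at0 (Φ w) + at0 d := by simp [hd]
      have e4 : at1 (Φ w') = at1 (Φ w) + at1 d := by simp [hd]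
      rw [e1, e2, e3, e4] at h2
      rw [massForm_apply]
      simp only [hk, hg, hk0, hk1, inner_add_left, inner_sub_left, real_inner_smul_left,
        at0L_apply, at1L_apply] at h2 ⊢
      linarith
    have h5 : massForm μ ν wd c0 c1 w' d d ≤ δ w' * ‖d‖ := by
      rw [h4]
      have i1 := (real_inner_le_norm (k w') (dx d)).trans
        (mul_le_mul_of_nonneg_left (norm_dx_le d) (norm_nonneg _))
      have i2 := (real_inner_le_norm (g w') (val d)).trans
        (mul_le_mul_of_nonneg_left (norm_val_le d) (norm_nonneg _))
      have i3 : k0 w' * at0L d ≤ |k0 w'| * (‖at0L‖ * ‖d‖) := by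
        refine (le_abs_self _).trans ?_
        rw [abs_mul]
        exact mul_le_mul_of_nonneg_left (at0L.le_opNorm d) (abs_nonneg _)
      have i4 : k1 w' * at1L d ≤ |k1 w'| * (‖at1L‖ * ‖d‖) := by
        refine (le_abs_self _).trans ?_
        rw [abs_mul]
        exact mul_le_mul_of_nonneg_left (at1L.le_opNorm d) (abs_nonneg _)
      simp only [hδ]
      linarith
    rcases (norm_nonneg d).eq_or_lt with h6 | h6
    · rw [← h6]
      positivity
    · rw [le_div_iff₀ hm]
      refine le_of_mul_le_mul_right ?_ h6
      nlinarith
  rw [ContinuousAt, tendsto_iff_dist_tendsto_zero]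
  refine squeeze_zero (fun _ => dist_nonneg) hb ?_
  have := (hc.div_const (min 1 μ)).tendsto w
  simpa [h0] using this

/-- A solution that is continuously differentiable in time. -/
structure IsFlow (μ ν wd c0 c1 : ℝ) (w z : ℝ → H1) : Prop where
  hasDerivAt : ∀ t, HasDerivAt w (z t) t
  continuous_deriv : Continuous z
  equation : ∀ t, 0 ≤ t → ∀ χ, weakForm μ ν wd c0 c1 (w t) (z t) χ = 0

/-- A weak solution is continuous in time, being a primitive. By uniqueness its derivative equals `Φ
(w t)` almost everywhere, and `Φ` is continuous, so the solution is C¹ in time and the equation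
holds at every time. -/
theorem IsWeakSolution.exists_flow {μ ν wd c0 c1 : ℝ} (hμ : 0 < μ) (hν : 0 < ν)
    (hwd : 0 ≤ wd) (hc0 : 0 < c0) (hc1 : 0 < c1) {w0 : H1} {w : ℝ → H1}
    (hw : IsWeakSolution μ ν wd c0 c1 w0 w) :
    ∃ W Z : ℝ → H1, IsFlow μ ν wd c0 c1 W Z ∧ W 0 = w0 ∧ ∀ t, 0 ≤ t → W t = w t := by
  obtain ⟨z, hz, hwz, heq⟩ := hw
  choose Φ hΦ using exists_weakForm_eq_zero hμ hν hwd hc0 hc1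
  have hΦc := continuous_of_weakForm_eq_zero hμ hν hwd hc0 hc1 hΦ
  have hzi : ∀ T : ℝ, 0 < T → IntervalIntegrable z volume 0 T := fun T hT => by
    rw [intervalIntegrable_iff_integrableOn_Ioo_of_le hT.le]
    exact (hz T hT).integrable (by norm_num)
  have hcont : ContinuousOn w (Ici 0) := by
    intro t ht
    have ht1 : (0 : ℝ) < t + 1 := by linarith [mem_Ici.1 ht]
    have h1 := intervalIntegral.continuousOn_primitive_interval
      ((intervalIntegrable_iff_integrableOn_Icc_of_le ht1.le).1 (hzi _ ht1) |>.mono_set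
        (uIcc_of_le ht1.le).subset)
    rw [uIcc_of_le ht1.le] at h1
    have h2 : ContinuousOn w (Icc 0 (t + 1)) :=
      (h1.const_add w0).congr fun s hs => hwz s hs.1
    refine (h2 t ⟨ht, by linarith⟩).mono_of_mem_nhdsWithin ?_
    rw [mem_nhdsWithin]
    exact ⟨Iio (t + 1), isOpen_Iio, by simp, fun s hs => ⟨hs.2, hs.1.le⟩⟩
  have hcm : Continuous fun t : ℝ => w (max t 0) :=
    hcont.comp_continuous (continuous_id.max continuous_const) fun t => mem_Ici.2 (le_max_right _ _)
  -- The derivative is frozen at its initial value for negative times, so that the flow is two-sided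
  -- differentiable at 0 as well.
  set Z : ℝ → H1 := fun t => Φ (w (max t 0)) with hZ
  have hZc : Continuous Z := hΦc.comp hcm
  have hae : ∀ᵐ t ∂volume.restrict (Ioi (0 : ℝ)), z t = Z t := by
    filter_upwards [heq, ae_restrict_mem measurableSet_Ioi] with t h1 h2
    simp only [hZ, max_eq_left (mem_Ioi.1 h2).le]
    exact weakForm_unique hμ hν hwd hc0 hc1 h1 (hΦ _)
  have hWw : ∀ t, 0 ≤ t → w0 + ∫ s in (0 : ℝ)..t, Z s = w t := by
    intro t ht
    rw [hwz t ht]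
    congr 1
    refine intervalIntegral.integral_congr_ae ?_
    filter_upwards [(ae_restrict_iff' measurableSet_Ioi).1 hae] with s hs hs'
    rw [uIoc_of_le ht] at hs'
    exact (hs hs'.1).symm
  refine ⟨fun t => w0 + ∫ s in (0 : ℝ)..t, Z s, Z, ⟨fun t => ?_, hZc, fun t ht χ => ?_⟩,
    by simp, hWw⟩
  · exact (intervalIntegral.integral_hasDerivAt_right (hZc.intervalIntegrable _ _)
      (hZc.stronglyMeasurableAtFilter _ _) hZc.continuousAt).const_add w0
  · rw [hWw t ht]
    simp only [hZ, max_eq_left ht]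
    exact hΦ _ χ

/-! ### Regularity in space -/

/-- A test function as an element of `H¹(0,1)`. -/
theorem IsTest.exists_H1 {φ : ℝ → ℝ} (hφ : IsTest φ) : ∃ χ : H1, val χ = hφ.memLp.toLp φ ∧
    dx χ = hφ.memLp_deriv.toLp (deriv φ) ∧ at0 χ = 0 ∧ at1 χ = 0 := by
  have h0 : φ 0 = 0 := image_eq_zero_of_notMem_tsupport fun h => lt_irrefl _ (hφ.support h).1
  have h1 : φ 1 = 0 := image_eq_zero_of_notMem_tsupport fun h => lt_irrefl _ (hφ.support h).2
  have hd : ∀ x, HasDerivAt φ (deriv φ x) x := fun x =>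
    (hφ.smooth.differentiable (by simp) x).hasDerivAt
  have hdc : Continuous (deriv φ) := hφ.smooth.continuous_deriv (by simp)
  set χ := primFun (hφ.memLp_deriv.toLp (deriv φ)) with hχ
  have hr : ∀ x ∈ Icc (0 : ℝ) 1, rep χ x = φ x := by
    intro x hx
    rw [rep, hχ, at0_primFun, zero_add, dx_primFun]
    have e : ∫ y in (0 : ℝ)..x, hφ.memLp_deriv.toLp (deriv φ) y = ∫ y in (0 : ℝ)..x, deriv φ y := by
      refine intervalIntegral.integral_congr_ae ?_
      filter_upwards [ae_unit_iff.1 hφ.memLp_deriv.coeFn_toLp] with y hy hy'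
      refine hy ?_
      rw [uIoc_of_le hx.1] at hy'
      rw [uIoc_of_le zero_le_one]
      exact ⟨hy'.1, hy'.2.trans hx.2⟩
    rw [e, intervalIntegral.integral_eq_sub_of_hasDerivAt (fun y _ => hd y)
      (hdc.intervalIntegrable _ _), h0, sub_zero]
  refine ⟨χ, ?_, by simp [hχ], by simp [hχ], ?_⟩
  · refine Lp.ext ?_
    filter_upwards [val_ae_eq_rep χ, hφ.memLp.coeFn_toLp, ae_restrict_mem measurableSet_Ioo]
      with x h2 h3 h4
    rw [h2, h3, hr x (Ioo_subset_Icc_self h4)]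
  · rw [← rep_one, hr 1 (by simp), h1]

/-- The lower order terms `w_t + (1 + w_d) w_x + w w_x`. -/
def lowerTerms (wd : ℝ) (w z : H1) : L2 := val z + (1 + wd) • dx w + pmul w (dx w)

/-- Test functions vanish at both ends, so no boundary term contributes and the weak formulation
says precisely that the flux is weakly differentiable. Neither `z` nor `w` need be in H²
individually. -/
theorem exists_flux {μ ν wd c0 c1 : ℝ} {w z : H1} (h : ∀ χ, weakForm μ ν wd c0 c1 w z χ = 0) :
    ∃ r : H1, val r = μ • dx z + ν • dx w ∧ dx r = lowerTerms wd w z := by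
  have hw : IsWeakDeriv (μ • dx z + ν • dx w) (lowerTerms wd w z) := by
    rw [isWeakDeriv_iff]
    intro φ hφ
    obtain ⟨χ, h1, h2, h3, h4⟩ := hφ.exists_H1
    have h5 := h χ
    rw [weakForm_eq_add, massForm_apply, loadForm_apply, h3, h4] at h5
    rw [← h1, ← h2, real_inner_comm, real_inner_comm (lowerTerms wd w z)]
    simp only [lowerTerms, inner_add_left, real_inner_smul_left]
    linarith
  exact ⟨⟨WithLp.toLp 2 (_, _), hw⟩, rfl, rfl⟩

/-! ### A weighted Gronwall inequality -/

theorem hasDerivAt_primitive {f : ℝ → ℝ} (hf : Continuous f) (t : ℝ) :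
    HasDerivAt (fun t => ∫ s in (0 : ℝ)..t, f s) (f t) t :=
  intervalIntegral.integral_hasDerivAt_right (hf.intervalIntegrable _ _)
    (hf.stronglyMeasurableAtFilter _ _) hf.continuousAt

/-- The combination `X` of the weighted `φ`, damped by `exp (-∫ G)`, with the integrals of `D` and
`B` is nonincreasing, because `exp (-A) ≤ exp (-∫ G) ≤ 1`. As `∫ G ≤ A` for all times, the constant
`exp A` does not grow with `t`. Nothing is required of `φ'` beyond being the pointwise derivative.
-/
theorem gronwall_weighted {φ φ' G B D : ℝ → ℝ} {α A b : ℝ} (hc : ContinuousOn φ (Ici 0))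
    (hd : ∀ t, 0 < t → HasDerivAt φ (φ' t) t) (hG : Continuous G) (hB : Continuous B)
    (hD : Continuous D) (hG0 : ∀ t, 0 ≤ G t) (hB0 : ∀ t, 0 ≤ B t) (hD0 : ∀ t, 0 ≤ D t)
    (hφ0 : ∀ t, 0 ≤ φ t)
    (hineq : ∀ t, 0 < t → φ' t + 2 * α * φ t + D t ≤ G t * φ t + B t)
    (hA : ∀ t, 0 ≤ t → ∫ s in (0 : ℝ)..t, G s ≤ A)
    (hb : ∀ t, 0 ≤ t → ∫ s in (0 : ℝ)..t, Real.exp (2 * α * s) * B s ≤ b) {t : ℝ} (ht : 0 ≤ t) :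
    Real.exp (2 * α * t) * φ t + ∫ s in (0 : ℝ)..t, Real.exp (2 * α * s) * D s
      ≤ Real.exp A * (φ 0 + b) := by
  have hexp : Continuous fun s : ℝ => Real.exp (2 * α * s) := by fun_prop
  have dG := hasDerivAt_primitive hG
  have dB := hasDerivAt_primitive (hexp.mul hB)
  have dD := hasDerivAt_primitive (hexp.mul hD)
  set 𝒢 : ℝ → ℝ := fun t => ∫ s in (0 : ℝ)..t, G s with h𝒢
  set ℬ : ℝ → ℝ := fun t => ∫ s in (0 : ℝ)..t, Real.exp (2 * α * s) * B s with hℬ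
  set 𝒟 : ℝ → ℝ := fun t => ∫ s in (0 : ℝ)..t, Real.exp (2 * α * s) * D s with h𝒟
  have h𝒢0 : ∀ t, 0 ≤ t → 0 ≤ 𝒢 t := fun t ht =>
    intervalIntegral.integral_nonneg ht fun s _ => hG0 s
  set X : ℝ → ℝ := fun t => Real.exp (2 * α * t) * φ t * Real.exp (-𝒢 t)
    + Real.exp (-A) * 𝒟 t - ℬ t with hX
  have cX : ContinuousOn X (Icc 0 t) := by
    have c1 : Continuous 𝒢 := continuous_iff_continuousAt.2 fun t => (dG t).continuousAt
    have c2 : Continuous ℬ := continuous_iff_continuousAt.2 fun t => (dB t).continuousAt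
    have c3 : Continuous 𝒟 := continuous_iff_continuousAt.2 fun t => (dD t).continuousAt
    have c4 : ContinuousOn φ (Icc 0 t) := hc.mono fun s hs => hs.1
    fun_prop
  have dX : ∀ s, 0 < s → HasDerivAt X
      (((Real.exp (2 * α * s) * (2 * α)) * φ s + Real.exp (2 * α * s) * φ' s) * Real.exp (-𝒢 s)
        + Real.exp (2 * α * s) * φ s * (Real.exp (-𝒢 s) * -G s)
        + Real.exp (-A) * (Real.exp (2 * α * s) * D s) - Real.exp (2 * α * s) * B s) s := by
    intro s hs
    have e1 : HasDerivAt (fun s => Real.exp (2 * α * s)) (Real.exp (2 * α * s) * (2 * α)) s := by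
      have := ((hasDerivAt_id s).const_mul (2 * α)).exp
      simpa using this
    exact (((e1.fun_mul (hd s hs)).fun_mul (dG s).neg.exp).add ((dD s).const_mul _)).sub (dB s)
  have anti : AntitoneOn X (Icc 0 t) := by
    refine antitoneOn_of_hasDerivWithinAt_nonpos (convex_Icc 0 t) cX
      (fun s hs => (dX s ?_).hasDerivWithinAt) fun s hs => ?_
    · rw [interior_Icc] at hs
      exact hs.1
    · rw [interior_Icc] at hs
      have h1 := hineq s hs.1
      have h2 : Real.exp (-A) ≤ Real.exp (-𝒢 s) :=
        Real.exp_le_exp.2 (neg_le_neg (hA s hs.1.le))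
      have h3 : Real.exp (-𝒢 s) ≤ 1 := Real.exp_le_one_iff.2 (neg_nonpos.2 (h𝒢0 s hs.1.le))
      have h4 := Real.exp_pos (2 * α * s)
      have h5 := Real.exp_pos (-𝒢 s)
      have h6 : Real.exp (-𝒢 s) * (φ' s + 2 * α * φ s - G s * φ s) ≤
          Real.exp (-𝒢 s) * (B s - D s) := mul_le_mul_of_nonneg_left (by linarith) h5.le
      have h7 := mul_le_mul_of_nonneg_right h2 (hD0 s)
      have h8 := mul_le_mul_of_nonneg_right h3 (hB0 s)
      have h9 : Real.exp (-𝒢 s) * (φ' s + 2 * α * φ s - G s * φ s)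
          + Real.exp (-A) * D s - B s ≤ 0 := by linarith
      calc _ = Real.exp (2 * α * s) * (Real.exp (-𝒢 s) * (φ' s + 2 * α * φ s - G s * φ s)
          + Real.exp (-A) * D s - B s) := by ring
        _ ≤ 0 := mul_nonpos_of_nonneg_of_nonpos h4.le h9
  have h0 := anti (left_mem_Icc.2 ht) (right_mem_Icc.2 ht) ht
  have hX0 : X 0 = φ 0 := by simp [hX, h𝒢, hℬ, h𝒟]
  rw [hX0] at h0
  have h1 : Real.exp (-A) ≤ Real.exp (-𝒢 t) := Real.exp_le_exp.2 (neg_le_neg (hA t ht))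
  have h2 : 0 ≤ Real.exp (2 * α * t) * φ t := mul_nonneg (Real.exp_pos _).le (hφ0 t)
  have h3 := mul_le_mul_of_nonneg_left h1 h2
  have h4 := hb t ht
  have h5 : Real.exp (-A) * (Real.exp (2 * α * t) * φ t + 𝒟 t) ≤ φ 0 + b := by
    simp only [hX] at h0
    have h6 : ℬ t ≤ b := h4
    linarith
  calc _ = Real.exp A * (Real.exp (-A) * (Real.exp (2 * α * t) * φ t + 𝒟 t)) := by
        rw [← mul_assoc, ← Real.exp_add, add_neg_cancel, Real.exp_zero, one_mul]
    _ ≤ _ := mul_le_mul_of_nonneg_left h5 (Real.exp_pos A).le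

/-! ### Parameters and differentiation of the functionals -/

/-- Standing assumptions on the coefficients; `κ` is a small positive number. -/
structure Params (ν wd c0 c1 κ : ℝ) : Prop where
  ν_pos : 0 < ν
  wd_nonneg : 0 ≤ wd
  c0_pos : 0 < c0
  c1_pos : 0 < c1
  κ_pos : 0 < κ
  κ_le_ν : 4 * κ ≤ ν
  κ_le_c0 : 8 * κ ≤ c0
  κ_le_c1 : 8 * κ ≤ c1
  κ_le_one : 8 * κ ≤ 1

theorem exists_params {ν wd c0 c1 : ℝ} (hν : 0 < ν) (hwd : 0 ≤ wd) (hc0 : 0 < c0)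
    (hc1 : 0 < c1) : ∃ κ, Params ν wd c0 c1 κ := by
  refine ⟨min (min (ν / 4) (1 / 8)) (min (c0 / 8) (c1 / 8)), hν, hwd, hc0, hc1, ?_, ?_, ?_, ?_, ?_⟩
  · positivity
  · linarith [(min_le_left (min (ν / 4) (1 / 8)) (min (c0 / 8) (c1 / 8))).trans (min_le_left _ _)]
  · linarith [(min_le_right (min (ν / 4) (1 / 8)) (min (c0 / 8) (c1 / 8))).trans (min_le_left _ _)]
  · linarith [(min_le_right (min (ν / 4) (1 / 8)) (min (c0 / 8) (c1 / 8))).trans (min_le_right _ _)]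
  · linarith [(min_le_left (min (ν / 4) (1 / 8)) (min (c0 / 8) (c1 / 8))).trans (min_le_right _ _)]

/-- The inequalities satisfied by the admissible rates. -/
structure Rate (μ ν wd c0 c1 α : ℝ) : Prop where
  nonneg : 0 ≤ α
  le_μ : α * (1 + μ) ≤ ν / 2
  le_two_μ : α * (2 * μ + ν) ≤ ν / 2
  le_c0 : α * (ν + (c0 + 1 + wd) * μ) ≤ ν * (c0 + 1 + wd) / 2
  le_c1 : α * (ν + (c1 + 1 + wd) * μ) ≤ ν * (c1 + 1 + wd) / 2

theorem rate_alphaMax {μ ν wd c0 c1 : ℝ} (hμ : 0 < μ) (hν : 0 < ν) (hwd : 0 ≤ wd) (hc0 : 0 < c0)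
    (hc1 : 0 < c1) : Rate μ ν wd c0 c1 (alphaMax μ ν wd c0 c1) := by
  have h1 : alphaMax μ ν wd c0 c1 ≤ 1 / 2 * (ν / (μ + 1)) := by
    unfold alphaMax
    gcongr
    exact (min_le_left _ _).trans (min_le_left _ _)
  have h2 : alphaMax μ ν wd c0 c1 ≤ 1 / 2 * (ν / (2 * μ + ν)) := by
    unfold alphaMax
    gcongr
    exact (min_le_left _ _).trans (min_le_right _ _)
  have h3 : alphaMax μ ν wd c0 c1 ≤ 1 / 2 * (ν * (1 + c0 + wd) / (ν + (1 + c0 + wd) * μ)) := by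
    unfold alphaMax
    gcongr
    exact (min_le_right _ _).trans (min_le_left _ _)
  have h4 : alphaMax μ ν wd c0 c1 ≤ 1 / 2 * (ν * (1 + c1 + wd) / (ν + (1 + c1 + wd) * μ)) := by
    unfold alphaMax
    gcongr
    exact (min_le_right _ _).trans (min_le_right _ _)
  refine ⟨?_, ?_, ?_, ?_, ?_⟩
  · unfold alphaMax
    positivity
  · refine (mul_le_mul_of_nonneg_right h1 (by positivity)).trans (le_of_eq ?_)
    field_simp
    ring
  · refine (mul_le_mul_of_nonneg_right h2 (by positivity)).trans (le_of_eq ?_)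
    field_simp
  · refine (mul_le_mul_of_nonneg_right h3 (by positivity)).trans (le_of_eq ?_)
    field_simp
    ring
  · refine (mul_le_mul_of_nonneg_right h4 (by positivity)).trans (le_of_eq ?_)
    field_simp
    ring

theorem hasDerivAt_val {u : ℝ → H1} {z : H1} {t : ℝ} (h : HasDerivAt u z t) :
    HasDerivAt (fun t => val (u t)) (val z) t := valL.hasFDerivAt.comp_hasDerivAt t h
theorem hasDerivAt_dx {u : ℝ → H1} {z : H1} {t : ℝ} (h : HasDerivAt u z t) :
    HasDerivAt (fun t => dx (u t)) (dx z) t := dxL.hasFDerivAt.comp_hasDerivAt t h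
theorem hasDerivAt_at0 {u : ℝ → H1} {z : H1} {t : ℝ} (h : HasDerivAt u z t) :
    HasDerivAt (fun t => at0 (u t)) (at0 z) t := by
  have h' := at0L.hasFDerivAt.comp_hasDerivAt t h
  rw [at0L_apply] at h'
  exact h'.congr_of_eventuallyEq (Filter.Eventually.of_forall fun t => (at0L_apply (u t)).symm)
theorem hasDerivAt_at1 {u : ℝ → H1} {z : H1} {t : ℝ} (h : HasDerivAt u z t) :
    HasDerivAt (fun t => at1 (u t)) (at1 z) t := by
  have h' := at1L.hasFDerivAt.comp_hasDerivAt t h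
  rw [at1L_apply] at h'
  exact h'.congr_of_eventuallyEq (Filter.Eventually.of_forall fun t => (at1L_apply (u t)).symm)

theorem at0_sq_le (v : H1) : at0 v ^ 2 ≤ tsq v := by
  unfold tsq
  nlinarith [sq_nonneg (at1 v), sq_nonneg ‖dx v‖]
theorem at1_sq_le (v : H1) : at1 v ^ 2 ≤ tsq v := by
  unfold tsq
  nlinarith [sq_nonneg (at0 v), sq_nonneg ‖dx v‖]
theorem norm_dx_sq_le (v : H1) : ‖dx v‖ ^ 2 ≤ tsq v := by
  unfold tsq
  nlinarith [sq_nonneg (at0 v), sq_nonneg (at1 v)]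

/-- Young's inequality for an inner product. -/
theorem abs_inner_le (x y : L2) {ε : ℝ} (hε : 0 < ε) :
    |inner ℝ x y| ≤ ε * ‖x‖ ^ 2 + 1 / (4 * ε) * ‖y‖ ^ 2 := by
  refine (abs_real_inner_le_norm x y).trans ?_
  have h : 0 ≤ (2 * ε * ‖x‖ - ‖y‖) ^ 2 / (4 * ε) := by positivity
  have e : (2 * ε * ‖x‖ - ‖y‖) ^ 2 / (4 * ε) =
      ε * ‖x‖ ^ 2 + 1 / (4 * ε) * ‖y‖ ^ 2 - ‖x‖ * ‖y‖ := by
    field_simp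
    ring
  linarith

/-! ### The energy of a single trajectory -/

/-- The energy obtained by testing with the solution. -/
def energy (μ ν wd c0 c1 : ℝ) (u : H1) : ℝ :=
  ‖val u‖ ^ 2 + μ * ‖dx u‖ ^ 2 + μ / ν * (((c0 + 1 + wd) * at0 u ^ 2 + 1 / (3 * c0) * at0 u ^ 4)
    + ((c1 + 1 + wd) * at1 u ^ 2 + 1 / (3 * c1) * at1 u ^ 4))

/-- The derivative of `energy` at `u` in the direction `z`. -/
def energyD (μ ν wd c0 c1 : ℝ) (u z : H1) : ℝ :=
  2 * inner ℝ (val u) (val z) + μ * (2 * inner ℝ (dx u) (dx z))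
    + μ / ν * (((c0 + 1 + wd) * (2 * at0 u * at0 z) + 1 / (3 * c0) * (4 * at0 u ^ 3 * at0 z))
    + ((c1 + 1 + wd) * (2 * at1 u * at1 z) + 1 / (3 * c1) * (4 * at1 u ^ 3 * at1 z)))

theorem hasDerivAt_energy (μ ν wd c0 c1 : ℝ) {u : ℝ → H1} {z : H1} {t : ℝ}
    (h : HasDerivAt u z t) :
    HasDerivAt (fun t => energy μ ν wd c0 c1 (u t)) (energyD μ ν wd c0 c1 (u t) z) t := by
  have h0 := hasDerivAt_at0 h
  have h1 := hasDerivAt_at1 h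
  have := (((hasDerivAt_val h).norm_sq.add ((hasDerivAt_dx h).norm_sq.const_mul μ)).add
    (((((h0.fun_pow 2).const_mul (c0 + 1 + wd)).add ((h0.fun_pow 4).const_mul (1 / (3 * c0)))).add
      (((h1.fun_pow 2).const_mul (c1 + 1 + wd)).add
        ((h1.fun_pow 4).const_mul (1 / (3 * c1))))).const_mul (μ / ν)))
  refine this.congr_deriv ?_
  simp [energyD]

/-- The functional obtained by testing with the time derivative. -/
def potential (ν wd c0 c1 : ℝ) (u : H1) : ℝ :=
  ν / 2 * ‖dx u‖ ^ 2 + (((c0 + 1 + wd) / 2 * at0 u ^ 2 + 1 / (18 * c0) * at0 u ^ 4)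
    + ((c1 + 1 + wd) / 2 * at1 u ^ 2 + 1 / (18 * c1) * at1 u ^ 4))

/-- The derivative of `potential` at `u` in the direction `z`. -/
def potentialD (ν wd c0 c1 : ℝ) (u z : H1) : ℝ :=
  ν * inner ℝ (dx u) (dx z) + (bdry wd c0 (at0 u) * at0 z + bdry wd c1 (at1 u) * at1 z)

theorem hasDerivAt_potential {ν wd c0 c1 : ℝ} {u : ℝ → H1} {z : H1} {t : ℝ}
    (h : HasDerivAt u z t) :
    HasDerivAt (fun t => potential ν wd c0 c1 (u t)) (potentialD ν wd c0 c1 (u t) z) t := by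
  have h0 := hasDerivAt_at0 h
  have h1 := hasDerivAt_at1 h
  have := ((hasDerivAt_dx h).norm_sq.const_mul (ν / 2)).add
    ((((h0.fun_pow 2).const_mul ((c0 + 1 + wd) / 2)).add
        ((h0.fun_pow 4).const_mul (1 / (18 * c0)))).add
      (((h1.fun_pow 2).const_mul ((c1 + 1 + wd) / 2)).add
        ((h1.fun_pow 4).const_mul (1 / (18 * c1)))))
  refine this.congr_deriv ?_
  simp only [potentialD, bdry, Nat.cast_ofNat]
  ring

/-- Both differences are perfect squares, `p² (3c ∓ 2p)² / (36c)`. The coefficient `1/(9c)` is half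
of the quartic damping `2/(9c)` supplied by the feedback; the other half pays for the decay rate. -/
theorem cube_le {c : ℝ} (hc : 0 < c) (p : ℝ) : |p ^ 3 / 3| ≤ c / 4 * p ^ 2 + 1 / (9 * c) * p ^ 4 := by
  have h1 : c / 4 * p ^ 2 + 1 / (9 * c) * p ^ 4 - p ^ 3 / 3 =
      p ^ 2 * (3 * c - 2 * p) ^ 2 / (36 * c) := by
    field_simp
    ring
  have h2 : c / 4 * p ^ 2 + 1 / (9 * c) * p ^ 4 + p ^ 3 / 3 =
      p ^ 2 * (3 * c + 2 * p) ^ 2 / (36 * c) := by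
    field_simp
    ring
  have h3 : 0 ≤ p ^ 2 * (3 * c - 2 * p) ^ 2 / (36 * c) := by positivity
  have h4 : 0 ≤ p ^ 2 * (3 * c + 2 * p) ^ 2 / (36 * c) := by positivity
  rw [abs_le]
  constructor <;> linarith

/-- This is the role of the bound `ν / (2μ + ν)`: it limits the cost of decay of the quartic
boundary energy. -/
theorem Rate.mul_div_le {μ ν wd c0 c1 α : ℝ} (hα : Rate μ ν wd c0 c1 α) (hν : 0 < ν) :
    α * (μ / ν) ≤ 1 / 4 := by
  have h := hα.le_two_μ
  have h1 := mul_nonneg hα.nonneg hν.le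
  rw [← mul_div_assoc, div_le_iff₀ hν]
  linarith

/-- With `a = c_i + 1 + w_d`, decay costs `α` at the endpoint through Poincaré and `α (μ/ν) a`
through the boundary mass. Together they use at most half of the linear damping. -/
theorem boundary_rate {α μ ν a : ℝ} (hν : 0 < ν)
    (h : α * (ν + a * μ) ≤ ν * a / 2) : α + α * (μ / ν) * a ≤ a / 2 := by
  have e : α + α * (μ / ν) * a = α * (ν + a * μ) / ν := by
    field_simp
  rw [e, div_le_iff₀ hν]
  linarith

/-- Budget at an endpoint: of the linear damping `c + 1 + w_d`, half goes to the decay rate, at most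
`(1 + w_d)/2` to linear convection and `c/4` to the cubic flux; the remaining `c/4` exceeds `κ`. Of
the quartic damping `2/(9c)`, the flux takes `1/(9c)` and the rate `1/(12c)`, leaving `1/(36c)`. In
the interior the rate takes at most `ν/2`. -/
theorem energy_dissipation {μ ν wd c0 c1 κ α : ℝ} (hp : Params ν wd c0 c1 κ)
    (hα : Rate μ ν wd c0 c1 α) {u z : H1} (h : weakForm μ ν wd c0 c1 u z u = 0) :
    energyD μ ν wd c0 c1 u z / 2 + α * energy μ ν wd c0 c1 u + κ * tsq u
      + (1 / (36 * c0) * at0 u ^ 4 + 1 / (36 * c1) * at1 u ^ 4) ≤ 0 := by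
  obtain ⟨hν, hwd, hc0, hc1, hκ, k1, k2, k3, k4⟩ := hp
  rw [weakForm_eq_add, massForm_apply, loadForm_apply, inner_pmul_dx_self, inner_dx_val_self,
    real_inner_self_eq_norm_sq, real_inner_comm, real_inner_comm (dx u)] at h
  have hP := mul_le_mul_of_nonneg_left (norm_val_sq_le u) hα.nonneg
  unfold energyD energy
  unfold tsq at hP ⊢
  unfold bdry at h
  have hd := hα.mul_div_le hν
  have b0 := mul_le_mul_of_nonneg_right (boundary_rate hν hα.le_c0) (sq_nonneg (at0 u))
  have b1 := mul_le_mul_of_nonneg_right (boundary_rate hν hα.le_c1) (sq_nonneg (at1 u))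
  have q0 := (abs_le.1 (cube_le hc0 (at0 u)))
  have q1 := (abs_le.1 (cube_le hc1 (at1 u)))
  have s0 : 0 ≤ at0 u ^ 2 := sq_nonneg _
  have s1 : 0 ≤ at1 u ^ 2 := sq_nonneg _
  have f0 : α * (μ / ν) * (1 / (3 * c0) * at0 u ^ 4) ≤ 1 / 4 * (1 / (3 * c0) * at0 u ^ 4) :=
    mul_le_mul_of_nonneg_right hd (by positivity)
  have f1 : α * (μ / ν) * (1 / (3 * c1) * at1 u ^ 4) ≤ 1 / 4 * (1 / (3 * c1) * at1 u ^ 4) :=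
    mul_le_mul_of_nonneg_right hd (by positivity)
  have d0 := mul_le_mul_of_nonneg_right hα.le_μ (sq_nonneg ‖dx u‖)
  have d1 := mul_le_mul_of_nonneg_right k1 (sq_nonneg ‖dx u‖)
  have d2 := mul_le_mul_of_nonneg_right k2 s0
  have d3 := mul_le_mul_of_nonneg_right k3 s1
  have w0 := mul_nonneg hwd s0
  have w1 := mul_nonneg hwd s1
  have c0' := mul_nonneg hc0.le s0
  have c1' := mul_nonneg hc1.le s1
  have n0 := mul_nonneg hν.le (sq_nonneg ‖dx u‖)
  have e0 : 1 / (9 * c0) * at0 u ^ 4 = (1 / c0 * at0 u ^ 4) / 9 := by field_simp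
  have e1 : 1 / (9 * c1) * at1 u ^ 4 = (1 / c1 * at1 u ^ 4) / 9 := by field_simp
  have e2 : 1 / (3 * c0) * at0 u ^ 4 = (1 / c0 * at0 u ^ 4) / 3 := by field_simp
  have e3 : 1 / (3 * c1) * at1 u ^ 4 = (1 / c1 * at1 u ^ 4) / 3 := by field_simp
  have e4 : 1 / (36 * c0) * at0 u ^ 4 = (1 / c0 * at0 u ^ 4) / 36 := by field_simp
  have e5 : 1 / (36 * c1) * at1 u ^ 4 = (1 / c1 * at1 u ^ 4) / 36 := by field_simp
  have e6 : 2 / (9 * c0) * at0 u ^ 3 * at0 u = 2 * (1 / c0 * at0 u ^ 4) / 9 := by field_simp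
  have e7 : 2 / (9 * c1) * at1 u ^ 3 * at1 u = 2 * (1 / c1 * at1 u ^ 4) / 9 := by field_simp
  have e8 : 1 / (3 * c0) * (4 * at0 u ^ 3 * at0 z)
    = 2 * (2 / (3 * c0) * at0 u ^ 2 * (at0 z * at0 u)) := by field_simp; ring
  have e9 : 1 / (3 * c1) * (4 * at1 u ^ 3 * at1 z)
    = 2 * (2 / (3 * c1) * at1 u ^ 2 * (at1 z * at1 u)) := by field_simp; ring
  rw [e0] at q0
  rw [e1] at q1
  rw [e2] at f0 ⊢
  rw [e3] at f1 ⊢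
  rw [e4, e5, e8, e9]
  have g0 : 0 ≤ 1 / c0 * at0 u ^ 4 := by positivity
  have g1 : 0 ≤ 1 / c1 * at1 u ^ 4 := by positivity
  set x0 := 1 / c0 * at0 u ^ 4
  set x1 := 1 / c1 * at1 u ^ 4
  have h' : inner ℝ (val u) (val z) + μ * inner ℝ (dx u) (dx z)
      + μ / ν * ((c0 + 1 + wd) + 2 / (3 * c0) * at0 u ^ 2) * (at0 z * at0 u)
      + μ / ν * ((c1 + 1 + wd) + 2 / (3 * c1) * at1 u ^ 2) * (at1 z * at1 u)
      + (ν * ‖dx u‖ ^ 2 + (1 + wd) * ((at1 u ^ 2 - at0 u ^ 2) / 2)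
      + (at1 u ^ 3 - at0 u ^ 3) / 3
      + ((c0 + 1 + wd) * at0 u ^ 2 + 2 * x0 / 9 + ((c1 + 1 + wd) * at1 u ^ 2 + 2 * x1 / 9))) = 0 := by
    rw [← h, ← e6, ← e7]
    ring
  linarith

/-- Tested with `z`, diffusion and boundary feedback become the derivative of the potential, while
`‖z‖²` absorbs convection. The growth coefficient `(4/ν) tsq u` is integrable in time by the energy
inequality. -/
theorem potential_dissipation {μ ν wd c0 c1 κ : ℝ} (hp : Params ν wd c0 c1 κ) (hμ : 0 < μ)
    {u z : H1} (h : weakForm μ ν wd c0 c1 u z z = 0) :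
    potentialD ν wd c0 c1 u z + μ / ν * (at0 z ^ 2 + at1 z ^ 2) ≤
      (1 + wd) ^ 2 * tsq u + 4 / ν * tsq u * potential ν wd c0 c1 u := by
  obtain ⟨hν, hwd, hc0, hc1, hκ, k1, k2, k3, k4⟩ := hp
  rw [weakForm_eq_add, massForm_apply, loadForm_apply,
    real_inner_self_eq_norm_sq, real_inner_self_eq_norm_sq] at h
  have h1 := (abs_le.1 (abs_inner_le (dx u) (val z) (ε := 1 + wd) (by linarith))).1
  have h2 := (abs_le.1 (abs_inner_le (pmul u (dx u)) (val z) one_pos)).1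
  have h3 := norm_pmul_sq_le u (dx u)
  have h4 := norm_dx_sq_le u
  have h5 := tsq_nonneg u
  have h6 : 2 / ν * (ν / 2 * ‖dx u‖ ^ 2) ≤ 2 / ν * potential ν wd c0 c1 u := by
    refine mul_le_mul_of_nonneg_left ?_ (by positivity)
    unfold potential
    have : 0 ≤ ((c0 + 1 + wd) / 2 * at0 u ^ 2 + 1 / (18 * c0) * at0 u ^ 4)
      + ((c1 + 1 + wd) / 2 * at1 u ^ 2 + 1 / (18 * c1) * at1 u ^ 4) := by positivity
    linarith
  have h7 : 2 / ν * (ν / 2 * ‖dx u‖ ^ 2) = ‖dx u‖ ^ 2 := by field_simp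
  rw [h7] at h6
  have h8 := mul_le_mul_of_nonneg_left h6 (by positivity : 0 ≤ 2 * tsq u)
  have h9 : 0 ≤ μ / ν * (c0 + wd + 2 / (3 * c0) * at0 u ^ 2) * at0 z ^ 2 := by positivity
  have h10 : 0 ≤ μ / ν * (c1 + wd + 2 / (3 * c1) * at1 u ^ 2) * at1 z ^ 2 := by positivity
  have h11 : 0 ≤ μ * ‖dx z‖ ^ 2 := by positivity
  have h12 : (1 + wd) * inner ℝ (dx u) (val z) ≥ -((1 + wd) ^ 2 * ‖dx u‖ ^ 2 + 1 / 4 * ‖val z‖ ^ 2) := by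
    have := mul_le_mul_of_nonneg_left h1 (by linarith : 0 ≤ 1 + wd)
    have e : (1 + wd) * -((1 + wd) * ‖dx u‖ ^ 2 + 1 / (4 * (1 + wd)) * ‖val z‖ ^ 2) =
      -((1 + wd) ^ 2 * ‖dx u‖ ^ 2 + 1 / 4 * ‖val z‖ ^ 2) := by field_simp
    linarith
  have h13 := mul_le_mul_of_nonneg_left h4 (sq_nonneg (1 + wd))
  have h14 := sq_nonneg ‖val z‖
  have e : 4 / ν * tsq u * potential ν wd c0 c1 u = 2 * tsq u * (2 / ν * potential ν wd c0 c1 u) := by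
    ring
  rw [e]
  unfold potentialD
  linarith

/-! ### Uniform decay of a single trajectory -/

/-- A trajectory along which the weak formulation may be tested with the state and its time
derivative. -/
structure IsTraj (μ ν wd c0 c1 : ℝ) (u z : ℝ → H1) : Prop where
  continuous : Continuous u
  hasDerivAt : ∀ t, 0 < t → HasDerivAt u (z t) t
  test_self : ∀ t, 0 < t → weakForm μ ν wd c0 c1 (u t) (z t) (u t) = 0
  test_deriv : ∀ t, 0 < t → weakForm μ ν wd c0 c1 (u t) (z t) (z t) = 0

theorem continuous_energy (μ ν wd c0 c1 : ℝ) : Continuous (energy μ ν wd c0 c1) := by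
  have h0 := continuous_at0
  have h1 := continuous_at1
  have h2 := continuous_val
  have h3 := continuous_dx
  unfold energy
  fun_prop

theorem continuous_potential (ν wd c0 c1 : ℝ) : Continuous (potential ν wd c0 c1) := by
  have h0 := continuous_at0
  have h1 := continuous_at1
  have h3 := continuous_dx
  unfold potential
  fun_prop

theorem pow_four_le {x T : ℝ} (h : x ^ 2 ≤ T) : x ^ 4 ≤ T ^ 2 := by
  have := pow_le_pow_left₀ (sq_nonneg x) h 2
  calc x ^ 4 = (x ^ 2) ^ 2 := by ring
    _ ≤ T ^ 2 := this

section

variable {μ ν wd c0 c1 κ α M T : ℝ} {u : H1}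

theorem energy_le (hp : Params ν wd c0 c1 κ) (hμ : 0 < μ) (hμM : μ ≤ M) (hT : tsq u ≤ T) :
    energy μ ν wd c0 c1 u ≤ T + M * T + M / ν * (((c0 + 1 + wd) * T + 1 / (3 * c0) * T ^ 2)
      + ((c1 + 1 + wd) * T + 1 / (3 * c1) * T ^ 2)) := by
  obtain ⟨hν, hwd, hc0, hc1, -⟩ := hp
  have hM : 0 < M := hμ.trans_le hμM
  have h0 := (at0_sq_le u).trans hT
  have h1 := (at1_sq_le u).trans hT
  have h2 := (norm_val_sq_le u).trans hT
  have h3 := (norm_dx_sq_le u).trans hT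
  have h4 := pow_four_le h0
  have h5 := pow_four_le h1
  unfold energy
  gcongr

theorem potential_le (hp : Params ν wd c0 c1 κ) (hT : tsq u ≤ T) :
    potential ν wd c0 c1 u ≤ ν / 2 * T + (((c0 + 1 + wd) / 2 * T + 1 / (18 * c0) * T ^ 2)
      + ((c1 + 1 + wd) / 2 * T + 1 / (18 * c1) * T ^ 2)) := by
  obtain ⟨hν, hwd, hc0, hc1, -⟩ := hp
  have h0 := (at0_sq_le u).trans hT
  have h1 := (at1_sq_le u).trans hT
  have h3 := (norm_dx_sq_le u).trans hT
  have h4 := pow_four_le h0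
  have h5 := pow_four_le h1
  unfold potential
  gcongr

theorem energy_nonneg (hp : Params ν wd c0 c1 κ) (hμ : 0 < μ) : 0 ≤ energy μ ν wd c0 c1 u := by
  obtain ⟨hν, hwd, hc0, hc1, -⟩ := hp
  unfold energy
  positivity

theorem tsq_le_potential (hp : Params ν wd c0 c1 κ) : κ * tsq u ≤ potential ν wd c0 c1 u := by
  obtain ⟨hν, hwd, hc0, hc1, hκ, k1, k2, k3, k4⟩ := hp
  have h0 : κ * at0 u ^ 2 ≤ (c0 + 1 + wd) / 2 * at0 u ^ 2 := by
    gcongr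
    linarith
  have h1 : κ * at1 u ^ 2 ≤ (c1 + 1 + wd) / 2 * at1 u ^ 2 := by
    gcongr
    linarith
  have h2 : κ * ‖dx u‖ ^ 2 ≤ ν / 2 * ‖dx u‖ ^ 2 := by
    gcongr
    linarith
  have h3 : 0 ≤ 1 / (18 * c0) * at0 u ^ 4 := by positivity
  have h4 : 0 ≤ 1 / (18 * c1) * at1 u ^ 4 := by positivity
  unfold tsq potential
  linarith

theorem Rate.two_le (hα : Rate μ ν wd c0 c1 α) (hμ : 0 < μ) : 2 * α ≤ ν := by
  have h := hα.le_μ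
  have := mul_nonneg hα.nonneg hμ.le
  linarith

theorem Rate.mul_le (hα : Rate μ ν wd c0 c1 α) : 2 * α * μ ≤ ν := by
  have h := hα.le_μ
  have := hα.nonneg
  linarith

/-- The potential inequality alone has no decay. `K` copies of the energy dissipation pay for `2α`
times the potential and for its linear source: `K κ` covers the quadratic parts, and `2ν ≤ K` lets
the leftover quartic damping cover the quartic part. -/
theorem combined_dissipation (hp : Params ν wd c0 c1 κ) (hμ : 0 < μ)
    (hα : Rate μ ν wd c0 c1 α) {z : H1} (h : weakForm μ ν wd c0 c1 u z u = 0)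
    (h' : weakForm μ ν wd c0 c1 u z z = 0) {K : ℝ}
    (hK : K = ((1 + wd) ^ 2 + ν * (ν + (c0 + 1 + wd) + (c1 + 1 + wd))) / κ + 2 * ν) :
    (K / 2 * energyD μ ν wd c0 c1 u z + potentialD ν wd c0 c1 u z)
      + 2 * α * (K / 2 * energy μ ν wd c0 c1 u + potential ν wd c0 c1 u)
      + μ / ν * (at0 z ^ 2 + at1 z ^ 2)
      ≤ 4 / ν * tsq u * (K / 2 * energy μ ν wd c0 c1 u + potential ν wd c0 c1 u) := by
  have h1 := energy_dissipation hp hα h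
  have h2 := potential_dissipation hp hμ h'
  have hE := energy_nonneg hp hμ (u := u)
  have h3 := hα.two_le hμ
  have hG := (mul_nonneg hp.κ_pos.le (tsq_nonneg u)).trans (tsq_le_potential hp)
  have h4 := mul_le_mul_of_nonneg_right h3 hG
  obtain ⟨hν, hwd, hc0, hc1, hκ, k1, k2, k3, k4⟩ := hp
  have hK0 : 0 < K := by
    rw [hK]
    positivity
  have h5 := mul_le_mul_of_nonneg_left h1 hK0.le
  have e : K * (κ * tsq u) = ((1 + wd) ^ 2 + ν * (ν + (c0 + 1 + wd) + (c1 + 1 + wd))) * tsq u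
      + 2 * ν * κ * tsq u := by
    rw [hK]
    field_simp
  have h6 : ν * potential ν wd c0 c1 u ≤ ν * (ν + (c0 + 1 + wd) + (c1 + 1 + wd)) * tsq u
      + K * (1 / (36 * c0) * at0 u ^ 4 + 1 / (36 * c1) * at1 u ^ 4) := by
    have h7 : 2 * ν ≤ K := by
      rw [hK]
      have : 0 ≤ ((1 + wd) ^ 2 + ν * (ν + (c0 + 1 + wd) + (c1 + 1 + wd))) / κ := by positivity
      linarith
    have h8 := mul_le_mul_of_nonneg_right h7
      (by positivity : 0 ≤ 1 / (36 * c0) * at0 u ^ 4 + 1 / (36 * c1) * at1 u ^ 4)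
    have e0 : 1 / (18 * c0) * at0 u ^ 4 = 2 * (1 / (36 * c0) * at0 u ^ 4) := by
      field_simp
      ring
    have e1 : 1 / (18 * c1) * at1 u ^ 4 = 2 * (1 / (36 * c1) * at1 u ^ 4) := by
      field_simp
      ring
    have h9 : ν / 2 * ‖dx u‖ ^ 2 + ((c0 + 1 + wd) / 2 * at0 u ^ 2 + (c1 + 1 + wd) / 2 * at1 u ^ 2) ≤
        (ν + (c0 + 1 + wd) + (c1 + 1 + wd)) * tsq u := by
      have i0 := mul_le_mul_of_nonneg_left (at0_sq_le u) (by positivity : 0 ≤ (c0 + 1 + wd) / 2)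
      have i1 := mul_le_mul_of_nonneg_left (at1_sq_le u) (by positivity : 0 ≤ (c1 + 1 + wd) / 2)
      have i2 := mul_le_mul_of_nonneg_left (norm_dx_sq_le u) (by positivity : 0 ≤ ν / 2)
      have i3 : 0 ≤ (ν + (c0 + 1 + wd) + (c1 + 1 + wd)) * tsq u :=
        mul_nonneg (by positivity) (tsq_nonneg u)
      linarith
    have h10 := mul_le_mul_of_nonneg_left h9 hν.le
    unfold potential
    rw [e0, e1]
    linarith
  have h11 : 0 ≤ 2 * ν * κ * tsq u := mul_nonneg (by positivity) (tsq_nonneg u)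
  have h12 : 0 ≤ 4 / ν * tsq u * (K / 2 * energy μ ν wd c0 c1 u) :=
    mul_nonneg (mul_nonneg (by positivity) (tsq_nonneg u)) (by positivity)
  linarith

end

theorem exp_mul_nonneg_ge {α t x : ℝ} (hα : 0 ≤ α) (ht : 0 ≤ t) (hx : 0 ≤ x) :
    x ≤ Real.exp (2 * α * t) * x := by
  have : 1 ≤ Real.exp (2 * α * t) := Real.one_le_exp (by positivity)
  nlinarith

/-- The energy inequality bounds the weighted time integral of `tsq u`, which makes the growth
coefficient of the combined inequality integrable; the latter then gives pointwise decay. The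
boundary dissipation is recorded through an arbitrary continuous minorant `D`, because for the
semidiscrete solution the time derivative is not assumed continuous. -/
theorem traj_bounds {ν wd c0 c1 κ : ℝ} (hp : Params ν wd c0 c1 κ) (M ρ : ℝ) :
    ∃ R : ℝ, 0 < R ∧ ∀ μ α : ℝ, 0 < μ → μ ≤ M → Rate μ ν wd c0 c1 α →
      ∀ u z : ℝ → H1, IsTraj μ ν wd c0 c1 u z → ‖u 0‖ ≤ ρ →
      (∀ t, 0 ≤ t → Real.exp (2 * α * t) * tsq (u t) ≤ R) ∧
      (∀ t, 0 ≤ t → ∫ s in (0 : ℝ)..t, Real.exp (2 * α * s) * tsq (u s) ≤ R) ∧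
      ∀ D : ℝ → ℝ, Continuous D → (∀ t, 0 ≤ D t) →
        (∀ t, 0 < t → D t ≤ μ * (at0 (z t) ^ 2 + at1 (z t) ^ 2)) →
        ∀ t, 0 ≤ t → ∫ s in (0 : ℝ)..t, Real.exp (2 * α * s) * D s ≤ R := by
  obtain ⟨C, hC0, hC⟩ := exists_tsq_le
  obtain ⟨hν, hwd, hc0, hc1, hκ, -⟩ := id hp
  set T := C * ρ ^ 2 with hT
  set E := T + |M| * T + |M| / ν * (((c0 + 1 + wd) * T + 1 / (3 * c0) * T ^ 2)
      + ((c1 + 1 + wd) * T + 1 / (3 * c1) * T ^ 2)) with hE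
  set P := ν / 2 * T + (((c0 + 1 + wd) / 2 * T + 1 / (18 * c0) * T ^ 2)
      + ((c1 + 1 + wd) / 2 * T + 1 / (18 * c1) * T ^ 2)) with hP
  set K := ((1 + wd) ^ 2 + ν * (ν + (c0 + 1 + wd) + (c1 + 1 + wd))) / κ + 2 * ν with hK
  have hT0 : 0 ≤ T := by positivity
  have hE0 : 0 ≤ E := by positivity
  have hP0 : 0 ≤ P := by positivity
  have hK0 : 0 < K := by positivity
  -- The coefficient `4/ν` times the bound `E/(2κ)` for the time integral of `tsq u`.
  set A := 4 / ν * (E / (2 * κ)) with hA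
  set X := Real.exp A * (K / 2 * E + P) with hX
  have hX0 : 0 ≤ X := by positivity
  refine ⟨E / (2 * κ) + X / κ + ν * X + 1, by positivity, ?_⟩
  intro μ α hμ hμM hα u z hu hρ
  have hu0 : tsq (u 0) ≤ T := (hC _).trans (by
    rw [hT]
    gcongr)
  have hE1 : energy μ ν wd c0 c1 (u 0) ≤ E := energy_le hp hμ (hμM.trans (le_abs_self M)) hu0
  have hP1 : potential ν wd c0 c1 (u 0) ≤ P := potential_le hp hu0
  have cE : Continuous fun t => energy μ ν wd c0 c1 (u t) :=
    (continuous_energy μ ν wd c0 c1).comp hu.continuous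
  have cP : Continuous fun t => potential ν wd c0 c1 (u t) :=
    (continuous_potential ν wd c0 c1).comp hu.continuous
  have cT : Continuous fun t => tsq (u t) := continuous_tsq.comp hu.continuous
  have cX : Continuous fun t : ℝ => Real.exp (2 * α * t) := by fun_prop
  have step1 : ∀ t, 0 ≤ t → ∫ s in (0 : ℝ)..t, Real.exp (2 * α * s) * tsq (u s) ≤ E / (2 * κ) := by
    intro t ht
    have h := gronwall_weighted (φ := fun t => energy μ ν wd c0 c1 (u t))
      (φ' := fun t => energyD μ ν wd c0 c1 (u t) (z t)) (G := fun _ => 0) (B := fun _ => 0)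
      (D := fun t => 2 * κ * tsq (u t)) (α := α) (A := 0) (b := 0) cE.continuousOn
      (fun t ht => hasDerivAt_energy μ ν wd c0 c1 (hu.hasDerivAt t ht)) continuous_const
      continuous_const (cT.const_mul _) (fun _ => le_rfl) (fun _ => le_rfl)
      (fun t => mul_nonneg (by positivity) (tsq_nonneg _)) (fun t => energy_nonneg hp hμ)
      (fun t ht => by
        have h1 := energy_dissipation hp hα (hu.test_self t ht)
        have h2 : 0 ≤ 1 / (36 * c0) * at0 (u t) ^ 4 + 1 / (36 * c1) * at1 (u t) ^ 4 := by
          positivity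
        linarith) (by simp) (by simp) ht
    have h1 : 0 ≤ Real.exp (2 * α * t) * energy μ ν wd c0 c1 (u t) :=
      mul_nonneg (Real.exp_pos _).le (energy_nonneg hp hμ)
    have h2 : ∫ s in (0 : ℝ)..t, Real.exp (2 * α * s) * (2 * κ * tsq (u s)) =
        2 * κ * ∫ s in (0 : ℝ)..t, Real.exp (2 * α * s) * tsq (u s) := by
      rw [← intervalIntegral.integral_const_mul]
      congr 1
      ext s
      ring
    rw [h2, Real.exp_zero, one_mul, add_zero] at h
    rw [le_div_iff₀ (by positivity)]
    linarith
  have step2 : ∀ D : ℝ → ℝ, Continuous D → (∀ t, 0 ≤ D t) →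
      (∀ t, 0 < t → D t ≤ μ * (at0 (z t) ^ 2 + at1 (z t) ^ 2)) → ∀ t, 0 ≤ t →
      Real.exp (2 * α * t) * potential ν wd c0 c1 (u t) +
        1 / ν * ∫ s in (0 : ℝ)..t, Real.exp (2 * α * s) * D s ≤ X := by
    intro D hD hD0 hDz t ht
    have h := gronwall_weighted
      (φ := fun t => K / 2 * energy μ ν wd c0 c1 (u t) + potential ν wd c0 c1 (u t))
      (φ' := fun t => K / 2 * energyD μ ν wd c0 c1 (u t) (z t) + potentialD ν wd c0 c1 (u t) (z t))
      (G := fun t => 4 / ν * tsq (u t)) (B := fun _ => 0) (D := fun t => 1 / ν * D t) (α := α)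
      (A := A) (b := 0) ((cE.const_mul _).add cP).continuousOn
      (fun t ht => ((hasDerivAt_energy μ ν wd c0 c1 (hu.hasDerivAt t ht)).const_mul _).add
        (hasDerivAt_potential (hu.hasDerivAt t ht)))
      (cT.const_mul _) continuous_const (hD.const_mul _)
      (fun t => mul_nonneg (by positivity) (tsq_nonneg _)) (fun _ => le_rfl)
      (fun t => mul_nonneg (by positivity) (hD0 t))
      (fun t => add_nonneg (mul_nonneg (by positivity) (energy_nonneg hp hμ))
        ((mul_nonneg hκ.le (tsq_nonneg _)).trans (tsq_le_potential hp)))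
      (fun t ht => by
        have h1 := combined_dissipation hp hμ hα (hu.test_self t ht) (hu.test_deriv t ht) hK
        have h2 := mul_le_mul_of_nonneg_left (hDz t ht) (by positivity : 0 ≤ 1 / ν)
        have e : 1 / ν * (μ * (at0 (z t) ^ 2 + at1 (z t) ^ 2)) =
          μ / ν * (at0 (z t) ^ 2 + at1 (z t) ^ 2) := by ring
        linarith)
      (fun t ht => by
        rw [intervalIntegral.integral_const_mul, hA]
        refine mul_le_mul_of_nonneg_left (le_trans ?_ (step1 t ht)) (by positivity)
        refine intervalIntegral.integral_mono_on ht (cT.intervalIntegrable _ _)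
          ((cX.mul cT).intervalIntegrable _ _) fun s hs => ?_
        exact exp_mul_nonneg_ge hα.nonneg hs.1 (tsq_nonneg _)) (by simp) ht
    have h1 : 0 ≤ Real.exp (2 * α * t) * (K / 2 * energy μ ν wd c0 c1 (u t)) :=
      mul_nonneg (Real.exp_pos _).le (mul_nonneg (by positivity) (energy_nonneg hp hμ))
    have h2 : ∫ s in (0 : ℝ)..t, Real.exp (2 * α * s) * (1 / ν * D s) =
        1 / ν * ∫ s in (0 : ℝ)..t, Real.exp (2 * α * s) * D s := by
      rw [← intervalIntegral.integral_const_mul]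
      congr 1
      ext s
      ring
    rw [h2] at h
    have h3 : Real.exp A * (K / 2 * energy μ ν wd c0 c1 (u 0) + potential ν wd c0 c1 (u 0) + 0)
        ≤ X := by
      rw [hX, add_zero]
      gcongr
    linarith
  have q1 : 0 ≤ E / (2 * κ) := by positivity
  have q2 : 0 ≤ X / κ := by positivity
  have q3 : 0 ≤ ν * X := by positivity
  refine ⟨fun t ht => ?_, fun t ht => (step1 t ht).trans (by linarith), fun D hD hD0 hDz t ht => ?_⟩
  · have h := step2 (fun _ => 0) continuous_const (fun _ => le_rfl)
      (fun t _ => mul_nonneg hμ.le (by positivity)) t ht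
    simp only [mul_zero, intervalIntegral.integral_zero, add_zero] at h
    have h1 := mul_le_mul_of_nonneg_left (tsq_le_potential hp (u := u t))
      (Real.exp_pos (2 * α * t)).le
    have h2 : Real.exp (2 * α * t) * tsq (u t) ≤ X / κ := by
      rw [le_div_iff₀ hκ]
      linarith
    linarith
  · have h := step2 D hD hD0 hDz t ht
    have h1 : 0 ≤ Real.exp (2 * α * t) * potential ν wd c0 c1 (u t) :=
      mul_nonneg (Real.exp_pos _).le ((mul_nonneg hκ.le (tsq_nonneg _)).trans (tsq_le_potential hp))
    have h2 : 1 / ν * ∫ s in (0 : ℝ)..t, Real.exp (2 * α * s) * D s ≤ X := by linarith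
    have h3 := mul_le_mul_of_nonneg_left h2 hν.le
    rw [← mul_assoc, mul_one_div_cancel hν.ne', one_mul] at h3
    linarith

/-! ### The difference of two trajectories -/

/-- The boundary part of `diffEnergy`. -/
def bdryP (p s : ℝ) : ℝ := 1 / 2 * p ^ 2 * s ^ 2 - 2 / 3 * p * s ^ 3 + 1 / 4 * s ^ 4

/-- The derivative of `bdryP`. -/
def bdryPD (p p' s s' : ℝ) : ℝ :=
  p * p' * s ^ 2 + p ^ 2 * s * s' - 2 / 3 * p' * s ^ 3 - 2 * p * s ^ 2 * s' + s ^ 3 * s'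

/-- The boundary part of `diffPotential`. -/
def bdryQ (p s : ℝ) : ℝ := 3 / 2 * p ^ 2 * s ^ 2 - p * s ^ 3 + 1 / 4 * s ^ 4

/-- The derivative of `bdryQ`. -/
def bdryQD (p p' s s' : ℝ) : ℝ :=
  3 * p * p' * s ^ 2 + 3 * p ^ 2 * s * s' - p' * s ^ 3 - 3 * p * s ^ 2 * s' + s ^ 3 * s'

/-- `bdryP p s` is the integral of `σ (p - σ)²` over `[0, s]`: its `s`-derivative matches the
boundary mass at the discrete state `p - s`, tested with `s`. -/
theorem bdryP_nonneg (p s : ℝ) : 0 ≤ bdryP p s := by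
  have : bdryP p s = s ^ 2 * ((s / 2 - 2 / 3 * p) ^ 2 + 1 / 18 * p ^ 2) := by
    unfold bdryP
    ring
  rw [this]
  positivity

theorem bdryP_le (p s : ℝ) : bdryP p s ≤ (p ^ 2 + s ^ 2) * s ^ 2 := by
  have : (p ^ 2 + s ^ 2) * s ^ 2 - bdryP p s =
      s ^ 2 * (1 / 3 * (p + s) ^ 2 + 1 / 6 * p ^ 2 + 5 / 12 * s ^ 2) := by
    unfold bdryP
    ring
  have h : 0 ≤ s ^ 2 * (1 / 3 * (p + s) ^ 2 + 1 / 6 * p ^ 2 + 5 / 12 * s ^ 2) := by positivity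
  linarith

/-- `bdryQ p s` is the integral of `p³ - (p - σ)³` over `[0, s]`, the potential of the difference of
the two cubic feedbacks. -/
theorem bdryQ_nonneg (p s : ℝ) : 0 ≤ bdryQ p s := by
  have : bdryQ p s = s ^ 2 * ((s / 2 - p) ^ 2 + 1 / 2 * p ^ 2) := by
    unfold bdryQ
    ring
  rw [this]
  positivity

theorem bdryQ_le (p s : ℝ) : bdryQ p s ≤ 2 * (p ^ 2 + s ^ 2) * s ^ 2 := by
  have : 2 * (p ^ 2 + s ^ 2) * s ^ 2 - bdryQ p s =
      s ^ 2 * (1 / 2 * (p + s) ^ 2 + 5 / 4 * s ^ 2) := by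
    unfold bdryQ
    ring
  have h : 0 ≤ s ^ 2 * (1 / 2 * (p + s) ^ 2 + 5 / 4 * s ^ 2) := by positivity
  linarith

/-- The energy of a perturbation `ζ` of the state `w`. -/
def diffEnergy (μ ν wd c0 c1 : ℝ) (w ζ : H1) : ℝ :=
  ‖val ζ‖ ^ 2 + μ * ‖dx ζ‖ ^ 2 + μ / ν *
    (((c0 + 1 + wd) * at0 ζ ^ 2 + 4 / (3 * c0) * bdryP (at0 w) (at0 ζ))
    + ((c1 + 1 + wd) * at1 ζ ^ 2 + 4 / (3 * c1) * bdryP (at1 w) (at1 ζ)))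

/-- Half the derivative of `diffEnergy`. -/
def diffEnergyD (μ ν wd c0 c1 : ℝ) (w z ζ ζt : H1) : ℝ :=
  inner ℝ (val ζ) (val ζt) + μ * inner ℝ (dx ζ) (dx ζt) + μ / ν *
    (((c0 + 1 + wd) * (at0 ζ * at0 ζt)
      + 2 / (3 * c0) * bdryPD (at0 w) (at0 z) (at0 ζ) (at0 ζt))
    + ((c1 + 1 + wd) * (at1 ζ * at1 ζt)
      + 2 / (3 * c1) * bdryPD (at1 w) (at1 z) (at1 ζ) (at1 ζt)))

/-- The potential of a perturbation `ζ` of the state `w`. -/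
def diffPotential (ν wd c0 c1 : ℝ) (w ζ : H1) : ℝ :=
  ν / 2 * ‖dx ζ‖ ^ 2 +
    (((c0 + 1 + wd) / 2 * at0 ζ ^ 2 + 2 / (9 * c0) * bdryQ (at0 w) (at0 ζ))
    + ((c1 + 1 + wd) / 2 * at1 ζ ^ 2 + 2 / (9 * c1) * bdryQ (at1 w) (at1 ζ)))

/-- The derivative of `diffPotential`. -/
def diffPotentialD (ν wd c0 c1 : ℝ) (w z ζ ζt : H1) : ℝ :=
  ν * inner ℝ (dx ζ) (dx ζt) +
    (((c0 + 1 + wd) * (at0 ζ * at0 ζt)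
      + 2 / (9 * c0) * bdryQD (at0 w) (at0 z) (at0 ζ) (at0 ζt))
    + ((c1 + 1 + wd) * (at1 ζ * at1 ζt)
      + 2 / (9 * c1) * bdryQD (at1 w) (at1 z) (at1 ζ) (at1 ζt)))

theorem hasDerivAt_bdryP {p s : ℝ → ℝ} {p' s' t : ℝ} (hp : HasDerivAt p p' t)
    (hs : HasDerivAt s s' t) :
    HasDerivAt (fun t => bdryP (p t) (s t)) (bdryPD (p t) p' (s t) s') t := by
  have := ((((hp.fun_pow 2).const_mul (1 / 2)).fun_mul (hs.fun_pow 2)).sub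
    ((hp.const_mul (2 / 3)).fun_mul (hs.fun_pow 3))).add ((hs.fun_pow 4).const_mul (1 / 4))
  refine this.congr_deriv ?_
  simp only [bdryPD, Nat.cast_ofNat]
  ring

theorem hasDerivAt_bdryQ {p s : ℝ → ℝ} {p' s' t : ℝ} (hp : HasDerivAt p p' t)
    (hs : HasDerivAt s s' t) :
    HasDerivAt (fun t => bdryQ (p t) (s t)) (bdryQD (p t) p' (s t) s') t := by
  have := ((((hp.fun_pow 2).const_mul (3 / 2)).fun_mul (hs.fun_pow 2)).sub
    (hp.fun_mul (hs.fun_pow 3))).add ((hs.fun_pow 4).const_mul (1 / 4))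
  refine this.congr_deriv ?_
  simp only [bdryQD, Nat.cast_ofNat]
  ring

theorem hasDerivAt_diffEnergy (μ ν wd c0 c1 : ℝ) {w ζ : ℝ → H1} {z ζt : H1} {t : ℝ}
    (hw : HasDerivAt w z t) (hζ : HasDerivAt ζ ζt t) :
    HasDerivAt (fun t => diffEnergy μ ν wd c0 c1 (w t) (ζ t))
      (2 * diffEnergyD μ ν wd c0 c1 (w t) z (ζ t) ζt) t := by
  have h0 := hasDerivAt_at0 hζ
  have h1 := hasDerivAt_at1 hζ
  have := ((hasDerivAt_val hζ).norm_sq.add ((hasDerivAt_dx hζ).norm_sq.const_mul μ)).add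
    (((((h0.fun_pow 2).const_mul (c0 + 1 + wd)).add
        ((hasDerivAt_bdryP (hasDerivAt_at0 hw) h0).const_mul (4 / (3 * c0)))).add
      (((h1.fun_pow 2).const_mul (c1 + 1 + wd)).add
        ((hasDerivAt_bdryP (hasDerivAt_at1 hw) h1).const_mul (4 / (3 * c1))))).const_mul (μ / ν))
  refine this.congr_deriv ?_
  simp only [diffEnergyD, Nat.cast_ofNat]
  ring

theorem hasDerivAt_diffPotential {ν wd c0 c1 : ℝ} {w ζ : ℝ → H1} {z ζt : H1} {t : ℝ}
    (hw : HasDerivAt w z t) (hζ : HasDerivAt ζ ζt t) :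
    HasDerivAt (fun t => diffPotential ν wd c0 c1 (w t) (ζ t))
      (diffPotentialD ν wd c0 c1 (w t) z (ζ t) ζt) t := by
  have h0 := hasDerivAt_at0 hζ
  have h1 := hasDerivAt_at1 hζ
  have := ((hasDerivAt_dx hζ).norm_sq.const_mul (ν / 2)).add
    ((((h0.fun_pow 2).const_mul ((c0 + 1 + wd) / 2)).add
        ((hasDerivAt_bdryQ (hasDerivAt_at0 hw) h0).const_mul (2 / (9 * c0)))).add
      (((h1.fun_pow 2).const_mul ((c1 + 1 + wd) / 2)).add
        ((hasDerivAt_bdryQ (hasDerivAt_at1 hw) h1).const_mul (2 / (9 * c1)))))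
  refine this.congr_deriv ?_
  simp only [diffPotentialD, Nat.cast_ofNat]
  ring

/-- The consistency error of the interpolation error `η`, tested with `χ`. -/
def remainder (wd : ℝ) (w wh η ηt χ : H1) : ℝ :=
  inner ℝ (val ηt) (val χ) +
    inner ℝ ((1 + wd) • dx η + pmul η (dx w) + pmul wh (dx η)) (val χ)

/-- The hypotheses on two states `w`, `wh` with time derivatives `z`, `zh` and a splitting
`w - wh = η + ζ` of their difference. -/
structure Splitting (w z wh zh η ηt ζ ζt : H1) : Prop where
  state : wh = w - η - ζ
  deriv : zh = z - ηt - ζt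
  η0 : at0 η = 0
  η1 : at1 η = 0
  ηt0 : at0 ηt = 0
  ηt1 : at1 ηt = 0

/-- Subtract the two equations. The quadratic term splits as `w w_x - w_h w_hx = ζ w_x + w_h ζ_x + η
w_x + w_h η_x`; orthogonality and the zero traces of `η` and `η_t` confine these two to `remainder`.
-/
theorem difference_identity {μ ν wd c0 c1 : ℝ} {w z wh zh η ηt ζ ζt χ : H1}
    (hs : Splitting w z wh zh η ηt ζ ζt) (h : weakForm μ ν wd c0 c1 w z χ = 0)
    (hh : weakForm μ ν wd c0 c1 wh zh χ = 0) (o1 : inner ℝ (dx η) (dx χ) = 0)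
    (o2 : inner ℝ (dx ηt) (dx χ) = 0) :
    inner ℝ (val ζt) (val χ) + μ * inner ℝ (dx ζt) (dx χ) + ν * inner ℝ (dx ζ) (dx χ)
      + (1 + wd) * inner ℝ (dx ζ) (val χ)
      + inner ℝ (pmul ζ (dx w) + pmul wh (dx ζ)) (val χ)
      + μ / ν * (((c0 + 1 + wd) * at0 ζt + 2 / (3 * c0) *
          (at0 w ^ 2 * at0 z - (at0 w - at0 ζ) ^ 2 * (at0 z - at0 ζt))) * at0 χ
        + ((c1 + 1 + wd) * at1 ζt + 2 / (3 * c1) *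
          (at1 w ^ 2 * at1 z - (at1 w - at1 ζ) ^ 2 * (at1 z - at1 ζt))) * at1 χ)
      + (((c0 + 1 + wd) * at0 ζ + 2 / (9 * c0) * (at0 w ^ 3 - (at0 w - at0 ζ) ^ 3)) * at0 χ
        + ((c1 + 1 + wd) * at1 ζ + 2 / (9 * c1) * (at1 w ^ 3 - (at1 w - at1 ζ) ^ 3)) * at1 χ)
      + remainder wd w wh η ηt χ = 0 := by
  obtain ⟨e1, e2, a1, a2, a3, a4⟩ := hs
  have n : pmul w (dx w) = pmul wh (dx wh) + (pmul ζ (dx w) + pmul wh (dx ζ))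
      + (pmul η (dx w) + pmul wh (dx η)) := by
    have f1 : dx wh = dx w - dx η - dx ζ := by rw [e1, dx_sub, dx_sub]
    have f2 : pmul w (dx w) = pmul (wh + ζ + η) (dx w) := by
      congr 1
      rw [e1]
      abel
    rw [f1, f2, pmul_add_left, pmul_add_left, pmul_sub_right, pmul_sub_right]
    abel
  rw [weakForm_eq_add, massForm_apply, loadForm_apply] at h hh
  rw [n] at h
  have v1 : val zh = val z - val ηt - val ζt := by rw [e2, val_sub, val_sub]
  have v2 : dx zh = dx z - dx ηt - dx ζt := by rw [e2, dx_sub, dx_sub]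
  have v3 : dx wh = dx w - dx η - dx ζ := by rw [e1, dx_sub, dx_sub]
  have v4 : at0 wh = at0 w - at0 ζ := by rw [e1, at0_sub, at0_sub, a1, sub_zero]
  have v5 : at1 wh = at1 w - at1 ζ := by rw [e1, at1_sub, at1_sub, a2, sub_zero]
  have v6 : at0 zh = at0 z - at0 ζt := by rw [e2, at0_sub, at0_sub, a3, sub_zero]
  have v7 : at1 zh = at1 z - at1 ζt := by rw [e2, at1_sub, at1_sub, a4, sub_zero]
  have i1 : inner ℝ (val zh) (val χ) = inner ℝ (val z) (val χ) - inner ℝ (val ηt) (val χ)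
      - inner ℝ (val ζt) (val χ) := by rw [v1, inner_sub_left, inner_sub_left]
  have i2 : inner ℝ (dx zh) (dx χ) = inner ℝ (dx z) (dx χ) - inner ℝ (dx ζt) (dx χ) := by
    rw [v2, inner_sub_left, inner_sub_left, o2, sub_zero]
  have i3 : inner ℝ (dx wh) (dx χ) = inner ℝ (dx w) (dx χ) - inner ℝ (dx ζ) (dx χ) := by
    rw [v3, inner_sub_left, inner_sub_left, o1, sub_zero]
  have i4 : inner ℝ (dx wh) (val χ) = inner ℝ (dx w) (val χ) - inner ℝ (dx η) (val χ)
      - inner ℝ (dx ζ) (val χ) := by rw [v3, inner_sub_left, inner_sub_left]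
  rw [i1, i2, i3, i4, v4, v5, v6, v7] at hh
  simp only [remainder, inner_add_left, real_inner_smul_left] at h ⊢
  unfold bdry at h hh
  linear_combination h - hh

theorem norm_add_sq_le (x y : L2) : ‖x + y‖ ^ 2 ≤ 2 * ‖x‖ ^ 2 + 2 * ‖y‖ ^ 2 := by
  have h := pow_le_pow_left₀ (norm_nonneg _) (norm_add_le x y) 2
  nlinarith [sq_nonneg (‖x‖ - ‖y‖)]

theorem norm_convection_sq_le (w wh ζ : H1) :
    ‖pmul ζ (dx w) + pmul wh (dx ζ)‖ ^ 2 ≤ 4 * tsq ζ * (tsq w + tsq wh) := by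
  have h1 := norm_add_sq_le (pmul ζ (dx w)) (pmul wh (dx ζ))
  have h2 := norm_pmul_sq_le ζ (dx w)
  have h3 := norm_pmul_sq_le wh (dx ζ)
  have h4 := mul_le_mul_of_nonneg_left (norm_dx_sq_le w) (tsq_nonneg ζ)
  have h5 := mul_le_mul_of_nonneg_left (norm_dx_sq_le ζ) (tsq_nonneg wh)
  linarith

theorem boundary_cubic_le {c X s : ℝ} (hc : 0 < c) :
    |X| * s ^ 2 ≤ c / 8 * s ^ 2 + 2 / c * X ^ 2 * s ^ 2 := by
  have h : |X| ≤ c / 8 + 2 / c * X ^ 2 := by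
    have h1 : c / 8 + 2 / c * X ^ 2 - |X| = (c - 4 * |X|) ^ 2 / (8 * c) := by
      rw [← sq_abs X]
      field_simp
      ring
    have h2 : 0 ≤ (c - 4 * |X|) ^ 2 / (8 * c) := by positivity
    linarith
  calc |X| * s ^ 2 ≤ (c / 8 + 2 / c * X ^ 2) * s ^ 2 :=
        mul_le_mul_of_nonneg_right h (sq_nonneg s)
    _ = _ := by ring

/-- The contribution of one boundary point to the energy inequality for differences. -/
theorem boundary_energy_le {μ ν c R p p' s α : ℝ} (hν : 0 < ν) (hμ : 0 < μ) (hc : 0 < c)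
    (hα2 : 2 * α ≤ ν) (hp : p ^ 2 ≤ R) (hq : (p - s) ^ 2 ≤ R) {g : ℝ}
    (hg : p ^ 2 + (p - s) ^ 2 + μ * p' ^ 2 ≤ g) :
    α * (μ / ν) * (4 / (3 * c) * bdryP p s)
      - μ / ν * (2 / (3 * c) * (p * p' * s ^ 2 - 1 / 3 * p' * s ^ 3)) ≤
      c / 8 * s ^ 2 + (2 / c + 8 * R / (9 * c ^ 3 * ν ^ 2)) * g * (μ * s ^ 2) := by
  have hR : 0 ≤ R := (sq_nonneg p).trans hp
  have hg0 : μ * p' ^ 2 ≤ g := by nlinarith [sq_nonneg p, sq_nonneg (p - s)]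
  have hgp : p ^ 2 + s ^ 2 ≤ 3 * g := by
    have : 0 ≤ μ * p' ^ 2 := by positivity
    nlinarith [sq_nonneg (p + (p - s)), sq_nonneg (p - s)]
  have h1 : α * (μ / ν) * (4 / (3 * c) * bdryP p s) ≤ 2 / c * g * (μ * s ^ 2) := by
    have e1 : α * (μ / ν) * (4 / (3 * c) * bdryP p s) =
        (2 * α / ν) * (2 * μ / (3 * c) * bdryP p s) := by
      field_simp
      ring
    have h2 : 2 * α / ν ≤ 1 := (div_le_one hν).2 hα2
    have h3 : bdryP p s ≤ 3 * g * s ^ 2 :=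
      (bdryP_le p s).trans (mul_le_mul_of_nonneg_right hgp (sq_nonneg s))
    have h4 := bdryP_nonneg p s
    rw [e1]
    calc _ ≤ 1 * (2 * μ / (3 * c) * bdryP p s) :=
          mul_le_mul_of_nonneg_right h2 (by positivity)
      _ ≤ 1 * (2 * μ / (3 * c) * (3 * g * s ^ 2)) := by gcongr
      _ = _ := by
        field_simp
  -- The coefficient of the boundary mass moves in time, and the excess is `p' (p - s/3) s²`. Its
  -- Young bound contains `(μ p')² s² = (μ p'²)(μ s²)`, where the first factor is integrable in time
  -- and the second is controlled by the energy of the difference.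
  have h2 := boundary_cubic_le (c := c) (X := μ / ν * (2 / (3 * c)) * (p' * (p - 1 / 3 * s)))
    (s := s) hc
  have h3 : -(μ / ν * (2 / (3 * c) * (p * p' * s ^ 2 - 1 / 3 * p' * s ^ 3))) ≤
      |μ / ν * (2 / (3 * c)) * (p' * (p - 1 / 3 * s))| * s ^ 2 := by
    have := mul_le_mul_of_nonneg_right
      (neg_abs_le (μ / ν * (2 / (3 * c)) * (p' * (p - 1 / 3 * s)))) (sq_nonneg s)
    linarith
  -- `p - s/3` is the convex combination `(2/3) p + (1/3) (p - s)` of the two boundary states.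
  have h4 : (p - 1 / 3 * s) ^ 2 ≤ R := by nlinarith [sq_nonneg (p - (p - s))]
  have h5 : 2 / c * (μ / ν * (2 / (3 * c)) * (p' * (p - 1 / 3 * s))) ^ 2 * s ^ 2 ≤
      8 * R / (9 * c ^ 3 * ν ^ 2) * g * (μ * s ^ 2) := by
    have e : 2 / c * (μ / ν * (2 / (3 * c)) * (p' * (p - 1 / 3 * s))) ^ 2 * s ^ 2 =
        8 / (9 * c ^ 3 * ν ^ 2) * (μ * p' ^ 2 * (p - 1 / 3 * s) ^ 2) * (μ * s ^ 2) := by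
      field_simp
      ring
    have h6 : μ * p' ^ 2 * (p - 1 / 3 * s) ^ 2 ≤ g * R :=
      mul_le_mul hg0 h4 (sq_nonneg _) ((by positivity : (0 : ℝ) ≤ μ * p' ^ 2).trans hg0)
    rw [e]
    calc _ ≤ 8 / (9 * c ^ 3 * ν ^ 2) * (g * R) * (μ * s ^ 2) := by gcongr
      _ = _ := by ring
  linarith

theorem diffEnergy_nonneg {μ ν wd c0 c1 κ : ℝ} (hp : Params ν wd c0 c1 κ) (hμ : 0 < μ)
    (w ζ : H1) : 0 ≤ diffEnergy μ ν wd c0 c1 w ζ := by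
  obtain ⟨hν, hwd, hc0, hc1, -⟩ := hp
  have h0 := bdryP_nonneg (at0 w) (at0 ζ)
  have h1 := bdryP_nonneg (at1 w) (at1 ζ)
  unfold diffEnergy
  positivity

theorem boundary_le_diffEnergy {μ ν wd c0 c1 κ : ℝ} (hp : Params ν wd c0 c1 κ) (hμ : 0 < μ)
    (w ζ : H1) : ‖val ζ‖ ^ 2 ≤ diffEnergy μ ν wd c0 c1 w ζ ∧
      μ * ‖dx ζ‖ ^ 2 ≤ diffEnergy μ ν wd c0 c1 w ζ ∧
      μ * at0 ζ ^ 2 ≤ ν * diffEnergy μ ν wd c0 c1 w ζ ∧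
      μ * at1 ζ ^ 2 ≤ ν * diffEnergy μ ν wd c0 c1 w ζ := by
  obtain ⟨hν, hwd, hc0, hc1, -⟩ := hp
  have h0 := bdryP_nonneg (at0 w) (at0 ζ)
  have h1 := bdryP_nonneg (at1 w) (at1 ζ)
  have q1 : 0 ≤ μ / ν * ((c0 + wd) * at0 ζ ^ 2 + 4 / (3 * c0) * bdryP (at0 w) (at0 ζ)) := by
    positivity
  have q2 : 0 ≤ μ / ν * ((c1 + wd) * at1 ζ ^ 2 + 4 / (3 * c1) * bdryP (at1 w) (at1 ζ)) := by
    positivity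
  have q3 : 0 ≤ ‖val ζ‖ ^ 2 := by positivity
  have q4 : 0 ≤ μ * ‖dx ζ‖ ^ 2 := by positivity
  have q5 : 0 ≤ μ / ν * at0 ζ ^ 2 := by positivity
  have q6 : 0 ≤ μ / ν * at1 ζ ^ 2 := by positivity
  have e5 : μ * at0 ζ ^ 2 = ν * (μ / ν * at0 ζ ^ 2) := by field_simp
  have e6 : μ * at1 ζ ^ 2 = ν * (μ / ν * at1 ζ ^ 2) := by field_simp
  rw [e5, e6]
  refine ⟨?_, ?_, mul_le_mul_of_nonneg_left ?_ hν.le, mul_le_mul_of_nonneg_left ?_ hν.le⟩ <;>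
  · unfold diffEnergy
    linarith

/-- The constant in the energy inequality for differences. -/
def diffConst (ν c0 c1 κ R : ℝ) : ℝ :=
  1 / κ + ν * (2 / c0 + 8 * R / (9 * c0 ^ 3 * ν ^ 2)) + ν * (2 / c1 + 8 * R / (9 * c1 ^ 3 * ν ^ 2))

/-- The budget is that of a single trajectory, except that the nonlinear terms are moved to the
right with an integrable growth coefficient. Convection is split so that this coefficient multiplies
only `‖ζ‖²`, and moving boundary coefficients cost `c/8`. The difference of the cubic feedbacks has
a favourable sign and is dropped. -/
theorem diffEnergy_dissipation {μ ν wd c0 c1 κ α R : ℝ} (hp : Params ν wd c0 c1 κ) (hμ : 0 < μ)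
    (hα : Rate μ ν wd c0 c1 α) {w z wh zh η ηt ζ ζt : H1} (hs : Splitting w z wh zh η ηt ζ ζt)
    (h : weakForm μ ν wd c0 c1 w z ζ = 0) (hh : weakForm μ ν wd c0 c1 wh zh ζ = 0)
    (o1 : inner ℝ (dx η) (dx ζ) = 0) (o2 : inner ℝ (dx ηt) (dx ζ) = 0)
    (hw : tsq w ≤ R) (hwh : tsq wh ≤ R) :
    diffEnergyD μ ν wd c0 c1 w z ζ ζt + α * diffEnergy μ ν wd c0 c1 w ζ + κ * tsq ζ ≤
      diffConst ν c0 c1 κ R * (tsq w + tsq wh + μ * (at0 z ^ 2 + at1 z ^ 2))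
        * diffEnergy μ ν wd c0 c1 w ζ - remainder wd w wh η ηt ζ := by
  have id := difference_identity hs h hh o1 o2
  obtain ⟨n1, -, n3, n4⟩ := boundary_le_diffEnergy hp hμ w ζ
  have hE := diffEnergy_nonneg hp hμ w ζ
  have h2α := hα.two_le hμ
  have hconv := norm_convection_sq_le w wh ζ
  set G := tsq w + tsq wh with hG
  set E := diffEnergy μ ν wd c0 c1 w ζ with hEdef
  set g := G + μ * (at0 z ^ 2 + at1 z ^ 2) with hg
  have hG0 : 0 ≤ G := add_nonneg (tsq_nonneg _) (tsq_nonneg _)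
  have hT0 := tsq_nonneg ζ
  have hb0 : at0 w - at0 ζ = at0 wh := by rw [hs.state, at0_sub, at0_sub, hs.η0, sub_zero]
  have hb1 : at1 w - at1 ζ = at1 wh := by rw [hs.state, at1_sub, at1_sub, hs.η1, sub_zero]
  have hR : 0 ≤ R := (tsq_nonneg w).trans hw
  obtain ⟨hν, hwd, hc0, hc1, hκ, k1, k2, k3, k4⟩ := hp
  have hz0 : 0 ≤ μ * at0 z ^ 2 := by positivity
  have hz1 : 0 ≤ μ * at1 z ^ 2 := by positivity
  have hg0 : 0 ≤ g := by
    rw [hg]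
    positivity
  have hGg : G ≤ g := by
    rw [hg]
    linarith
  have B0 := boundary_energy_le (p' := at0 z) (g := g) hν hμ hc0 h2α
    ((at0_sq_le w).trans hw)
    (by
      rw [hb0]
      exact (at0_sq_le wh).trans hwh)
    (by
      rw [hb0, hg, hG]
      linarith [at0_sq_le w, at0_sq_le wh])
  have B1 := boundary_energy_le (p' := at1 z) (g := g) hν hμ hc1 h2α
    ((at1_sq_le w).trans hw)
    (by
      rw [hb1]
      exact (at1_sq_le wh).trans hwh)
    (by
      rw [hb1, hg, hG]
      linarith [at1_sq_le w, at1_sq_le wh])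
  have C0 : (2 / c0 + 8 * R / (9 * c0 ^ 3 * ν ^ 2)) * g * (μ * at0 ζ ^ 2) ≤
      (2 / c0 + 8 * R / (9 * c0 ^ 3 * ν ^ 2)) * g * (ν * E) :=
    mul_le_mul_of_nonneg_left n3 (by positivity)
  have C1 : (2 / c1 + 8 * R / (9 * c1 ^ 3 * ν ^ 2)) * g * (μ * at1 ζ ^ 2) ≤
      (2 / c1 + 8 * R / (9 * c1 ^ 3 * ν ^ 2)) * g * (ν * E) :=
    mul_le_mul_of_nonneg_left n4 (by positivity)
  have N : |inner ℝ (pmul ζ (dx w) + pmul wh (dx ζ)) (val ζ)| ≤ κ * tsq ζ + 1 / κ * g * E := by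
    have i1 : |inner ℝ (pmul ζ (dx w) + pmul wh (dx ζ)) (val ζ)| ≤
        κ * tsq ζ + 1 / κ * G * ‖val ζ‖ ^ 2 := by
      refine abs_le_of_sq_le_sq ?_ (by positivity)
      have j1 := abs_real_inner_le_norm (pmul ζ (dx w) + pmul wh (dx ζ)) (val ζ)
      have j2 := pow_le_pow_left₀ (abs_nonneg _) j1 2
      rw [sq_abs, mul_pow] at j2
      have j3 := mul_le_mul_of_nonneg_right hconv (sq_nonneg ‖val ζ‖)
      have j4 : (κ * tsq ζ + 1 / κ * G * ‖val ζ‖ ^ 2) ^ 2 - 4 * tsq ζ * G * ‖val ζ‖ ^ 2 =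
          (κ * tsq ζ - 1 / κ * G * ‖val ζ‖ ^ 2) ^ 2 := by
        field_simp
        ring
      have j5 := sq_nonneg (κ * tsq ζ - 1 / κ * G * ‖val ζ‖ ^ 2)
      linarith
    have i2 : 1 / κ * G * ‖val ζ‖ ^ 2 ≤ 1 / κ * g * E := by gcongr
    linarith
  have N' := (abs_le.1 N).1
  have P := mul_le_mul_of_nonneg_left (norm_val_sq_le ζ) hα.nonneg
  have b0 := mul_le_mul_of_nonneg_right (boundary_rate hν hα.le_c0) (sq_nonneg (at0 ζ))
  have b1 := mul_le_mul_of_nonneg_right (boundary_rate hν hα.le_c1) (sq_nonneg (at1 ζ))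
  have d0 := mul_le_mul_of_nonneg_right hα.le_μ (sq_nonneg ‖dx ζ‖)
  have d1 := mul_le_mul_of_nonneg_right k1 (sq_nonneg ‖dx ζ‖)
  have d2 := mul_le_mul_of_nonneg_right k2 (sq_nonneg (at0 ζ))
  have d3 := mul_le_mul_of_nonneg_right k3 (sq_nonneg (at1 ζ))
  have w0 := mul_nonneg hwd (sq_nonneg (at0 ζ))
  have w1 := mul_nonneg hwd (sq_nonneg (at1 ζ))
  have z0 := mul_nonneg hκ.le (sq_nonneg (at0 ζ))
  have z1 := mul_nonneg hκ.le (sq_nonneg (at1 ζ))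
  have s0 := sq_nonneg (at0 ζ)
  have s1 := sq_nonneg (at1 ζ)
  -- Monotonicity of the cube; `ζ(0)` is the difference of the two arguments.
  have r0 : 0 ≤ 2 / (9 * c0) * (at0 w ^ 3 - (at0 w - at0 ζ) ^ 3) * at0 ζ := by
    have : (at0 w ^ 3 - (at0 w - at0 ζ) ^ 3) * at0 ζ =
        at0 ζ ^ 2 * (3 * (at0 w - at0 ζ / 2) ^ 2 + at0 ζ ^ 2 / 4) := by ring
    rw [mul_assoc, this]
    positivity
  have r1 : 0 ≤ 2 / (9 * c1) * (at1 w ^ 3 - (at1 w - at1 ζ) ^ 3) * at1 ζ := by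
    have : (at1 w ^ 3 - (at1 w - at1 ζ) ^ 3) * at1 ζ =
        at1 ζ ^ 2 * (3 * (at1 w - at1 ζ / 2) ^ 2 + at1 ζ ^ 2 / 4) := by ring
    rw [mul_assoc, this]
    positivity
  rw [inner_dx_val_self, real_inner_self_eq_norm_sq, real_inner_comm,
    real_inner_comm (dx ζ) (dx ζt)] at id
  have id' : diffEnergyD μ ν wd c0 c1 w z ζ ζt + ν * ‖dx ζ‖ ^ 2
      + (1 + wd) * ((at1 ζ ^ 2 - at0 ζ ^ 2) / 2)
      + inner ℝ (pmul ζ (dx w) + pmul wh (dx ζ)) (val ζ)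
      + (μ / ν * (2 / (3 * c0) * (at0 w * at0 z * at0 ζ ^ 2 - 1 / 3 * at0 z * at0 ζ ^ 3))
        + μ / ν * (2 / (3 * c1) * (at1 w * at1 z * at1 ζ ^ 2 - 1 / 3 * at1 z * at1 ζ ^ 3)))
      + ((c0 + 1 + wd) * at0 ζ ^ 2 + 2 / (9 * c0) * (at0 w ^ 3 - (at0 w - at0 ζ) ^ 3) * at0 ζ
        + ((c1 + 1 + wd) * at1 ζ ^ 2 + 2 / (9 * c1) * (at1 w ^ 3 - (at1 w - at1 ζ) ^ 3) * at1 ζ))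
      + remainder wd w wh η ηt ζ = 0 := by
    rw [← id]
    unfold diffEnergyD bdryPD
    ring
  have hEexp : α * E = α * ‖val ζ‖ ^ 2 + α * μ * ‖dx ζ‖ ^ 2
      + (α * (μ / ν) * (c0 + 1 + wd) * at0 ζ ^ 2 + α * (μ / ν) * (c1 + 1 + wd) * at1 ζ ^ 2)
      + (α * (μ / ν) * (4 / (3 * c0) * bdryP (at0 w) (at0 ζ))
        + α * (μ / ν) * (4 / (3 * c1) * bdryP (at1 w) (at1 ζ))) := by
    rw [hEdef]
    unfold diffEnergy
    ring
  have hCexp : diffConst ν c0 c1 κ R * g * E = 1 / κ * g * E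
      + (2 / c0 + 8 * R / (9 * c0 ^ 3 * ν ^ 2)) * g * (ν * E)
      + (2 / c1 + 8 * R / (9 * c1 ^ 3 * ν ^ 2)) * g * (ν * E) := by
    unfold diffConst
    ring
  have ht : tsq ζ = at0 ζ ^ 2 + at1 ζ ^ 2 + ‖dx ζ‖ ^ 2 := rfl
  rw [hEexp, hCexp]
  rw [ht] at N' P ⊢
  linarith

theorem abs_mul_sq_le {x s c : ℝ} (h : |x| ≤ c) : |x * s ^ 2| ≤ c * s ^ 2 := by
  rw [abs_mul, abs_of_nonneg (sq_nonneg s)]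
  exact mul_le_mul_of_nonneg_right h (sq_nonneg s)

/-- The contribution of one boundary point to the potential inequality for differences. -/
theorem boundary_potential_le {μ ν c R M p p' s s' : ℝ} (hν : 0 < ν) (hμ : 0 < μ) (hμM : μ ≤ M)
    (hc : 0 < c) (hp : p ^ 2 ≤ R) (hq : (p - s) ^ 2 ≤ R) :
    bdryQD p p' s s' * (2 / (9 * c)) + μ / ν * (1 / 2 * s' ^ 2) ≤
      μ / ν * (s' + 2 / (3 * c) * (p ^ 2 * p' - (p - s) ^ 2 * (p' - s'))) * s'
        + 2 / (9 * c) * (p ^ 3 - (p - s) ^ 3) * s'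
        + (M / ν * (8 * R / (9 * c ^ 2)) + 1 / (9 * c)) * (p' ^ 2 * s ^ 2) + R / c * s ^ 2 := by
  have hR : 0 ≤ R := (sq_nonneg p).trans hp
  have h1 : 2 / (3 * c) * (s * (2 * p - s) * p') * s' ≥
      -(1 / 2 * s' ^ 2) - 8 * R / (9 * c ^ 2) * (p' ^ 2 * s ^ 2) := by
    have i1 : (2 * p - s) ^ 2 ≤ 4 * R := by nlinarith [sq_nonneg (p - (p - s))]
    have i2 : (2 / (3 * c) * (s * (2 * p - s) * p')) ^ 2 ≤ 16 * R / (9 * c ^ 2) * (p' ^ 2 * s ^ 2) := by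
      have e : (2 / (3 * c) * (s * (2 * p - s) * p')) ^ 2 =
          4 / (9 * c ^ 2) * (2 * p - s) ^ 2 * (p' ^ 2 * s ^ 2) := by
        field_simp
        ring
      rw [e]
      calc _ ≤ 4 / (9 * c ^ 2) * (4 * R) * (p' ^ 2 * s ^ 2) := by gcongr
        _ = _ := by ring
    have i3 : 16 * R / (9 * c ^ 2) * (p' ^ 2 * s ^ 2) =
        2 * (8 * R / (9 * c ^ 2) * (p' ^ 2 * s ^ 2)) := by ring
    nlinarith [sq_nonneg (2 / (3 * c) * (s * (2 * p - s) * p') + s')]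
  have h2 := mul_le_mul_of_nonneg_left h1 (by positivity : 0 ≤ μ / ν)
  have h3 : |p' * (3 * p - s) * (2 / (9 * c))| ≤ (p' ^ 2 / (9 * c) + R / c) := by
    have i1 : (3 * p - s) ^ 2 ≤ 9 * R := by nlinarith [sq_nonneg (p - (p - s))]
    have i2 : |p' * (3 * p - s)| ≤ (p' ^ 2 + 9 * R) / 2 := by
      rw [abs_le]
      constructor <;> nlinarith [sq_nonneg (p' + (3 * p - s)), sq_nonneg (p' - (3 * p - s))]
    rw [abs_mul, abs_of_nonneg (by positivity : 0 ≤ 2 / (9 * c))]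
    calc _ ≤ (p' ^ 2 + 9 * R) / 2 * (2 / (9 * c)) := by gcongr
      _ = _ := by
        field_simp
  have h4 := (abs_le.1 (abs_mul_sq_le (s := s) h3)).2
  have h5 : 0 ≤ μ / ν * (2 / (3 * c) * (p - s) ^ 2 * s' ^ 2) := by positivity
  have h6 : μ / ν * (8 * R / (9 * c ^ 2) * (p' ^ 2 * s ^ 2)) ≤
      M / ν * (8 * R / (9 * c ^ 2)) * (p' ^ 2 * s ^ 2) := by
    rw [mul_assoc]
    gcongr
  have e1 : bdryQD p p' s s' * (2 / (9 * c)) = 2 / (9 * c) * (p ^ 3 - (p - s) ^ 3) * s'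
      + p' * (3 * p - s) * (2 / (9 * c)) * s ^ 2 := by
    unfold bdryQD
    ring
  have e2 : μ / ν * (s' + 2 / (3 * c) * (p ^ 2 * p' - (p - s) ^ 2 * (p' - s'))) * s' =
      μ / ν * s' ^ 2 + μ / ν * (2 / (3 * c) * (p - s) ^ 2 * s' ^ 2)
      + μ / ν * (2 / (3 * c) * (s * (2 * p - s) * p') * s') := by ring
  have e3 : (p' ^ 2 / (9 * c) + R / c) * s ^ 2 = 1 / (9 * c) * (p' ^ 2 * s ^ 2) + R / c * s ^ 2 := by
    ring
  rw [e3] at h4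
  rw [e1, e2]
  linarith

/-- The constant in the potential inequality for differences. -/
def potConst (ν wd c0 c1 R M : ℝ) : ℝ :=
  (1 + wd) ^ 2 + 8 * R + R / c0 + R / c1 + (M / ν * (8 * R / (9 * c0 ^ 2)) + 1 / (9 * c0))
    + (M / ν * (8 * R / (9 * c1 ^ 2)) + 1 / (9 * c1))

/-- Testing with `ζ_t` keeps half of `‖ζ_t‖²` and all of `μ‖ζ_xt‖²`, both needed in the L² estimate.
The moving boundary coefficients leave `p'² s²`, so `tsq z` multiplies only boundary values of `ζ`;
after multiplication by `μ` these are controlled by the energy alone. -/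
theorem diffPotential_dissipation {μ ν wd c0 c1 κ R M : ℝ} (hp : Params ν wd c0 c1 κ)
    (hμ : 0 < μ) (hμM : μ ≤ M) {w z wh zh η ηt ζ ζt : H1} (hs : Splitting w z wh zh η ηt ζ ζt)
    (h : weakForm μ ν wd c0 c1 w z ζt = 0) (hh : weakForm μ ν wd c0 c1 wh zh ζt = 0)
    (o1 : inner ℝ (dx η) (dx ζt) = 0) (o2 : inner ℝ (dx ηt) (dx ζt) = 0)
    (hw : tsq w ≤ R) (hwh : tsq wh ≤ R) :
    diffPotentialD ν wd c0 c1 w z ζ ζt + 1 / 2 * ‖val ζt‖ ^ 2 + μ * ‖dx ζt‖ ^ 2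
      + μ / ν * (1 / 2 * (at0 ζt ^ 2 + at1 ζt ^ 2)) ≤
      potConst ν wd c0 c1 R M * tsq ζ
      + potConst ν wd c0 c1 R M * (tsq z * (at0 ζ ^ 2 + at1 ζ ^ 2))
      - remainder wd w wh η ηt ζt := by
  have id := difference_identity hs h hh o1 o2
  have hconv := norm_convection_sq_le w wh ζ
  have hb0 : at0 w - at0 ζ = at0 wh := by rw [hs.state, at0_sub, at0_sub, hs.η0, sub_zero]
  have hb1 : at1 w - at1 ζ = at1 wh := by rw [hs.state, at1_sub, at1_sub, hs.η1, sub_zero]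
  have hR : 0 ≤ R := (tsq_nonneg w).trans hw
  have hM : 0 < M := hμ.trans_le hμM
  obtain ⟨hν, hwd, hc0, hc1, hκ, k1, k2, k3, k4⟩ := hp
  have B0 := boundary_potential_le (M := M) (p' := at0 z) (s' := at0 ζt) hν hμ hμM hc0
    ((at0_sq_le w).trans hw)
    (by
      rw [hb0]
      exact (at0_sq_le wh).trans hwh)
  have B1 := boundary_potential_le (M := M) (p' := at1 z) (s' := at1 ζt) hν hμ hμM hc1
    ((at1_sq_le w).trans hw)
    (by
      rw [hb1]
      exact (at1_sq_le wh).trans hwh)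
  have N := (abs_le.1 (abs_inner_le (pmul ζ (dx w) + pmul wh (dx ζ)) (val ζt) one_pos)).1
  have hT := tsq_nonneg ζ
  have hN : ‖pmul ζ (dx w) + pmul wh (dx ζ)‖ ^ 2 ≤ 8 * R * tsq ζ := by
    have := mul_le_mul_of_nonneg_left (add_le_add hw hwh) hT
    linarith
  have A1 : (1 + wd) * inner ℝ (dx ζ) (val ζt) ≥
      -((1 + wd) ^ 2 * ‖dx ζ‖ ^ 2 + 1 / 4 * ‖val ζt‖ ^ 2) := by
    have h1 := (abs_le.1 (abs_inner_le (dx ζ) (val ζt) (ε := 1 + wd) (by linarith))).1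
    have := mul_le_mul_of_nonneg_left h1 (by linarith : 0 ≤ 1 + wd)
    have e : (1 + wd) * -((1 + wd) * ‖dx ζ‖ ^ 2 + 1 / (4 * (1 + wd)) * ‖val ζt‖ ^ 2) =
      -((1 + wd) ^ 2 * ‖dx ζ‖ ^ 2 + 1 / 4 * ‖val ζt‖ ^ 2) := by field_simp
    linarith
  have A2 := mul_le_mul_of_nonneg_left (norm_dx_sq_le ζ) (sq_nonneg (1 + wd))
  have f0 : 0 ≤ μ / ν * ((c0 + wd) * at0 ζt ^ 2) := by positivity
  have f1 : 0 ≤ μ / ν * ((c1 + wd) * at1 ζt ^ 2) := by positivity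
  have s0 := mul_le_mul_of_nonneg_left (at0_sq_le ζ) (by positivity : 0 ≤ R / c0)
  have s1 := mul_le_mul_of_nonneg_left (at1_sq_le ζ) (by positivity : 0 ≤ R / c1)
  set m0 := M / ν * (8 * R / (9 * c0 ^ 2)) + 1 / (9 * c0) with hm0
  set m1 := M / ν * (8 * R / (9 * c1 ^ 2)) + 1 / (9 * c1) with hm1
  have m0p : 0 ≤ m0 := by positivity
  have m1p : 0 ≤ m1 := by positivity
  have t0 := mul_le_mul_of_nonneg_left
    (mul_le_mul_of_nonneg_right (at0_sq_le z) (sq_nonneg (at0 ζ))) m0p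
  have t1 := mul_le_mul_of_nonneg_left
    (mul_le_mul_of_nonneg_right (at1_sq_le z) (sq_nonneg (at1 ζ))) m1p
  have hC : potConst ν wd c0 c1 R M = (1 + wd) ^ 2 + 8 * R + R / c0 + R / c1 + m0 + m1 := rfl
  have hC' : m0 * (tsq z * at0 ζ ^ 2) + m1 * (tsq z * at1 ζ ^ 2) ≤
      potConst ν wd c0 c1 R M * (tsq z * (at0 ζ ^ 2 + at1 ζ ^ 2)) := by
    have q0 : 0 ≤ tsq z * at0 ζ ^ 2 := mul_nonneg (tsq_nonneg z) (sq_nonneg _)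
    have q1 : 0 ≤ tsq z * at1 ζ ^ 2 := mul_nonneg (tsq_nonneg z) (sq_nonneg _)
    have q2 : 0 ≤ (1 + wd) ^ 2 + 8 * R + R / c0 + R / c1 := by positivity
    have q3 : m0 ≤ potConst ν wd c0 c1 R M := by rw [hC]; linarith
    have q4 : m1 ≤ potConst ν wd c0 c1 R M := by rw [hC]; linarith
    have q5 := mul_le_mul_of_nonneg_right q3 q0
    have q6 := mul_le_mul_of_nonneg_right q4 q1
    linarith
  have hC'' : (1 + wd) ^ 2 * tsq ζ + 8 * R * tsq ζ + R / c0 * tsq ζ + R / c1 * tsq ζ ≤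
      potConst ν wd c0 c1 R M * tsq ζ := by
    have q5 := mul_nonneg m0p hT
    have q6 := mul_nonneg m1p hT
    rw [hC]
    linarith
  rw [real_inner_self_eq_norm_sq, real_inner_self_eq_norm_sq] at id
  have id' : (diffPotentialD ν wd c0 c1 w z ζ ζt
        - bdryQD (at0 w) (at0 z) (at0 ζ) (at0 ζt) * (2 / (9 * c0))
        - bdryQD (at1 w) (at1 z) (at1 ζ) (at1 ζt) * (2 / (9 * c1)))
      + ‖val ζt‖ ^ 2 + μ * ‖dx ζt‖ ^ 2 + (1 + wd) * inner ℝ (dx ζ) (val ζt)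
      + inner ℝ (pmul ζ (dx w) + pmul wh (dx ζ)) (val ζt)
      + (μ / ν * ((c0 + wd) * at0 ζt ^ 2) + μ / ν * ((c1 + wd) * at1 ζt ^ 2))
      + (μ / ν * (at0 ζt + 2 / (3 * c0) *
          (at0 w ^ 2 * at0 z - (at0 w - at0 ζ) ^ 2 * (at0 z - at0 ζt))) * at0 ζt
        + μ / ν * (at1 ζt + 2 / (3 * c1) *
          (at1 w ^ 2 * at1 z - (at1 w - at1 ζ) ^ 2 * (at1 z - at1 ζt))) * at1 ζt)
      + (2 / (9 * c0) * (at0 w ^ 3 - (at0 w - at0 ζ) ^ 3) * at0 ζt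
        + 2 / (9 * c1) * (at1 w ^ 3 - (at1 w - at1 ζ) ^ 3) * at1 ζt)
      + remainder wd w wh η ηt ζt = 0 := by
    rw [← id]
    unfold diffPotentialD
    ring
  linarith

/-! ### Bounds for the remainder -/

theorem norm_add₃_sq_le (x y v : L2) :
    ‖x + y + v‖ ^ 2 ≤ 3 * (‖x‖ ^ 2 + ‖y‖ ^ 2 + ‖v‖ ^ 2) := by
  have h := pow_le_pow_left₀ (norm_nonneg _) (norm_add₃_le (a := x) (b := y) (c := v)) 2
  nlinarith [sq_nonneg (‖x‖ - ‖y‖), sq_nonneg (‖x‖ - ‖v‖), sq_nonneg (‖y‖ - ‖v‖)]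

theorem inner_sq_le (x y : L2) : inner ℝ x y ^ 2 ≤ ‖x‖ ^ 2 * ‖y‖ ^ 2 := by
  have := pow_le_pow_left₀ (abs_nonneg _) (abs_real_inner_le_norm x y) 2
  rwa [sq_abs, mul_pow] at this

theorem norm_smul_sq (c : ℝ) (x : L2) : ‖c • x‖ ^ 2 = c ^ 2 * ‖x‖ ^ 2 := by
  rw [norm_smul, mul_pow, Real.norm_eq_abs, sq_abs]

/-- The spatial part of the remainder, bounded through `‖η_x‖`. -/
theorem remainder_strong {wd R : ℝ} {w wh η ηt χ : H1} (h0 : at0 η = 0) (h1 : at1 η = 0)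
    (hw : tsq w ≤ R) (hwh : tsq wh ≤ R) :
    (remainder wd w wh η ηt χ - inner ℝ (val ηt) (val χ)) ^ 2 ≤
      3 * ((1 + wd) ^ 2 + 4 * R) * ‖dx η‖ ^ 2 * ‖val χ‖ ^ 2 := by
  rw [remainder, add_sub_cancel_left]
  refine (inner_sq_le _ _).trans (mul_le_mul_of_nonneg_right ?_ (sq_nonneg _))
  have i1 := norm_add₃_sq_le ((1 + wd) • dx η) (pmul η (dx w)) (pmul wh (dx η))
  have i2 := norm_pmul_sq_le η (dx w)
  have i3 := norm_pmul_sq_le wh (dx η)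
  have e : tsq η = ‖dx η‖ ^ 2 := by simp [tsq, h0, h1]
  rw [e] at i2
  have i4 := mul_le_mul_of_nonneg_left ((norm_dx_sq_le w).trans hw) (sq_nonneg ‖dx η‖)
  have i5 := mul_le_mul_of_nonneg_right hwh (sq_nonneg ‖dx η‖)
  rw [norm_smul_sq] at i1
  linarith

/-- The spatial part of the remainder, bounded through `‖η‖`. -/
theorem remainder_weak {wd R : ℝ} {w wh η ηt χ : H1} (h0 : at0 η = 0) (h1 : at1 η = 0)
    (hw : tsq w ≤ R) (hwh : tsq wh ≤ R) :
    (remainder wd w wh η ηt χ - inner ℝ (val ηt) (val χ)) ^ 2 ≤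
      6 * ((1 + wd) ^ 2 + 6 * R) * ‖val η‖ ^ 2 * tsq χ := by
  have c1 : inner ℝ (pmul η (dx w)) (val χ) = inner ℝ (val η) (pmul χ (dx w)) := by
    rw [real_inner_comm (pmul χ (dx w)), inner_pmul, inner_pmul]
    refine integral_congr_ae (Filter.Eventually.of_forall fun x => ?_)
    ring
  -- Integration by parts takes the derivative off `η`, with no boundary terms since `η` vanishes at
  -- both ends. One power of `h` is gained in exchange for a derivative of `χ`.
  have c2 : inner ℝ (pmul wh (dx η)) (val χ) =
      -inner ℝ (val η) (pmul χ (dx wh)) - inner ℝ (val η) (pmul wh (dx χ)) := by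
    have p := inner_product_rule η wh χ
    rw [h0, h1] at p
    have e1 : inner ℝ (pmul η (dx wh)) (val χ) = inner ℝ (val η) (pmul χ (dx wh)) := by
      rw [real_inner_comm (pmul χ (dx wh)), inner_pmul, inner_pmul]
      refine integral_congr_ae (Filter.Eventually.of_forall fun x => ?_)
      ring
    have e2 : inner ℝ (pmul η (val wh)) (dx χ) = inner ℝ (val η) (pmul wh (dx χ)) := by
      rw [pmul_val_comm, inner_pmul_left]
    rw [e1, e2] at p
    linarith
  have c3 : inner ℝ (dx η) (val χ) = -inner ℝ (val η) (dx χ) := by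
    have p := inner_dx_val_add η χ
    rw [h0, h1] at p
    linarith
  have e : remainder wd w wh η ηt χ - inner ℝ (val ηt) (val χ) =
      inner ℝ (val η) (-(1 + wd) • dx χ + (pmul χ (dx w) - pmul χ (dx wh)) - pmul wh (dx χ)) := by
    rw [remainder, add_sub_cancel_left]
    simp only [inner_add_left, inner_add_right, inner_sub_right, real_inner_smul_left,
      real_inner_smul_right, c1, c2, c3]
    ring
  rw [e]
  refine (inner_sq_le _ _).trans ?_
  have hT := tsq_nonneg χ
  have hN : ‖-(1 + wd) • dx χ + (pmul χ (dx w) - pmul χ (dx wh)) - pmul wh (dx χ)‖ ^ 2 ≤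
      6 * ((1 + wd) ^ 2 + 6 * R) * tsq χ := by
    have i1 := norm_add₃_sq_le (-(1 + wd) • dx χ) (pmul χ (dx w) - pmul χ (dx wh)) (-pmul wh (dx χ))
    have i0 := norm_add_sq_le (pmul χ (dx w)) (-pmul χ (dx wh))
    rw [norm_neg, ← sub_eq_add_neg] at i0
    rw [norm_neg, ← sub_eq_add_neg, norm_smul_sq, neg_sq] at i1
    have i2 := norm_pmul_sq_le χ (dx w)
    have i3 := norm_pmul_sq_le χ (dx wh)
    have i4 := norm_pmul_sq_le wh (dx χ)
    have j1 := mul_le_mul_of_nonneg_left ((norm_dx_sq_le w).trans hw) hT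
    have j2 := mul_le_mul_of_nonneg_left ((norm_dx_sq_le wh).trans hwh) hT
    have j3 := mul_le_mul hwh (norm_dx_sq_le χ) (sq_nonneg _) ((tsq_nonneg wh).trans hwh)
    have j4 := mul_le_mul_of_nonneg_left (norm_dx_sq_le χ) (sq_nonneg (1 + wd))
    have j5 : 0 ≤ (1 + wd) ^ 2 * tsq χ := by positivity
    have j6 : 0 ≤ R * tsq χ := mul_nonneg ((tsq_nonneg wh).trans hwh) hT
    linarith
  calc _ ≤ ‖val η‖ ^ 2 * (6 * ((1 + wd) ^ 2 + 6 * R) * tsq χ) :=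
        mul_le_mul_of_nonneg_left hN (sq_nonneg _)
    _ = _ := by ring

/-! ### Bounds for the time derivative -/

theorem IsFlow.continuous {μ ν wd c0 c1 : ℝ} {w z : ℝ → H1} (h : IsFlow μ ν wd c0 c1 w z) :
    Continuous w :=
  continuous_iff_continuousAt.2 fun t => (h.hasDerivAt t).continuousAt

theorem IsFlow.isTraj {μ ν wd c0 c1 : ℝ} {w z : ℝ → H1} (h : IsFlow μ ν wd c0 c1 w z) :
    IsTraj μ ν wd c0 c1 w z :=
  ⟨h.continuous, fun t _ => h.hasDerivAt t, fun t ht => h.equation t ht.le _,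
    fun t ht => h.equation t ht.le _⟩

theorem tsq_smul (c : ℝ) (v : H1) : tsq (c • v) = c ^ 2 * tsq v := by
  simp only [tsq, at0_smul, at1_smul, dx_smul, norm_smul_sq]
  ring

theorem diffEnergy_le {μ ν wd c0 c1 κ R : ℝ} (hp : Params ν wd c0 c1 κ) (hμ : 0 < μ)
    {w ζ : H1} (hw : tsq w ≤ R) (hwh0 : (at0 w - at0 ζ) ^ 2 ≤ R)
    (hwh1 : (at1 w - at1 ζ) ^ 2 ≤ R) :
    diffEnergy μ ν wd c0 c1 w ζ ≤ (1 + 1 / ν * ((c0 + 1 + wd) + (c1 + 1 + wd)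
      + 20 * R / (3 * c0) + 20 * R / (3 * c1))) * (‖val ζ‖ ^ 2 + μ * tsq ζ) := by
  obtain ⟨hν, hwd, hc0, hc1, -⟩ := hp
  have hR : 0 ≤ R := (tsq_nonneg w).trans hw
  have p0 := (at0_sq_le w).trans hw
  have p1 := (at1_sq_le w).trans hw
  have b0 : bdryP (at0 w) (at0 ζ) ≤ 5 * R * at0 ζ ^ 2 := by
    refine (bdryP_le _ _).trans (mul_le_mul_of_nonneg_right ?_ (sq_nonneg _))
    nlinarith [sq_nonneg (at0 w + (at0 w - at0 ζ))]
  have b1 : bdryP (at1 w) (at1 ζ) ≤ 5 * R * at1 ζ ^ 2 := by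
    refine (bdryP_le _ _).trans (mul_le_mul_of_nonneg_right ?_ (sq_nonneg _))
    nlinarith [sq_nonneg (at1 w + (at1 w - at1 ζ))]
  have t0 := at0_sq_le ζ
  have t1 := at1_sq_le ζ
  have t2 := norm_dx_sq_le ζ
  have tn := tsq_nonneg ζ
  have h1 : diffEnergy μ ν wd c0 c1 w ζ ≤ ‖val ζ‖ ^ 2 + μ * tsq ζ + μ / ν *
      (((c0 + 1 + wd) * tsq ζ + 4 / (3 * c0) * (5 * R * tsq ζ))
      + ((c1 + 1 + wd) * tsq ζ + 4 / (3 * c1) * (5 * R * tsq ζ))) := by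
    unfold diffEnergy
    gcongr
    · exact b0.trans (by gcongr)
    · exact b1.trans (by gcongr)
  have h2 : 0 ≤ (1 / ν * ((c0 + 1 + wd) + (c1 + 1 + wd)
      + 20 * R / (3 * c0) + 20 * R / (3 * c1))) * ‖val ζ‖ ^ 2 := by positivity
  have e : μ / ν * (((c0 + 1 + wd) * tsq ζ + 4 / (3 * c0) * (5 * R * tsq ζ))
      + ((c1 + 1 + wd) * tsq ζ + 4 / (3 * c1) * (5 * R * tsq ζ))) =
      (1 / ν * ((c0 + 1 + wd) + (c1 + 1 + wd)
      + 20 * R / (3 * c0) + 20 * R / (3 * c1))) * (μ * tsq ζ) := by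
    ring
  rw [e] at h1
  linarith

theorem continuous_diffEnergy (μ ν wd c0 c1 : ℝ) {X : Type*} [TopologicalSpace X] {w ζ : X → H1}
    (hw : Continuous w) (hζ : Continuous ζ) :
    Continuous fun t => diffEnergy μ ν wd c0 c1 (w t) (ζ t) := by
  have h0 := continuous_at0
  have h1 := continuous_at1
  have h2 := continuous_val
  have h3 := continuous_dx
  unfold diffEnergy bdryP
  fun_prop

/-- Stability of a solution under a shift in time. -/
theorem shift_stability {μ ν wd c0 c1 κ α R : ℝ} (hp : Params ν wd c0 c1 κ) (hμ : 0 < μ)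
    (hα : Rate μ ν wd c0 c1 α) {w z : ℝ → H1} (h : IsFlow μ ν wd c0 c1 w z)
    (hR1 : ∀ t, 0 ≤ t → Real.exp (2 * α * t) * tsq (w t) ≤ R)
    (hR2 : ∀ t, 0 ≤ t → ∫ s in (0 : ℝ)..t, Real.exp (2 * α * s) * tsq (w s) ≤ R)
    (hR3 : ∀ t, 0 ≤ t → ∫ s in (0 : ℝ)..t,
      Real.exp (2 * α * s) * (μ * (at0 (z s) ^ 2 + at1 (z s) ^ 2)) ≤ R)
    {s t : ℝ} (hs : 0 ≤ s) (ht : 0 ≤ t) :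
    Real.exp (2 * α * t) * ‖val (w t - w (t + s))‖ ^ 2
      + ∫ r in (0 : ℝ)..t, Real.exp (2 * α * r) * (2 * κ * tsq (w r - w (r + s))) ≤
      Real.exp (2 * diffConst ν c0 c1 κ R * (3 * R)) * ((1 + 1 / ν * ((c0 + 1 + wd) + (c1 + 1 + wd)
        + 20 * R / (3 * c0) + 20 * R / (3 * c1))) *
        (‖val (w 0 - w (0 + s))‖ ^ 2 + μ * tsq (w 0 - w (0 + s)))) := by
  have cw := h.continuous
  have cz := h.continuous_deriv
  have cws : Continuous fun t => w (t + s) := cw.comp (continuous_id.add continuous_const)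
  have cζ : Continuous fun t => w t - w (t + s) := cw.sub cws
  have cX : Continuous fun t : ℝ => Real.exp (2 * α * t) := by fun_prop
  have c1' : Continuous fun t => tsq (w t) := continuous_tsq.comp cw
  have c2' : Continuous fun t => tsq (w (t + s)) := continuous_tsq.comp cws
  have c12 : Continuous fun t => tsq (w t) + tsq (w (t + s)) := c1'.add c2'
  have c3' : Continuous fun t => μ * (at0 (z t) ^ 2 + at1 (z t) ^ 2) := by
    have h0 := continuous_at0
    have h1 := continuous_at1
    fun_prop
  have hR : ∀ t, 0 ≤ t → tsq (w t) ≤ R := fun t ht =>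
    (exp_mul_nonneg_ge hα.nonneg ht (tsq_nonneg _)).trans (hR1 t ht)
  have hR0 : 0 ≤ R := (tsq_nonneg _).trans (hR 0 le_rfl)
  have hI : ∀ f : ℝ → ℝ, Continuous f → (∀ r, 0 ≤ f r) → ∀ t, 0 ≤ t →
      (∫ r in (0 : ℝ)..t, Real.exp (2 * α * r) * f r) ≤ R → ∫ r in (0 : ℝ)..t, f r ≤ R := by
    intro f hf hf0 t ht hle
    refine le_trans ?_ hle
    exact intervalIntegral.integral_mono_on ht (hf.intervalIntegrable _ _)
      ((cX.mul hf).intervalIntegrable _ _) fun r hr =>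
        exp_mul_nonneg_ge hα.nonneg hr.1 (hf0 r)
  have hz0 : ∀ t, 0 ≤ μ * (at0 (z t) ^ 2 + at1 (z t) ^ 2) := fun t => by positivity
  have hC : 0 ≤ diffConst ν c0 c1 κ R := by
    obtain ⟨hν, hwd, hc0, hc1, hκ, -⟩ := hp
    unfold diffConst
    positivity
  -- The shifted solution plays the part of the discrete one, with `η = 0`, so there is no source.
  -- The growth is a sum of three terms, each of integral at most `R`.
  have key := gronwall_weighted (φ := fun t => diffEnergy μ ν wd c0 c1 (w t) (w t - w (t + s)))
    (φ' := fun t => 2 * diffEnergyD μ ν wd c0 c1 (w t) (z t) (w t - w (t + s)) (z t - z (t + s)))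
    (G := fun t => 2 * diffConst ν c0 c1 κ R *
      (tsq (w t) + tsq (w (t + s)) + μ * (at0 (z t) ^ 2 + at1 (z t) ^ 2)))
    (B := fun _ => 0) (D := fun t => 2 * κ * tsq (w t - w (t + s))) (α := α)
    (A := 2 * diffConst ν c0 c1 κ R * (3 * R)) (b := 0)
    (continuous_diffEnergy μ ν wd c0 c1 cw cζ).continuousOn
    (fun t _ => hasDerivAt_diffEnergy μ ν wd c0 c1 (h.hasDerivAt t)
      ((h.hasDerivAt t).sub (HasDerivAt.comp_add_const t s (h.hasDerivAt (t + s)))))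
    (((c1'.add c2').add c3').const_mul _) continuous_const
    ((continuous_tsq.comp cζ).const_mul _)
    (fun t => mul_nonneg (by positivity)
      (add_nonneg (add_nonneg (tsq_nonneg _) (tsq_nonneg _)) (hz0 t)))
    (fun _ => le_rfl) (fun t => mul_nonneg (by linarith [hp.κ_pos]) (tsq_nonneg _))
    (fun t => diffEnergy_nonneg hp hμ _ _)
    (fun t ht => by
      have := diffEnergy_dissipation hp hμ hα (w := w t) (z := z t) (wh := w (t + s))
        (zh := z (t + s)) (η := 0) (ηt := 0) (ζ := w t - w (t + s)) (ζt := z t - z (t + s))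
        ⟨by abel, by abel, at0_zero, at1_zero, at0_zero, at1_zero⟩ (h.equation t ht.le _)
        (h.equation (t + s) (by linarith) _) (by simp) (by simp) (hR t ht.le)
        (hR (t + s) (by linarith))
      have hrem : remainder wd (w t) (w (t + s)) 0 0 (w t - w (t + s)) = 0 := by
        have e1 : pmul 0 (dx (w t)) = 0 := DFunLike.congr_fun (map_zero mulL) (dx (w t))
        have e2 : pmul (w (t + s)) 0 = 0 := map_zero (mulL (w (t + s)))
        simp [remainder, e1, e2]
      rw [hrem] at this
      linarith)
    (fun t ht => by
      rw [intervalIntegral.integral_const_mul]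
      refine mul_le_mul_of_nonneg_left ?_ (by positivity)
      rw [intervalIntegral.integral_add (c12.intervalIntegrable _ _)
        (c3'.intervalIntegrable _ _), intervalIntegral.integral_add (c1'.intervalIntegrable _ _)
        (c2'.intervalIntegrable _ _)]
      have i1 := hI _ c1' (fun r => tsq_nonneg _) t ht (hR2 t ht)
      have i3 := hI _ c3' hz0 t ht (hR3 t ht)
      have i2 : ∫ r in (0 : ℝ)..t, tsq (w (r + s)) ≤ R := by
        rw [intervalIntegral.integral_comp_add_right (fun r => tsq (w r))]
        have i4 := hI _ c1' (fun r => tsq_nonneg _) (t + s) (by linarith)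
          (hR2 (t + s) (by linarith))
        refine le_trans ?_ i4
        exact intervalIntegral.integral_mono_interval (by linarith) (by linarith) le_rfl
          (Filter.Eventually.of_forall fun r => tsq_nonneg _) (c1'.intervalIntegrable _ _)
      linarith) (by simp) ht
  have h0 : tsq (w 0 - (w 0 - w (0 + s))) ≤ R := by
    rw [sub_sub_cancel]
    exact hR _ (by linarith)
  have h1 := diffEnergy_le (μ := μ) hp hμ (hR 0 le_rfl)
    (by
      rw [← at0_sub]
      exact (at0_sq_le _).trans h0)
    (by
      rw [← at1_sub]
      exact (at1_sq_le _).trans h0)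
  have h2 := mul_le_mul_of_nonneg_left
    (boundary_le_diffEnergy hp hμ (w t) (w t - w (t + s))).1 (Real.exp_pos (2 * α * t)).le
  have h3 := mul_le_mul_of_nonneg_left h1
    (Real.exp_pos (2 * diffConst ν c0 c1 κ R * (3 * R))).le
  rw [add_zero] at key
  linarith

/-- Divide the shift estimate by `s²` and let `s` decrease to 0. The equation is never
differentiated in time, so no second time derivative is needed; the boundedness of `z` on `[0, t +
1]` dominates the integrals. -/
theorem deriv_stability {μ ν wd c0 c1 κ α R : ℝ} (hp : Params ν wd c0 c1 κ) (hμ : 0 < μ)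
    (hα : Rate μ ν wd c0 c1 α) {w z : ℝ → H1} (h : IsFlow μ ν wd c0 c1 w z)
    (hR1 : ∀ t, 0 ≤ t → Real.exp (2 * α * t) * tsq (w t) ≤ R)
    (hR2 : ∀ t, 0 ≤ t → ∫ s in (0 : ℝ)..t, Real.exp (2 * α * s) * tsq (w s) ≤ R)
    (hR3 : ∀ t, 0 ≤ t → ∫ s in (0 : ℝ)..t,
      Real.exp (2 * α * s) * (μ * (at0 (z s) ^ 2 + at1 (z s) ^ 2)) ≤ R) {t : ℝ} (ht : 0 ≤ t) :
    Real.exp (2 * α * t) * ‖val (z t)‖ ^ 2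
      + ∫ r in (0 : ℝ)..t, Real.exp (2 * α * r) * (2 * κ * tsq (z r)) ≤
      Real.exp (2 * diffConst ν c0 c1 κ R * (3 * R)) * ((1 + 1 / ν * ((c0 + 1 + wd) + (c1 + 1 + wd)
        + 20 * R / (3 * c0) + 20 * R / (3 * c1))) * (‖val (z 0)‖ ^ 2 + μ * tsq (z 0))) := by
  set v : ℝ → ℝ → H1 := fun s r => s⁻¹ • (w (r + s) - w r) with hv
  have hlim : ∀ r, Filter.Tendsto (fun s => v s r) (nhdsWithin 0 (Ioi 0)) (nhds (z r)) :=
    fun r => (h.hasDerivAt r).tendsto_slope_zero_right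
  have hζ : ∀ s r, s ≠ 0 → w r - w (r + s) = (-s) • v s r := by
    intro s r hs
    rw [hv, smul_smul, neg_mul, mul_inv_cancel₀ hs, neg_one_smul, neg_sub]
  have hineq : ∀ s, 0 < s → Real.exp (2 * α * t) * ‖val (v s t)‖ ^ 2
      + ∫ r in (0 : ℝ)..t, Real.exp (2 * α * r) * (2 * κ * tsq (v s r)) ≤
      Real.exp (2 * diffConst ν c0 c1 κ R * (3 * R)) * ((1 + 1 / ν * ((c0 + 1 + wd) + (c1 + 1 + wd)
        + 20 * R / (3 * c0) + 20 * R / (3 * c1))) * (‖val (v s 0)‖ ^ 2 + μ * tsq (v s 0))) := by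
    intro s hs
    have h1 := shift_stability hp hμ hα h hR1 hR2 hR3 hs.le ht
    have h2 : ∫ r in (0 : ℝ)..t, Real.exp (2 * α * r) * (2 * κ * tsq (w r - w (r + s))) =
        s ^ 2 * ∫ r in (0 : ℝ)..t, Real.exp (2 * α * r) * (2 * κ * tsq (v s r)) := by
      rw [← intervalIntegral.integral_const_mul]
      refine intervalIntegral.integral_congr fun r _ => ?_
      simp only [hζ s r hs.ne', tsq_smul]
      ring
    have e : ∀ r : H1, ‖val ((-s) • r)‖ ^ 2 = s ^ 2 * ‖val r‖ ^ 2 := fun r => by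
      rw [val_smul, norm_smul_sq, neg_sq]
    rw [h2, hζ s t hs.ne', hζ s 0 hs.ne', tsq_smul, e, e, neg_sq] at h1
    have h3 : 0 < s ^ 2 := by positivity
    refine le_of_mul_le_mul_left ?_ h3
    linarith
  have cX : Continuous fun t : ℝ => Real.exp (2 * α * t) := by fun_prop
  obtain ⟨B, hB⟩ := (isCompact_Icc (a := (0 : ℝ)) (b := t + 1)).exists_bound_of_continuousOn
    h.continuous_deriv.continuousOn
  have hvB : ∀ s r, 0 < s → s ≤ 1 → 0 ≤ r → r ≤ t → ‖v s r‖ ≤ B := by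
    intro s r hs hs1 hr hrt
    have h1 := (convex_Icc (0 : ℝ) (t + 1)).norm_image_sub_le_of_norm_hasDerivWithin_le
      (fun x _ => (h.hasDerivAt x).hasDerivWithinAt) hB (x := r) (y := r + s)
      ⟨hr, by linarith⟩ ⟨by linarith, by linarith⟩
    rw [add_sub_cancel_left, Real.norm_eq_abs, abs_of_pos hs] at h1
    rw [hv, norm_smul, norm_inv, Real.norm_eq_abs, abs_of_pos hs, inv_mul_le_iff₀ hs, mul_comm]
    exact h1
  obtain ⟨C, hC0, hC⟩ := exists_tsq_le
  have hlimI : Filter.Tendsto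
      (fun s => ∫ r in (0 : ℝ)..t, Real.exp (2 * α * r) * (2 * κ * tsq (v s r)))
      (nhdsWithin 0 (Ioi 0))
      (nhds (∫ r in (0 : ℝ)..t, Real.exp (2 * α * r) * (2 * κ * tsq (z r)))) := by
    refine intervalIntegral.tendsto_integral_filter_of_dominated_convergence
      (fun r => Real.exp (2 * α * r) * (2 * κ * (C * B ^ 2))) ?_ ?_ ?_ ?_
    · refine Filter.Eventually.of_forall fun s => Continuous.aestronglyMeasurable ?_
      have cw := h.continuous
      have : Continuous fun r => tsq (v s r) := continuous_tsq.comp (by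
        unfold v
        fun_prop)
      fun_prop
    · have : ∀ᶠ s : ℝ in nhdsWithin 0 (Ioi 0), s ∈ Ioc (0 : ℝ) 1 := Ioc_mem_nhdsGT one_pos
      filter_upwards [this] with s hs
      refine Filter.Eventually.of_forall fun r hr => ?_
      rw [uIoc_of_le ht] at hr
      have h1 := hvB s r hs.1 hs.2 hr.1.le hr.2
      have h2 := hp.κ_pos
      rw [Real.norm_eq_abs, abs_of_nonneg (mul_nonneg (Real.exp_pos _).le
        (mul_nonneg (by positivity) (tsq_nonneg _)))]
      refine mul_le_mul_of_nonneg_left (mul_le_mul_of_nonneg_left ((hC _).trans ?_)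
        (by positivity)) (Real.exp_pos _).le
      gcongr
    · exact (cX.mul continuous_const).intervalIntegrable _ _
    · refine Filter.Eventually.of_forall fun r _ => ?_
      exact ((((continuous_tsq.tendsto _).comp (hlim r)).const_mul _).const_mul _)
  have l1 := (((continuous_val.norm.pow 2).tendsto _).comp (hlim t)).const_mul
    (Real.exp (2 * α * t))
  have l2 := ((continuous_val.norm.pow 2).tendsto _).comp (hlim 0)
  have l3 := ((continuous_tsq.tendsto _).comp (hlim 0)).const_mul μ
  have l4 := ((l2.add l3).const_mul (1 + 1 / ν * ((c0 + 1 + wd) + (c1 + 1 + wd)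
        + 20 * R / (3 * c0) + 20 * R / (3 * c1)))).const_mul
        (Real.exp (2 * diffConst ν c0 c1 κ R * (3 * R)))
  refine le_of_tendsto_of_tendsto (l1.add hlimI) l4 ?_
  filter_upwards [self_mem_nhdsWithin] with s hs
  exact hineq s hs

/-- `R` depends on `μ` only through the upper bound `M` and on the initial derivative only through
`R1`. Uniformity in `μ` is thus reduced to a bound on the data at time 0. -/
theorem flow_bounds {ν wd c0 c1 κ : ℝ} (hp : Params ν wd c0 c1 κ) (M ρ R1 : ℝ) :
    ∃ R : ℝ, 0 < R ∧ ∀ μ α : ℝ, 0 < μ → μ ≤ M → Rate μ ν wd c0 c1 α →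
      ∀ w z : ℝ → H1, IsFlow μ ν wd c0 c1 w z → ‖w 0‖ ≤ ρ →
      ‖val (z 0)‖ ^ 2 + μ * tsq (z 0) ≤ R1 → ∀ t, 0 ≤ t →
      Real.exp (2 * α * t) * tsq (w t) ≤ R ∧ Real.exp (2 * α * t) * ‖val (z t)‖ ^ 2 ≤ R ∧
      ∫ s in (0 : ℝ)..t, Real.exp (2 * α * s) * tsq (w s) ≤ R ∧
      ∫ s in (0 : ℝ)..t, Real.exp (2 * α * s) * tsq (z s) ≤ R := by
  obtain ⟨R, hR0, hR⟩ := traj_bounds hp M ρ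
  have hκ := hp.κ_pos
  have hν := hp.ν_pos
  have hwd := hp.wd_nonneg
  have hc0 := hp.c0_pos
  have hc1 := hp.c1_pos
  set X := Real.exp (2 * diffConst ν c0 c1 κ R * (3 * R)) * ((1 + 1 / ν * ((c0 + 1 + wd)
    + (c1 + 1 + wd) + 20 * R / (3 * c0) + 20 * R / (3 * c1))) * |R1|) with hX
  have hX0 : 0 ≤ X := by positivity
  refine ⟨R + X + X / (2 * κ), by positivity, ?_⟩
  intro μ α hμ hμM hα w z h hρ hz t ht
  obtain ⟨h1, h2, h3⟩ := hR μ α hμ hμM hα w z h.isTraj hρ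
  have cD : Continuous fun t => μ * (at0 (z t) ^ 2 + at1 (z t) ^ 2) := by
    have h0 := continuous_at0
    have h1 := continuous_at1
    have h2 := h.continuous_deriv
    fun_prop
  have h3' := h3 _ cD (fun t => by positivity) (fun t _ => le_rfl)
  have key := deriv_stability hp hμ hα h h1 h2 h3' ht
  have hle : Real.exp (2 * diffConst ν c0 c1 κ R * (3 * R)) * ((1 + 1 / ν * ((c0 + 1 + wd)
      + (c1 + 1 + wd) + 20 * R / (3 * c0) + 20 * R / (3 * c1))) *
      (‖val (z 0)‖ ^ 2 + μ * tsq (z 0))) ≤ X := by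
    rw [hX]
    gcongr
    exact hz.trans (le_abs_self _)
  have e : ∫ r in (0 : ℝ)..t, Real.exp (2 * α * r) * (2 * κ * tsq (z r)) =
      2 * κ * ∫ r in (0 : ℝ)..t, Real.exp (2 * α * r) * tsq (z r) := by
    rw [← intervalIntegral.integral_const_mul]
    congr 1
    ext r
    ring
  rw [e] at key
  have i0 : 0 ≤ ∫ r in (0 : ℝ)..t, Real.exp (2 * α * r) * tsq (z r) :=
    intervalIntegral.integral_nonneg ht fun r _ => mul_nonneg (Real.exp_pos _).le (tsq_nonneg _)
  have i1 : 0 ≤ Real.exp (2 * α * t) * ‖val (z t)‖ ^ 2 := by positivity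
  have i2 : 0 ≤ 2 * κ * ∫ r in (0 : ℝ)..t, Real.exp (2 * α * r) * tsq (z r) :=
    mul_nonneg (by positivity) i0
  have i3 : 0 ≤ X / (2 * κ) := by positivity
  refine ⟨by linarith [h1 t ht], by linarith, by linarith [h2 t ht], ?_⟩
  have : ∫ r in (0 : ℝ)..t, Real.exp (2 * α * r) * tsq (z r) ≤ X / (2 * κ) := by
    rw [le_div_iff₀ (by positivity)]
    linarith
  linarith

/-! ### Energy inequalities for the discretization error -/

theorem abs_le_of_sq_le_mul {r A B ε : ℝ} (hε : 0 < ε) (hA : 0 ≤ A) (hB : 0 ≤ B)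
    (h : r ^ 2 ≤ A * B) : |r| ≤ ε * A + 1 / (4 * ε) * B := by
  refine abs_le_of_sq_le_sq ?_ (by positivity)
  have e : (ε * A + 1 / (4 * ε) * B) ^ 2 - A * B = (ε * A - 1 / (4 * ε) * B) ^ 2 := by
    field_simp
    ring
  linarith [sq_nonneg (ε * A - 1 / (4 * ε) * B)]

/-- With `q = μ y + ν x` one has `2μ(x, y) = 2(x, q) - 2ν‖x‖²`; Young's inequality and `2αμ ≤ ν`
leave `-ν/2 ‖x‖²`. Applied to `x = η`, `y = η_t`, this damping absorbs every occurrence of `η`. -/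
theorem relaxation_le {μ ν α : ℝ} (hν : 0 < ν) (hα : 2 * α * μ ≤ ν) (x y : L2) :
    μ * (2 * inner ℝ x y + 2 * α * ‖x‖ ^ 2) ≤
      2 / ν * ‖μ • y + ν • x‖ ^ 2 - ν / 2 * ‖x‖ ^ 2 := by
  have h1 : inner ℝ x (μ • y + ν • x) = μ * inner ℝ x y + ν * ‖x‖ ^ 2 := by
    rw [inner_add_right, real_inner_smul_right, real_inner_smul_right, real_inner_self_eq_norm_sq]
  have h2 := (abs_le.1 (abs_inner_le x (μ • y + ν • x) (ε := ν / 4) (by positivity))).2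
  have h3 := mul_le_mul_of_nonneg_right hα (sq_nonneg ‖x‖)
  have h4 : 1 / (4 * (ν / 4)) * ‖μ • y + ν • x‖ ^ 2 = 1 / ν * ‖μ • y + ν • x‖ ^ 2 := by
    field_simp
  have h5 : 2 / ν * ‖μ • y + ν • x‖ ^ 2 = 2 * (1 / ν * ‖μ • y + ν • x‖ ^ 2) := by ring
  rw [h1, h4] at h2
  rw [h5]
  linarith

/-- The constant in the upper bound for `diffPotential`. -/
def potUpper (ν wd c0 c1 R : ℝ) : ℝ :=
  ν / 2 + (c0 + 1 + wd) / 2 + (c1 + 1 + wd) / 2 + 20 * R / (9 * c0) + 20 * R / (9 * c1)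

theorem diffPotential_le {ν wd c0 c1 κ R : ℝ} (hp : Params ν wd c0 c1 κ) {w ζ : H1}
    (hw : tsq w ≤ R) (hwh0 : (at0 w - at0 ζ) ^ 2 ≤ R) (hwh1 : (at1 w - at1 ζ) ^ 2 ≤ R) :
    diffPotential ν wd c0 c1 w ζ ≤ potUpper ν wd c0 c1 R * tsq ζ := by
  obtain ⟨hν, hwd, hc0, hc1, -⟩ := hp
  have p0 := (at0_sq_le w).trans hw
  have p1 := (at1_sq_le w).trans hw
  have b0 : bdryQ (at0 w) (at0 ζ) ≤ 10 * R * at0 ζ ^ 2 := by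
    refine (bdryQ_le _ _).trans (mul_le_mul_of_nonneg_right ?_ (sq_nonneg _))
    nlinarith [sq_nonneg (at0 w + (at0 w - at0 ζ))]
  have b1 : bdryQ (at1 w) (at1 ζ) ≤ 10 * R * at1 ζ ^ 2 := by
    refine (bdryQ_le _ _).trans (mul_le_mul_of_nonneg_right ?_ (sq_nonneg _))
    nlinarith [sq_nonneg (at1 w + (at1 w - at1 ζ))]
  have hR : 0 ≤ R := (sq_nonneg _).trans p0
  have t0 := at0_sq_le ζ
  have t1 := at1_sq_le ζ
  have t2 := norm_dx_sq_le ζ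
  calc diffPotential ν wd c0 c1 w ζ ≤ ν / 2 * tsq ζ +
      (((c0 + 1 + wd) / 2 * tsq ζ + 2 / (9 * c0) * (10 * R * tsq ζ))
      + ((c1 + 1 + wd) / 2 * tsq ζ + 2 / (9 * c1) * (10 * R * tsq ζ))) := by
        unfold diffPotential
        gcongr
        · exact b0.trans (by gcongr)
        · exact b1.trans (by gcongr)
    _ = _ := by
        unfold potUpper
        ring

theorem tsq_le_diffPotential {ν wd c0 c1 κ : ℝ} (hp : Params ν wd c0 c1 κ) (w ζ : H1) :
    κ * tsq ζ ≤ diffPotential ν wd c0 c1 w ζ := by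
  obtain ⟨hν, hwd, hc0, hc1, hκ, k1, k2, k3, k4⟩ := hp
  have q0 : 0 ≤ 2 / (9 * c0) * bdryQ (at0 w) (at0 ζ) :=
    mul_nonneg (by positivity) (bdryQ_nonneg _ _)
  have q1 : 0 ≤ 2 / (9 * c1) * bdryQ (at1 w) (at1 ζ) :=
    mul_nonneg (by positivity) (bdryQ_nonneg _ _)
  have h0 : κ * at0 ζ ^ 2 ≤ (c0 + 1 + wd) / 2 * at0 ζ ^ 2 := by gcongr; linarith
  have h1 : κ * at1 ζ ^ 2 ≤ (c1 + 1 + wd) / 2 * at1 ζ ^ 2 := by gcongr; linarith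
  have h2 : κ * ‖dx ζ‖ ^ 2 ≤ ν / 2 * ‖dx ζ‖ ^ 2 := by gcongr; linarith
  unfold diffPotential tsq
  linarith

/-- The functional controlling the error in `L²`. -/
def weakFunctional (μ ν wd c0 c1 K L : ℝ) (w η ζ : H1) : ℝ :=
  K * (1 / 2 * diffEnergy μ ν wd c0 c1 w ζ + inner ℝ (val η) (val ζ))
    + μ * diffPotential ν wd c0 c1 w ζ + L * ‖val η‖ ^ 2

/-- The derivative of `weakFunctional`. -/
def weakFunctionalD (μ ν wd c0 c1 K L : ℝ) (w z η ηt ζ ζt : H1) : ℝ :=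
  K * (diffEnergyD μ ν wd c0 c1 w z ζ ζt
      + (inner ℝ (val η) (val ζt) + inner ℝ (val ηt) (val ζ)))
    + μ * diffPotentialD ν wd c0 c1 w z ζ ζt + L * (2 * inner ℝ (val η) (val ηt))

theorem boundary_state_le {R : ℝ} {w z wh zh η ηt ζ ζt : H1} (hs : Splitting w z wh zh η ηt ζ ζt)
    (hwh : tsq wh ≤ R) : (at0 w - at0 ζ) ^ 2 ≤ R ∧ (at1 w - at1 ζ) ^ 2 ≤ R := by
  have hb0 : at0 w - at0 ζ = at0 wh := by rw [hs.state, at0_sub, at0_sub, hs.η0, sub_zero]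
  have hb1 : at1 w - at1 ζ = at1 wh := by rw [hs.state, at1_sub, at1_sub, hs.η1, sub_zero]
  rw [hb0, hb1]
  exact ⟨(at0_sq_le _).trans hwh, (at1_sq_le _).trans hwh⟩

theorem growth_le {μ M : ℝ} (hμ : 0 < μ) (hμM : μ ≤ M) (w wh z : H1) :
    tsq w + tsq wh + μ * (at0 z ^ 2 + at1 z ^ 2) ≤ tsq w + tsq wh + (M + 1) * tsq z ∧
      tsq z ≤ tsq w + tsq wh + (M + 1) * tsq z := by
  have h1 : at0 z ^ 2 + at1 z ^ 2 ≤ tsq z := by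
    unfold tsq
    linarith [sq_nonneg ‖dx z‖]
  have h2 : μ * (at0 z ^ 2 + at1 z ^ 2) ≤ M * tsq z :=
    mul_le_mul hμM h1 (by positivity) (hμ.le.trans hμM)
  have h3 : 0 ≤ M * tsq z := mul_nonneg (hμ.le.trans hμM) (tsq_nonneg z)
  have h4 := tsq_nonneg z
  have h5 := tsq_nonneg w
  have h6 := tsq_nonneg wh
  constructor <;> linarith

/-- Differentiating the cross term `(η, ζ)` cancels `(η_t, ζ)` in the remainder and creates `(η,
ζ_t)`. In `μ` times the potential inequality, `μ(η_t, ζ_t)` is rewritten as `(q, ζ_t) - ν(η, ζ_t)`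
with `q = μ η_t + ν η`. So `η_t` never has to be estimated: only `‖η‖²/μ` appears, absorbed by the
relaxation of `L‖η‖²`, besides `‖q‖²/μ`, which is the source. -/
theorem weakFunctional_dissipation {μ ν wd c0 c1 κ α R M K L B : ℝ} (hp : Params ν wd c0 c1 κ)
    (hμ : 0 < μ) (hμM : μ ≤ M) (hα : Rate μ ν wd c0 c1 α) {w z wh zh η ηt ζ ζt : H1}
    (hs : Splitting w z wh zh η ηt ζ ζt)
    (h : ∀ χ, weakForm μ ν wd c0 c1 w z χ = 0)
    (hh : weakForm μ ν wd c0 c1 wh zh ζ = 0) (hh' : weakForm μ ν wd c0 c1 wh zh ζt = 0)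
    (o1 : inner ℝ (dx η) (dx ζ) = 0) (o2 : inner ℝ (dx ηt) (dx ζ) = 0)
    (o1' : inner ℝ (dx η) (dx ζt) = 0) (o2' : inner ℝ (dx ηt) (dx ζt) = 0)
    (hw : tsq w ≤ R) (hwh : tsq wh ≤ R) (hB : ‖μ • val ηt + ν • val η‖ ^ 2 ≤ B)
    (hK0 : 0 ≤ K) (hK : ν * potUpper ν wd c0 c1 R + M * potConst ν wd c0 c1 R M ≤ K * κ / 2)
    (hL0 : 0 ≤ L)
    (hL : K / κ * (6 * ((1 + wd) ^ 2 + 6 * R)) * M + 2 * K ^ 2 + K * ν ^ 2 / κ * M + 2 * ν ^ 2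
      + (1 + 2 * ν) / 4 * (6 * ((1 + wd) ^ 2 + 6 * R)) * M ≤ L * ν / 2) :
    weakFunctionalD μ ν wd c0 c1 K L w z η ηt ζ ζt
      + 2 * α * weakFunctional μ ν wd c0 c1 K L w η ζ ≤
    (K * diffConst ν c0 c1 κ R + 2 * ν * potConst ν wd c0 c1 R M)
      * (tsq w + tsq wh + (M + 1) * tsq z) * diffEnergy μ ν wd c0 c1 w ζ
      + 1 / μ * ((2 * L / ν + 2) * B) := by
  have T1 := mul_le_mul_of_nonneg_left (diffEnergy_dissipation hp hμ hα hs (h _) hh o1 o2 hw hwh) hK0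
  have T2 := mul_le_mul_of_nonneg_left
    (diffPotential_dissipation hp hμ hμM hs (h _) hh' o1' o2' hw hwh) hμ.le
  obtain ⟨b0, b1⟩ := boundary_state_le hs hwh
  have PU := diffPotential_le hp hw b0 b1
  obtain ⟨g1, g2⟩ := growth_le hμ hμM w wh z
  obtain ⟨e1, -, e3, e4⟩ := boundary_le_diffEnergy hp hμ w ζ
  have W1 := remainder_weak (wd := wd) (ηt := ηt) (χ := ζ) hs.η0 hs.η1 hw hwh
  have W2 := remainder_weak (wd := wd) (ηt := ηt) (χ := ζt) hs.η0 hs.η1 hw hwh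
  have hR : 0 ≤ R := (tsq_nonneg w).trans hw
  have hαμ := hα.mul_le
  have h2α := hα.two_le hμ
  have hα0 := hα.nonneg
  have hE := diffEnergy_nonneg hp hμ w ζ
  have hP := (mul_nonneg hp.κ_pos.le (tsq_nonneg ζ)).trans (tsq_le_diffPotential hp w ζ)
  have relax := relaxation_le hp.ν_pos hαμ (val η) (val ηt)
  have hM : 0 < M := hμ.trans_le hμM
  have hD : 0 ≤ diffConst ν c0 c1 κ R := by
    obtain ⟨hν, hwd, hc0, hc1, hκ, -⟩ := hp
    unfold diffConst
    positivity
  have hpC : 0 ≤ potConst ν wd c0 c1 R M := by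
    obtain ⟨hν, hwd, hc0, hc1, hκ, -⟩ := hp
    unfold potConst
    positivity
  obtain ⟨hν, hwd, hc0, hc1, hκ, -⟩ := hp
  unfold weakFunctionalD weakFunctional
  set E := diffEnergy μ ν wd c0 c1 w ζ with hEd
  set P := diffPotential ν wd c0 c1 w ζ with hPd
  set W := 6 * ((1 + wd) ^ 2 + 6 * R) with hW
  set p := potConst ν wd c0 c1 R M
  set d := diffConst ν c0 c1 κ R
  set g := tsq w + tsq wh + (M + 1) * tsq z
  set q := μ • val ηt + ν • val η with hq
  have hW0 : 0 ≤ W := by positivity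
  set s := ‖val η‖ ^ 2 / μ with hsd
  have hs0 : 0 ≤ s := by positivity
  have hηs : ‖val η‖ ^ 2 = μ * s := by
    rw [hsd]
    field_simp
  have hηM : ‖val η‖ ^ 2 ≤ M * s := by
    rw [hηs]
    gcongr
  set b := B / μ with hbd
  have hBb : B = μ * b := by
    rw [hbd]
    field_simp
  have hTζ := tsq_nonneg ζ
  have hTt := tsq_nonneg ζt
  -- the remainder tested with `ζ`
  have r1 : |remainder wd w wh η ηt ζ - inner ℝ (val ηt) (val ζ)| ≤
      κ / 4 * tsq ζ + 1 / κ * W * (M * s) := by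
    have := abs_le_of_sq_le_mul (ε := κ / 4) (A := tsq ζ) (B := W * ‖val η‖ ^ 2) (by positivity)
      hTζ (by positivity) (W1.trans_eq (by ring))
    refine this.trans ?_
    have e : 1 / (4 * (κ / 4)) * (W * ‖val η‖ ^ 2) = 1 / κ * W * ‖val η‖ ^ 2 := by
      field_simp
    rw [e]
    gcongr
  -- The weight `1/(1 + 2ν)` lies below both 1 and `1/(2ν)`, so the first term fits into the
  -- interior and boundary dissipation of `ζ_t`.
  have r2 : |remainder wd w wh η ηt ζt - inner ℝ (val ηt) (val ζt)| ≤
      1 / (1 + 2 * ν) * (μ * tsq ζt) + (1 + 2 * ν) / 4 * W * s := by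
    have := abs_le_of_sq_le_mul (ε := 1 / (1 + 2 * ν)) (A := μ * tsq ζt) (B := W * s)
      (by positivity) (by positivity) (by positivity) (W2.trans_eq (by rw [hηs]; ring))
    refine this.trans_eq ?_
    congr 1
    field_simp
  have r3 : 1 / (1 + 2 * ν) * (μ * tsq ζt) ≤ μ * ‖dx ζt‖ ^ 2
      + μ / ν * (1 / 2 * (at0 ζt ^ 2 + at1 ζt ^ 2)) := by
    have i1 : 1 / (1 + 2 * ν) ≤ 1 := by
      rw [div_le_one (by positivity)]
      linarith
    have i2 : 1 / (1 + 2 * ν) ≤ 1 / (2 * ν) := by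
      apply one_div_le_one_div_of_le <;> linarith
    have i3 := mul_le_mul_of_nonneg_right i1 (by positivity : 0 ≤ μ * ‖dx ζt‖ ^ 2)
    have i4 := mul_le_mul_of_nonneg_right i2
      (by positivity : 0 ≤ μ * (at0 ζt ^ 2 + at1 ζt ^ 2))
    have i5 : 1 / (2 * ν) * (μ * (at0 ζt ^ 2 + at1 ζt ^ 2)) =
        μ / ν * (1 / 2 * (at0 ζt ^ 2 + at1 ζt ^ 2)) := by
      field_simp
    unfold tsq
    linarith
  -- Used for `K η`, `ν η` and `q`: three times `μ/8` stays below the available `μ/2`.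
  have young : ∀ x : L2, |inner ℝ (val ζt) x| ≤ μ / 8 * ‖val ζt‖ ^ 2 + 2 * (‖x‖ ^ 2 / μ) := by
    intro x
    refine (abs_inner_le (val ζt) x (ε := μ / 8) (by positivity)).trans_eq ?_
    congr 1
    field_simp
    ring
  have y1 := (abs_le.1 (young (K • val η))).2
  have y2 := (abs_le.1 (young (ν • val η))).2
  have y3 := (abs_le.1 (young q)).1
  have y4 : ‖q‖ ^ 2 / μ ≤ b := by
    rw [hbd]
    gcongr
  rw [norm_smul_sq, mul_div_assoc, ← hsd, real_inner_smul_right, real_inner_comm] at y1 y2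
  have y5 : inner ℝ (val ζt) q = μ * inner ℝ (val ηt) (val ζt) + ν * inner ℝ (val η) (val ζt) := by
    rw [hq, inner_add_right, real_inner_smul_right, real_inner_smul_right,
      real_inner_comm (val ηt), real_inner_comm (val η)]
  rw [y5] at y3
  have y6 := (abs_le.1 (abs_inner_le (val ζ) ((2 * α) • val η) (ε := κ / 4) (by positivity))).2
  have y7 : 1 / (4 * (κ / 4)) * ‖(2 * α) • val η‖ ^ 2 ≤ 1 / κ * (ν ^ 2 * (M * s)) := by
    rw [norm_smul_sq]
    have : 1 / (4 * (κ / 4)) = 1 / κ := by field_simp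
    rw [this]
    gcongr
  rw [real_inner_smul_right, real_inner_comm] at y6
  have n1 := norm_val_sq_le ζ
  have z1 : K * (2 * α * inner ℝ (val η) (val ζ)) ≤
      K * (κ / 4 * tsq ζ + 1 / κ * (ν ^ 2 * (M * s))) := by
    refine mul_le_mul_of_nonneg_left ?_ hK0
    have := mul_le_mul_of_nonneg_left n1 (by positivity : 0 ≤ κ / 4)
    linarith
  have z2 : K * (inner ℝ (val ηt) (val ζ) - remainder wd w wh η ηt ζ) ≤
      K * (κ / 4 * tsq ζ + 1 / κ * W * (M * s)) := by
    refine mul_le_mul_of_nonneg_left ?_ hK0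
    linarith [(abs_le.1 r1).1]
  have z3 : μ * (inner ℝ (val ηt) (val ζt) - remainder wd w wh η ηt ζt) ≤
      μ * (μ * ‖dx ζt‖ ^ 2 + μ / ν * (1 / 2 * (at0 ζt ^ 2 + at1 ζt ^ 2)))
        + (1 + 2 * ν) / 4 * W * (M * s) := by
    have i1 : inner ℝ (val ηt) (val ζt) - remainder wd w wh η ηt ζt ≤
        (μ * ‖dx ζt‖ ^ 2 + μ / ν * (1 / 2 * (at0 ζt ^ 2 + at1 ζt ^ 2)))
          + (1 + 2 * ν) / 4 * W * s := by linarith [(abs_le.1 r2).1]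
    have i2 := mul_le_mul_of_nonneg_left i1 hμ.le
    have i3 : (1 + 2 * ν) / 4 * W * (μ * s) ≤ (1 + 2 * ν) / 4 * W * (M * s) := by gcongr
    linarith
  have z4 : L * (2 * inner ℝ (val η) (val ηt) + 2 * α * ‖val η‖ ^ 2) ≤
      L * (2 / ν * b - ν / 2 * s) := by
    refine mul_le_mul_of_nonneg_left ?_ hL0
    refine le_of_mul_le_mul_left (relax.trans ?_) hμ
    have : 2 / ν * ‖q‖ ^ 2 ≤ 2 / ν * (μ * b) := by
      rw [← hBb]
      gcongr
    rw [hηs]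
    linarith
  have z5 : 2 * α * μ * P ≤ ν * (potUpper ν wd c0 c1 R * tsq ζ) :=
    mul_le_mul hαμ PU hP hν.le
  have z6 : μ * (p * tsq ζ) ≤ M * (p * tsq ζ) := by gcongr
  have z7 : p * (tsq z * (μ * (at0 ζ ^ 2 + at1 ζ ^ 2))) ≤ p * (g * (2 * ν * E)) := by
    refine mul_le_mul_of_nonneg_left (mul_le_mul g2 ?_ (by positivity)
      ((tsq_nonneg z).trans g2)) hpC
    linarith
  have z8 : K * (d * (tsq w + tsq wh + μ * (at0 z ^ 2 + at1 z ^ 2)) * E) ≤ K * (d * g * E) := by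
    gcongr
  have z9 := mul_le_mul_of_nonneg_right hK hTζ
  have z10 := mul_le_mul_of_nonneg_right hL hs0
  have e : 1 / μ * ((2 * L / ν + 2) * B) = (2 * L / ν + 2) * b := by
    rw [hBb]
    field_simp
  have e1 : (K / κ * W * M + 2 * K ^ 2 + K * ν ^ 2 / κ * M + 2 * ν ^ 2
      + (1 + 2 * ν) / 4 * W * M) * s = K * (1 / κ * W * (M * s)) + 2 * (K ^ 2 * s)
      + K * (1 / κ * (ν ^ 2 * (M * s))) + 2 * (ν ^ 2 * s) + (1 + 2 * ν) / 4 * W * (M * s) := by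
    ring
  have e2 : (2 * L / ν + 2) * b = L * (2 / ν * b) + 2 * b := by ring
  have n2 : 0 ≤ μ * ‖val ζt‖ ^ 2 := by positivity
  rw [e1] at z10
  rw [e, e2]
  linarith

/-- The cross term costs at most `K‖η‖²` and `K/4 ‖ζ‖²`: the former is covered by `L ≥ K + 1`, the
latter by half of the energy term. -/
theorem le_weakFunctional {μ ν wd c0 c1 κ K L : ℝ} (hp : Params ν wd c0 c1 κ) (hμ : 0 < μ)
    (hK : 0 ≤ K) (hL : K + 1 ≤ L) (w η ζ : H1) :
    K / 4 * diffEnergy μ ν wd c0 c1 w ζ + ‖val η‖ ^ 2 ≤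
      weakFunctional μ ν wd c0 c1 K L w η ζ := by
  have h1 := (boundary_le_diffEnergy hp hμ w ζ).1
  have hP := (mul_nonneg hp.κ_pos.le (tsq_nonneg ζ)).trans (tsq_le_diffPotential hp w ζ)
  have h2 := (abs_le.1 (abs_inner_le (val η) (val ζ) one_pos)).1
  have h3 := mul_le_mul_of_nonneg_left h2 hK
  have h4 := mul_le_mul_of_nonneg_left h1 hK
  have h5 := mul_le_mul_of_nonneg_right hL (sq_nonneg ‖val η‖)
  have h6 := mul_nonneg hμ.le hP
  unfold weakFunctional
  linarith

/-- The functional controlling the error in `H¹`. -/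
def strongFunctional (μ ν wd c0 c1 K L : ℝ) (w η ζ : H1) : ℝ :=
  K * (1 / 2 * diffEnergy μ ν wd c0 c1 w ζ) + diffPotential ν wd c0 c1 w ζ
    + L * (μ * ‖dx η‖ ^ 2)

/-- The derivative of `strongFunctional`. -/
def strongFunctionalD (μ ν wd c0 c1 K L : ℝ) (w z η ηt ζ ζt : H1) : ℝ :=
  K * diffEnergyD μ ν wd c0 c1 w z ζ ζt + diffPotentialD ν wd c0 c1 w z ζ ζt
    + L * (μ * (2 * inner ℝ (dx η) (dx ηt)))

theorem le_strongFunctional {μ ν wd c0 c1 κ K L : ℝ} (hp : Params ν wd c0 c1 κ) (hμ : 0 < μ)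
    (hL : 0 ≤ L) (w η ζ : H1) :
    K / 2 * diffEnergy μ ν wd c0 c1 w ζ + κ * tsq ζ ≤
      strongFunctional μ ν wd c0 c1 K L w η ζ := by
  have h1 := tsq_le_diffPotential hp w ζ
  have h2 : 0 ≤ L * (μ * ‖dx η‖ ^ 2) := by positivity
  unfold strongFunctional
  linarith

/-- At order `h` no cross term is needed, because `‖η_t‖` is itself an admissible source. Hence no
division by `μ` occurs. The term `W‖η_x‖²` is absorbed by the relaxation of `L μ‖η_x‖²`. -/
theorem strongFunctional_dissipation {μ ν wd c0 c1 κ α R M K L B : ℝ} (hp : Params ν wd c0 c1 κ)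
    (hμ : 0 < μ) (hμM : μ ≤ M) (hα : Rate μ ν wd c0 c1 α) {w z wh zh η ηt ζ ζt : H1}
    (hs : Splitting w z wh zh η ηt ζ ζt)
    (h : ∀ χ, weakForm μ ν wd c0 c1 w z χ = 0)
    (hh : weakForm μ ν wd c0 c1 wh zh ζ = 0) (hh' : weakForm μ ν wd c0 c1 wh zh ζt = 0)
    (o1 : inner ℝ (dx η) (dx ζ) = 0) (o2 : inner ℝ (dx ηt) (dx ζ) = 0)
    (o1' : inner ℝ (dx η) (dx ζt) = 0) (o2' : inner ℝ (dx ηt) (dx ζt) = 0)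
    (hw : tsq w ≤ R) (hwh : tsq wh ≤ R) (hB : ‖μ • dx ηt + ν • dx η‖ ^ 2 ≤ B)
    (hB' : ‖val ηt‖ ^ 2 ≤ B) (hK0 : 0 ≤ K)
    (hK : ν * potUpper ν wd c0 c1 R + potConst ν wd c0 c1 R M ≤ K * κ / 2)
    (hL0 : 0 ≤ L) (hL : (K / κ + 1) * (3 * ((1 + wd) ^ 2 + 4 * R)) ≤ L * ν / 2) :
    strongFunctionalD μ ν wd c0 c1 K L w z η ηt ζ ζt
      + 2 * α * strongFunctional μ ν wd c0 c1 K L w η ζ ≤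
    (2 * diffConst ν c0 c1 κ R + potConst ν wd c0 c1 R M / κ)
      * (tsq w + tsq wh + (M + 1) * tsq z) * strongFunctional μ ν wd c0 c1 K L w η ζ
      + (2 * L / ν + (K / κ + 1)) * B := by
  have T1 := mul_le_mul_of_nonneg_left (diffEnergy_dissipation hp hμ hα hs (h _) hh o1 o2 hw hwh) hK0
  have T2 := diffPotential_dissipation hp hμ hμM hs (h _) hh' o1' o2' hw hwh
  obtain ⟨b0, b1⟩ := boundary_state_le hs hwh
  have PU := diffPotential_le hp hw b0 b1
  obtain ⟨g1, g2⟩ := growth_le hμ hμM w wh z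
  have W1 := remainder_strong (wd := wd) (ηt := ηt) (χ := ζ) hs.η0 hs.η1 hw hwh
  have W2 := remainder_strong (wd := wd) (ηt := ηt) (χ := ζt) hs.η0 hs.η1 hw hwh
  have hR : 0 ≤ R := (tsq_nonneg w).trans hw
  have hαμ := hα.mul_le
  have h2α := hα.two_le hμ
  have hα0 := hα.nonneg
  have hE := diffEnergy_nonneg hp hμ w ζ
  have hP := (mul_nonneg hp.κ_pos.le (tsq_nonneg ζ)).trans (tsq_le_diffPotential hp w ζ)
  have relax := mul_le_mul_of_nonneg_left (relaxation_le hp.ν_pos hαμ (dx η) (dx ηt)) hL0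
  have lower := le_strongFunctional (K := K) hp hμ hL0 w η ζ
  have hM : 0 < M := hμ.trans_le hμM
  have hD : 0 ≤ diffConst ν c0 c1 κ R := by
    obtain ⟨hν, hwd, hc0, hc1, hκ, -⟩ := hp
    unfold diffConst
    positivity
  have hpC : 0 ≤ potConst ν wd c0 c1 R M := by
    obtain ⟨hν, hwd, hc0, hc1, hκ, -⟩ := hp
    unfold potConst
    positivity
  obtain ⟨hν, hwd, hc0, hc1, hκ, -⟩ := hp
  have eY : 2 * α * strongFunctional μ ν wd c0 c1 K L w η ζ =
      2 * α * (K * (1 / 2 * diffEnergy μ ν wd c0 c1 w ζ) + diffPotential ν wd c0 c1 w ζ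
        + L * (μ * ‖dx η‖ ^ 2)) := rfl
  rw [eY]
  unfold strongFunctionalD
  set Y := strongFunctional μ ν wd c0 c1 K L w η ζ
  set E := diffEnergy μ ν wd c0 c1 w ζ with hEd
  set P := diffPotential ν wd c0 c1 w ζ with hPd
  set W := 3 * ((1 + wd) ^ 2 + 4 * R) with hW
  set p := potConst ν wd c0 c1 R M
  set d := diffConst ν c0 c1 κ R
  set g := tsq w + tsq wh + (M + 1) * tsq z
  have hW0 : 0 ≤ W := by positivity
  have hTζ := tsq_nonneg ζ
  have hg0 : 0 ≤ g := (tsq_nonneg z).trans g2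
  have hKE : 0 ≤ K / 2 * E := by positivity
  have r1 : |remainder wd w wh η ηt ζ - inner ℝ (val ηt) (val ζ)| ≤
      κ / 4 * ‖val ζ‖ ^ 2 + 1 / κ * (W * ‖dx η‖ ^ 2) := by
    refine (abs_le_of_sq_le_mul (ε := κ / 4) (A := ‖val ζ‖ ^ 2) (B := W * ‖dx η‖ ^ 2)
      (by positivity) (by positivity) (by positivity) (W1.trans_eq (by ring))).trans_eq ?_
    congr 1
    field_simp
  have r2 : |remainder wd w wh η ηt ζt - inner ℝ (val ηt) (val ζt)| ≤
      1 / 4 * ‖val ζt‖ ^ 2 + W * ‖dx η‖ ^ 2 := by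
    refine (abs_le_of_sq_le_mul (ε := 1 / 4) (A := ‖val ζt‖ ^ 2) (B := W * ‖dx η‖ ^ 2)
      (by positivity) (by positivity) (by positivity) (W2.trans_eq (by ring))).trans_eq ?_
    norm_num
  have y1 := (abs_le.1 (abs_inner_le (val ζ) (val ηt) (ε := κ / 4) (by positivity))).1
  have y2 := (abs_le.1 (abs_inner_le (val ζt) (val ηt) (ε := 1 / 4) (by positivity))).1
  have y3 : 1 / (4 * (κ / 4)) * ‖val ηt‖ ^ 2 ≤ 1 / κ * B := by
    have : 1 / (4 * (κ / 4)) = 1 / κ := by field_simp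
    rw [this]
    gcongr
  rw [real_inner_comm] at y1 y2
  have n1 := mul_le_mul_of_nonneg_left (norm_val_sq_le ζ) (by positivity : 0 ≤ κ / 2)
  have z1 : K * (-remainder wd w wh η ηt ζ) ≤
      K * (κ / 2 * tsq ζ + 1 / κ * B + 1 / κ * (W * ‖dx η‖ ^ 2)) := by
    refine mul_le_mul_of_nonneg_left ?_ hK0
    linarith [(abs_le.1 r1).1]
  have z2 : -remainder wd w wh η ηt ζt ≤ 1 / 2 * ‖val ζt‖ ^ 2 + B + W * ‖dx η‖ ^ 2 := by
    linarith [(abs_le.1 r2).1]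
  have z4 : L * (2 / ν * ‖μ • dx ηt + ν • dx η‖ ^ 2) ≤ L * (2 / ν * B) := by gcongr
  have z5 : 2 * α * P ≤ ν * (potUpper ν wd c0 c1 R * tsq ζ) := mul_le_mul h2α PU hP hν.le
  have z7 : p * (tsq z * (at0 ζ ^ 2 + at1 ζ ^ 2)) ≤ p * (g * (1 / κ * Y)) := by
    refine mul_le_mul_of_nonneg_left (mul_le_mul g2 ?_ (by positivity) hg0) hpC
    rw [div_mul_eq_mul_div, one_mul, le_div_iff₀ hκ]
    have : at0 ζ ^ 2 + at1 ζ ^ 2 ≤ tsq ζ := by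
      unfold tsq
      linarith [sq_nonneg ‖dx ζ‖]
    have := mul_le_mul_of_nonneg_left this hκ.le
    linarith
  have z8 : K * (d * (tsq w + tsq wh + μ * (at0 z ^ 2 + at1 z ^ 2)) * E) ≤ 2 * (d * g * Y) := by
    have i1 : K * (d * (tsq w + tsq wh + μ * (at0 z ^ 2 + at1 z ^ 2)) * E) ≤ K * (d * g * E) := by
      gcongr
    have i2 : d * g * (K / 2 * E) ≤ d * g * Y := by
      refine mul_le_mul_of_nonneg_left ?_ (by positivity)
      linarith [mul_nonneg hκ.le hTζ]
    linarith
  have z9 := mul_le_mul_of_nonneg_right hK hTζ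
  have z10 := mul_le_mul_of_nonneg_right hL (sq_nonneg ‖dx η‖)
  have n2 : 0 ≤ μ * ‖dx ζt‖ ^ 2 := by positivity
  have n3 : 0 ≤ μ / ν * (1 / 2 * (at0 ζt ^ 2 + at1 ζt ^ 2)) := by positivity
  have e1 : (K / κ + 1) * W * ‖dx η‖ ^ 2 = K * (1 / κ * (W * ‖dx η‖ ^ 2)) + W * ‖dx η‖ ^ 2 := by
    ring
  have e2 : (2 * L / ν + (K / κ + 1)) * B = L * (2 / ν * B) + K * (1 / κ * B) + B := by ring
  have e3 : (2 * d + p / κ) * g * Y = 2 * (d * g * Y) + p * (g * (1 / κ * Y)) := by ring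
  rw [e1] at z10
  rw [e2, e3]
  linarith

/-! ### The interpolation error along a solution -/

/-- Pointwise version of the relaxation argument, with integrating factor `exp (βt)`, `β = ν/(2μ)`.
The level `4S/ν²` is the equilibrium of the resulting scalar inequality and is independent of `μ`.
-/
theorem relaxation_bound {μ ν α S : ℝ} (hμ : 0 < μ) (hν : 0 < ν) (hα : 2 * α * μ ≤ ν)
    {x y : ℝ → L2} (hd : ∀ t, HasDerivAt x (y t) t)
    (hS : ∀ t, 0 ≤ t → Real.exp (2 * α * t) * ‖μ • y t + ν • x t‖ ^ 2 ≤ S) {t : ℝ} (ht : 0 ≤ t) :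
    Real.exp (2 * α * t) * ‖x t‖ ^ 2 ≤ ‖x 0‖ ^ 2 + 4 * S / ν ^ 2 := by
  set β := ν / (2 * μ) with hβ
  set k := 4 * S / ν ^ 2 with hk
  have hS0 : 0 ≤ S := le_trans (by positivity) (hS 0 le_rfl)
  have hk0 : 0 ≤ k := by positivity
  set f : ℝ → ℝ := fun s => Real.exp (β * s) * (Real.exp (2 * α * s) * ‖x s‖ ^ 2 - k) with hf
  have hexp : ∀ c s : ℝ, HasDerivAt (fun s => Real.exp (c * s)) (c * Real.exp (c * s)) s :=
    fun c s => (((hasDerivAt_id s).const_mul c).exp).congr_deriv (by simp [mul_comm])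
  have hfd : ∀ s, HasDerivAt f (β * Real.exp (β * s) * (Real.exp (2 * α * s) * ‖x s‖ ^ 2 - k)
      + Real.exp (β * s) * (2 * α * Real.exp (2 * α * s) * ‖x s‖ ^ 2
        + Real.exp (2 * α * s) * (2 * inner ℝ (x s) (y s)))) s := fun s =>
    (hexp β s).mul (((hexp (2 * α) s).mul (hd s).norm_sq).sub_const k)
  have hanti : AntitoneOn f (Ici 0) := by
    refine antitoneOn_of_hasDerivWithinAt_nonpos (convex_Ici 0)
      (fun s _ => (hfd s).continuousAt.continuousWithinAt)
      (fun s _ => (hfd s).hasDerivWithinAt) fun s hs => ?_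
    rw [interior_Ici] at hs
    have h1 := mul_le_mul_of_nonneg_left (relaxation_le hν hα (x s) (y s))
      (Real.exp_pos (2 * α * s)).le
    have h2 := mul_le_mul_of_nonneg_left (hS s (mem_Ioi.1 hs).le) (by positivity : 0 ≤ 2 / ν)
    have e1 : μ * β = ν / 2 := by
      rw [hβ]
      field_simp
    have e2 : ν / 2 * k = 2 / ν * S := by
      rw [hk]
      field_simp
      norm_num
    have h3 : μ * (β * (Real.exp (2 * α * s) * ‖x s‖ ^ 2 - k)
        + (2 * α * Real.exp (2 * α * s) * ‖x s‖ ^ 2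
          + Real.exp (2 * α * s) * (2 * inner ℝ (x s) (y s)))) ≤ 0 := by
      have : μ * (β * (Real.exp (2 * α * s) * ‖x s‖ ^ 2 - k)) =
          ν / 2 * (Real.exp (2 * α * s) * ‖x s‖ ^ 2) - 2 / ν * S := by
        rw [← mul_assoc, e1, mul_sub, e2]
      rw [mul_add, this]
      linarith
    have h4 := nonpos_of_mul_nonpos_right h3 hμ
    have h5 := mul_nonpos_of_nonneg_of_nonpos (Real.exp_pos (β * s)).le h4
    linarith
  have h1 := hanti (mem_Ici.2 le_rfl) (mem_Ici.2 ht) ht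
  simp only [hf, mul_zero, Real.exp_zero, one_mul] at h1
  by_contra! hcon
  have h2 : 0 ≤ Real.exp (2 * α * t) * ‖x t‖ ^ 2 - k := by linarith [sq_nonneg ‖x 0‖]
  have h3 : 1 ≤ Real.exp (β * t) := Real.one_le_exp (by positivity)
  have h4 := mul_le_mul_of_nonneg_right h3 h2
  linarith

theorem norm_lowerTerms_sq_le {wd R : ℝ} {w z : H1} (hw : tsq w ≤ R) :
    ‖lowerTerms wd w z‖ ^ 2 ≤ 3 * (1 + (1 + wd) ^ 2 + 2 * R) * (‖val z‖ ^ 2 + tsq w) := by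
  have h1 := norm_add₃_sq_le (val z) ((1 + wd) • dx w) (pmul w (dx w))
  rw [norm_smul_sq] at h1
  have h2 := norm_pmul_sq_le w (dx w)
  have h3 := norm_dx_sq_le w
  have hR : 0 ≤ R := (tsq_nonneg w).trans hw
  have h4 : 2 * tsq w * ‖dx w‖ ^ 2 ≤ 2 * R * tsq w := by
    have := tsq_nonneg w
    gcongr
  have h5 : (1 + wd) ^ 2 * ‖dx w‖ ^ 2 ≤ (1 + wd) ^ 2 * tsq w := by gcongr
  have h6 : 0 ≤ ((1 + wd) ^ 2 + 2 * R) * ‖val z‖ ^ 2 := by positivity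
  have h7 := tsq_nonneg w
  unfold lowerTerms
  linarith

theorem Mesh.norm_val_intErr_le' (m : Mesh) (v : H1) : ‖val (m.intErr v)‖ ≤ m.h * ‖dx v‖ :=
  (m.norm_val_intErr_le v).trans (mul_le_mul_of_nonneg_left (m.norm_dx_intErr_le v) m.h_nonneg)

/-- Taking the interpolation error is linear, so `μ η_t + ν η` is the interpolation error of a
primitive of the flux. That primitive is in H² with second derivative `lowerTerms`, although `w` and
`z` separately need not have such bounds. -/
theorem interp_flux_le {μ ν wd c0 c1 : ℝ} (m : Mesh) {w z : H1}
    (h : ∀ χ, weakForm μ ν wd c0 c1 w z χ = 0) :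
    ‖μ • dx (m.intErr z) + ν • dx (m.intErr w)‖ ^ 2 ≤ m.h ^ 2 * ‖lowerTerms wd w z‖ ^ 2 ∧
      ‖μ • val (m.intErr z) + ν • val (m.intErr w)‖ ^ 2 ≤ m.h ^ 4 * ‖lowerTerms wd w z‖ ^ 2 := by
  obtain ⟨r, hr, hr'⟩ := exists_flux h
  set q := primFun (μ • dx z + ν • dx w) with hq
  have hqd : dx q = dx (μ • z + ν • w) := by
    rw [hq, dx_primFun, dx_add, dx_smul, dx_smul]
  have hT : m.intErr q = μ • m.intErr z + ν • m.intErr w := by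
    rw [← map_smul, ← map_smul, ← map_add]
    refine H1_ext (by simp) ?_
    rw [m.dx_intErr, m.dx_intErr, hqd]
  have hH2 : HasH2Deriv q r := by
    rw [HasH2Deriv, hr, hq, dx_primFun]
  have h1 := m.norm_dx_intErr_le_of_H2 hH2
  have h2 := (m.norm_val_intErr_le q).trans (mul_le_mul_of_nonneg_left h1 m.h_nonneg)
  rw [hT, hr', dx_add, dx_smul, dx_smul] at h1
  rw [hT, hr', val_add, val_smul, val_smul] at h2
  constructor
  · exact (pow_le_pow_left₀ (norm_nonneg _) h1 2).trans_eq (by ring)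
  · exact (pow_le_pow_left₀ (norm_nonneg _) h2 2).trans_eq (by ring)

/-! ### Initial error -/

/-- Test the projection identity with `ζ` itself. Since `η_x` is orthogonal to `ζ_x`, only `lam (η,
ζ)` remains. So the full H¹ norm of `ζ` is controlled by `‖η‖`, one order better than `‖η_x‖`. -/
theorem IsProjection.error_le {lam : ℝ} (hlam : 0 < lam) {m : Mesh} {v p : H1}
    (h : IsProjection lam m v p) :
    ‖v - m.intErr v - p‖ ^ 2 ≤ (1 + lam) * ‖val (m.intErr v)‖ ^ 2 := by
  set ζ := v - m.intErr v - p with hζ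
  have hV : ζ ∈ m.V := by
    rw [← m.mem_VS]
    exact m.VS.sub_mem ((m.mem_VS _).2 (m.sub_intErr_mem v)) ((m.mem_VS _).2 h.1)
  have h1 := h.2 ζ hV
  have e : v - p = ζ + m.intErr v := by
    rw [hζ]
    abel
  rw [e, dx_add, val_add, inner_add_left, inner_add_left, m.inner_dx_intErr v hV,
    real_inner_self_eq_norm_sq, real_inner_self_eq_norm_sq] at h1
  have h2 := (abs_le.1 (abs_inner_le (val (m.intErr v)) (val ζ) (ε := 1 / 2) (by norm_num))).1
  have h3 := mul_le_mul_of_nonneg_left h2 hlam.le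
  have h4 : ‖dx ζ‖ ^ 2 + lam / 2 * ‖val ζ‖ ^ 2 ≤ lam / 2 * ‖val (m.intErr v)‖ ^ 2 := by linarith
  have h5 : ‖val ζ‖ ^ 2 ≤ ‖val (m.intErr v)‖ ^ 2 :=
    le_of_mul_le_mul_left (by linarith [sq_nonneg ‖dx ζ‖]) (half_pos hlam)
  have h6 := mul_le_mul_of_nonneg_left (sq_nonneg ‖val ζ‖) hlam.le
  have h7 := mul_nonneg hlam.le (sq_nonneg ‖val (m.intErr v)‖)
  rw [norm_sq_H1]
  linarith

/-- Initial data of the semidiscrete problem are bounded independently of the mesh; the constant is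
crude. -/
theorem IsProjection.norm_le {lam : ℝ} (hlam : 0 < lam) {m : Mesh} {v p : H1}
    (h : IsProjection lam m v p) : ‖p‖ ≤ (4 + lam) * ‖v‖ := by
  have h1 := h.error_le hlam
  have h2 := m.norm_val_intErr_le' v
  have h3 := m.norm_dx_intErr_le v
  have h4 : m.h * ‖dx v‖ ≤ 1 * ‖v‖ :=
    mul_le_mul m.h_le_one (norm_dx_le v) (norm_nonneg _) zero_le_one
  have h5 := norm_dx_le v
  have h6 : ‖v - m.intErr v - p‖ ≤ (1 + lam) * ‖v‖ := by
    refine abs_le_of_sq_le_sq' ?_ (by positivity) |>.2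
    refine h1.trans ?_
    have : ‖val (m.intErr v)‖ ^ 2 ≤ ‖v‖ ^ 2 := by
      refine pow_le_pow_left₀ (norm_nonneg _) ?_ 2
      linarith
    calc (1 + lam) * ‖val (m.intErr v)‖ ^ 2 ≤ (1 + lam) * ‖v‖ ^ 2 := by gcongr
      _ ≤ (1 + lam) ^ 2 * ‖v‖ ^ 2 := by
        gcongr
        nlinarith
      _ = _ := by ring
  have h7 : ‖m.intErr v‖ ≤ 2 * ‖v‖ := by
    refine abs_le_of_sq_le_sq' ?_ (by positivity) |>.2
    rw [norm_sq_H1]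
    have i1 : ‖val (m.intErr v)‖ ^ 2 ≤ ‖v‖ ^ 2 :=
      pow_le_pow_left₀ (norm_nonneg _) (by linarith) 2
    have i2 : ‖dx (m.intErr v)‖ ^ 2 ≤ ‖v‖ ^ 2 :=
      pow_le_pow_left₀ (norm_nonneg _) (by linarith) 2
    nlinarith [sq_nonneg ‖v‖]
  have e : p = v - m.intErr v - (v - m.intErr v - p) := by abel
  calc ‖p‖ = ‖v - m.intErr v - (v - m.intErr v - p)‖ := by rw [← e]
    _ ≤ ‖v‖ + ‖m.intErr v‖ + ‖v - m.intErr v - p‖ :=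
      (norm_sub_le _ _).trans (add_le_add_left (norm_sub_le _ _) _)
    _ ≤ _ := by linarith

/-! ### Error estimates -/

/-- A solution `w` with time derivative `z`, and a semidiscrete solution `wh` with time derivative
`zh`, continuously extended to negative times. -/
structure ErrorPair (μ ν wd c0 c1 : ℝ) (m : Mesh) (w z wh zh : ℝ → H1) : Prop where
  flow : IsFlow μ ν wd c0 c1 w z
  continuous : Continuous wh
  hasDerivAt : ∀ t, 0 < t → HasDerivAt wh (zh t) t
  mem : ∀ t, 0 ≤ t → wh t ∈ m.V
  mem_deriv : ∀ t, 0 < t → zh t ∈ m.V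
  equation : ∀ t, 0 < t → ∀ χ ∈ m.V, weakForm μ ν wd c0 c1 (wh t) (zh t) χ = 0

theorem IsSemidiscrete.errorPair {μ ν wd c0 c1 lam : ℝ} {w0 : H1} {m : Mesh} {w z wh : ℝ → H1}
    (h : IsSemidiscrete μ ν wd c0 c1 lam w0 m wh) (hw : IsFlow μ ν wd c0 c1 w z) :
    ErrorPair μ ν wd c0 c1 m w z (fun t => wh (max t 0)) (deriv wh) := by
  have hev : ∀ t : ℝ, 0 < t → (fun t => wh (max t 0)) =ᶠ[nhds t] wh := fun t ht => by
    filter_upwards [Ioi_mem_nhds ht] with s hs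
    rw [max_eq_left (mem_Ioi.1 hs).le]
  refine ⟨hw, ?_, fun t ht => ?_, fun t ht => ?_, fun t ht => ?_, fun t ht χ hχ => ?_⟩
  · exact h.continuousOn.comp_continuous (by fun_prop) fun t => le_max_right t 0
  · exact (h.differentiableAt t ht).hasDerivAt.congr_of_eventuallyEq (hev t ht)
  · simpa only [max_eq_left ht] using h.mem t ht
  · rw [← m.mem_VS]
    -- The time derivative is a limit of difference quotients in `V_h`, which is closed in H¹.
    have hd := (h.differentiableAt t ht).hasDerivAt.tendsto_slope_zero_right
    refine m.isClosed_VS.mem_of_tendsto hd ?_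
    filter_upwards [self_mem_nhdsWithin] with s hs
    exact m.VS.smul_mem _ (m.VS.sub_mem ((m.mem_VS _).2 (h.mem _ (by
      have := mem_Ioi.1 hs
      linarith))) ((m.mem_VS _).2 (h.mem t ht.le)))
  · rw [max_eq_left ht.le]
    exact h.equation t ht χ hχ

theorem ErrorPair.isTraj {μ ν wd c0 c1 : ℝ} {m : Mesh} {w z wh zh : ℝ → H1}
    (h : ErrorPair μ ν wd c0 c1 m w z wh zh) : IsTraj μ ν wd c0 c1 wh zh :=
  ⟨h.continuous, h.hasDerivAt, fun t ht => h.equation t ht _ (h.mem t ht.le),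
    fun t ht => h.equation t ht _ (h.mem_deriv t ht)⟩

/-- The discrete part of the error. -/
def discErr (m : Mesh) (w wh : H1) : H1 := w - m.intErr w - wh

theorem discErr_mem {m : Mesh} {w wh : H1} (h : wh ∈ m.V) : discErr m w wh ∈ m.V := by
  rw [← m.mem_VS]
  exact m.VS.sub_mem ((m.mem_VS _).2 (m.sub_intErr_mem w)) ((m.mem_VS _).2 h)

theorem discErr_splitting (m : Mesh) (w z wh zh : H1) :
    Splitting w z wh zh (m.intErr w) (m.intErr z) (discErr m w wh) (discErr m z zh) :=
  ⟨by rw [discErr, sub_sub_cancel], by rw [discErr, sub_sub_cancel], by simp, by simp, by simp,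
    by simp⟩

theorem sub_eq_intErr_add_discErr (m : Mesh) (w wh : H1) :
    w - wh = m.intErr w + discErr m w wh := by
  unfold discErr
  abel

theorem hasDerivAt_intErr (m : Mesh) {w : ℝ → H1} {z : H1} {t : ℝ} (h : HasDerivAt w z t) :
    HasDerivAt (fun t => m.intErr (w t)) (m.intErr z) t :=
  m.intErr.hasFDerivAt.comp_hasDerivAt t h

theorem hasDerivAt_discErr (m : Mesh) {w wh : ℝ → H1} {z zh : H1} {t : ℝ} (h : HasDerivAt w z t)
    (hh : HasDerivAt wh zh t) :
    HasDerivAt (fun t => discErr m (w t) (wh t)) (discErr m z zh) t :=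
  (h.sub (hasDerivAt_intErr m h)).sub hh

theorem continuous_discErr (m : Mesh) {w wh : ℝ → H1} (h : Continuous w) (hh : Continuous wh) :
    Continuous fun t => discErr m (w t) (wh t) :=
  (h.sub (m.intErr.continuous.comp h)).sub hh

/-- Weighted bounds for a solution and its discretization. -/
structure ErrorBound (α R : ℝ) (w z wh : ℝ → H1) : Prop where
  state : ∀ t, 0 ≤ t → Real.exp (2 * α * t) * tsq (w t) ≤ R
  discrete : ∀ t, 0 ≤ t → Real.exp (2 * α * t) * tsq (wh t) ≤ R
  deriv : ∀ t, 0 ≤ t → Real.exp (2 * α * t) * ‖val (z t)‖ ^ 2 ≤ R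
  int_state : ∀ t, 0 ≤ t → ∫ s in (0 : ℝ)..t, Real.exp (2 * α * s) * tsq (w s) ≤ R
  int_discrete : ∀ t, 0 ≤ t → ∫ s in (0 : ℝ)..t, Real.exp (2 * α * s) * tsq (wh s) ≤ R
  int_deriv : ∀ t, 0 ≤ t → ∫ s in (0 : ℝ)..t, Real.exp (2 * α * s) * tsq (z s) ≤ R

theorem integral_le_weighted {α R : ℝ} (hα : 0 ≤ α) {f : ℝ → ℝ} (hf : Continuous f)
    (hf0 : ∀ r, 0 ≤ f r) {t : ℝ} (ht : 0 ≤ t)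
    (hle : ∫ r in (0 : ℝ)..t, Real.exp (2 * α * r) * f r ≤ R) : ∫ r in (0 : ℝ)..t, f r ≤ R := by
  have cX : Continuous fun t : ℝ => Real.exp (2 * α * t) := by fun_prop
  refine le_trans ?_ hle
  exact intervalIntegral.integral_mono_on ht (hf.intervalIntegrable _ _)
    ((cX.mul hf).intervalIntegrable _ _) fun r hr => exp_mul_nonneg_ge hα hr.1 (hf0 r)

theorem ErrorBound.int_growth {α R M : ℝ} {w z wh : ℝ → H1} (h : ErrorBound α R w z wh)
    (hα : 0 ≤ α) (hM : 0 ≤ M) (cw : Continuous w) (cz : Continuous z) (cwh : Continuous wh)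
    {t : ℝ} (ht : 0 ≤ t) :
    ∫ s in (0 : ℝ)..t, (tsq (w s) + tsq (wh s) + (M + 1) * tsq (z s)) ≤ (M + 3) * R := by
  have c1 : Continuous fun s => tsq (w s) := continuous_tsq.comp cw
  have c2 : Continuous fun s => tsq (wh s) := continuous_tsq.comp cwh
  have c3 : Continuous fun s => tsq (z s) := continuous_tsq.comp cz
  have c12 : Continuous fun s => tsq (w s) + tsq (wh s) := c1.add c2
  have c4 : Continuous fun s => (M + 1) * tsq (z s) := c3.const_mul _
  rw [intervalIntegral.integral_add (c12.intervalIntegrable _ _) (c4.intervalIntegrable _ _),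
    intervalIntegral.integral_add (c1.intervalIntegrable _ _) (c2.intervalIntegrable _ _),
    intervalIntegral.integral_const_mul]
  have i1 := integral_le_weighted hα c1 (fun r => tsq_nonneg _) ht (h.int_state t ht)
  have i2 := integral_le_weighted hα c2 (fun r => tsq_nonneg _) ht (h.int_discrete t ht)
  have i3 := mul_le_mul_of_nonneg_left
    (integral_le_weighted hα c3 (fun r => tsq_nonneg _) ht (h.int_deriv t ht))
    (by linarith : 0 ≤ M + 1)
  linarith

theorem continuous_lowerTerms (wd : ℝ) {w z : ℝ → H1} (cw : Continuous w) (cz : Continuous z) :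
    Continuous fun t => lowerTerms wd (w t) (z t) := by
  have h1 := continuous_val
  have h2 := continuous_dx
  have h3 : Continuous fun t => pmul (w t) (dx (w t)) := continuous_pmul cw (h2.comp cw)
  unfold lowerTerms
  fun_prop

theorem ErrorBound.state_le {α R : ℝ} {w z wh : ℝ → H1} (h : ErrorBound α R w z wh) (hα : 0 ≤ α)
    {t : ℝ} (ht : 0 ≤ t) : tsq (w t) ≤ R :=
  (exp_mul_nonneg_ge hα ht (tsq_nonneg _)).trans (h.state t ht)

theorem ErrorBound.discrete_le {α R : ℝ} {w z wh : ℝ → H1} (h : ErrorBound α R w z wh)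
    (hα : 0 ≤ α) {t : ℝ} (ht : 0 ≤ t) : tsq (wh t) ≤ R :=
  (exp_mul_nonneg_ge hα ht (tsq_nonneg _)).trans (h.discrete t ht)

/-- The constant in the bounds for `lowerTerms`. -/
def lowerConst (wd R : ℝ) : ℝ := 3 * (1 + (1 + wd) ^ 2 + 2 * R)

theorem ErrorBound.lowerTerms_le {α R wd : ℝ} {w z wh : ℝ → H1} (h : ErrorBound α R w z wh)
    (hα : 0 ≤ α) {t : ℝ} (ht : 0 ≤ t) :
    Real.exp (2 * α * t) * ‖lowerTerms wd (w t) (z t)‖ ^ 2 ≤ lowerConst wd R * (2 * R) := by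
  have hR : 0 ≤ R := (tsq_nonneg _).trans (h.state_le hα le_rfl)
  have h1 := mul_le_mul_of_nonneg_left (norm_lowerTerms_sq_le (wd := wd) (z := z t)
    (h.state_le hα ht)) (Real.exp_pos (2 * α * t)).le
  have h2 : lowerConst wd R * (Real.exp (2 * α * t) * ‖val (z t)‖ ^ 2
      + Real.exp (2 * α * t) * tsq (w t)) ≤ lowerConst wd R * (R + R) := by
    refine mul_le_mul_of_nonneg_left (add_le_add (h.deriv t ht) (h.state t ht)) ?_
    unfold lowerConst
    positivity
  refine h1.trans ?_
  unfold lowerConst at h2 ⊢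
  linarith

theorem ErrorBound.int_lowerTerms {α R wd : ℝ} {w z wh : ℝ → H1} (h : ErrorBound α R w z wh)
    (hα : 0 ≤ α) (cw : Continuous w) (cz : Continuous z) {t : ℝ} (ht : 0 ≤ t) :
    ∫ s in (0 : ℝ)..t, Real.exp (2 * α * s) * ‖lowerTerms wd (w s) (z s)‖ ^ 2 ≤
      lowerConst wd R * (2 * R) := by
  have hR : 0 ≤ R := (tsq_nonneg _).trans (h.state_le hα le_rfl)
  have hC : 0 ≤ lowerConst wd R := by
    unfold lowerConst
    positivity
  have cX : Continuous fun t : ℝ => Real.exp (2 * α * t) := by fun_prop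
  have c1 : Continuous fun s => Real.exp (2 * α * s) * tsq (w s) :=
    cX.mul (continuous_tsq.comp cw)
  have c2 : Continuous fun s => Real.exp (2 * α * s) * tsq (z s) :=
    cX.mul (continuous_tsq.comp cz)
  have c3 : Continuous fun s => Real.exp (2 * α * s) * ‖lowerTerms wd (w s) (z s)‖ ^ 2 :=
    cX.mul ((continuous_lowerTerms wd cw cz).norm.pow 2)
  have c4 : Continuous fun s => lowerConst wd R * (Real.exp (2 * α * s) * tsq (z s)
      + Real.exp (2 * α * s) * tsq (w s)) := (c2.add c1).const_mul _
  calc _ ≤ ∫ s in (0 : ℝ)..t, lowerConst wd R * (Real.exp (2 * α * s) * tsq (z s)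
      + Real.exp (2 * α * s) * tsq (w s)) := by
        refine intervalIntegral.integral_mono_on ht (c3.intervalIntegrable _ _)
          (c4.intervalIntegrable _ _) fun s hs => ?_
        have h1 := norm_lowerTerms_sq_le (wd := wd) (z := z s) (h.state_le hα hs.1)
        have h2 : ‖lowerTerms wd (w s) (z s)‖ ^ 2 ≤ lowerConst wd R * (tsq (z s) + tsq (w s)) := by
          refine h1.trans (mul_le_mul_of_nonneg_left ?_ hC)
          linarith [norm_val_sq_le (z s)]
        have h3 := mul_le_mul_of_nonneg_left h2 (Real.exp_pos (2 * α * s)).le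
        linarith
    _ ≤ _ := by
        rw [intervalIntegral.integral_const_mul, intervalIntegral.integral_add
          (c2.intervalIntegrable _ _) (c1.intervalIntegrable _ _)]
        refine mul_le_mul_of_nonneg_left ?_ hC
        linarith [h.int_deriv t ht, h.int_state t ht]

/-! ### Initial values and time derivatives of the error functionals -/

theorem continuous_diffPotential (ν wd c0 c1 : ℝ) {X : Type*} [TopologicalSpace X] {w ζ : X → H1}
    (hw : Continuous w) (hζ : Continuous ζ) :
    Continuous fun t => diffPotential ν wd c0 c1 (w t) (ζ t) := by
  have h0 := continuous_at0
  have h1 := continuous_at1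
  have h3 := continuous_dx
  unfold diffPotential bdryQ
  fun_prop

/-- The constant in the bound for the initial error. -/
def initConst (ν wd c0 c1 R M : ℝ) : ℝ :=
  (1 + 1 / ν * ((c0 + 1 + wd) + (c1 + 1 + wd) + 20 * R / (3 * c0) + 20 * R / (3 * c1))) * (1 + M)
    + potUpper ν wd c0 c1 R

theorem diff_initial_le {μ ν wd c0 c1 κ R M : ℝ} (hp : Params ν wd c0 c1 κ) (hμ : 0 < μ)
    (hμM : μ ≤ M) {w ζ : H1} (hw : tsq w ≤ R) (h0 : (at0 w - at0 ζ) ^ 2 ≤ R)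
    (h1 : (at1 w - at1 ζ) ^ 2 ≤ R) :
    diffEnergy μ ν wd c0 c1 w ζ ≤ initConst ν wd c0 c1 R M * tsq ζ ∧
      diffPotential ν wd c0 c1 w ζ ≤ initConst ν wd c0 c1 R M * tsq ζ := by
  have hE := diffEnergy_le hp hμ hw h0 h1
  have hP := diffPotential_le hp hw h0 h1
  have hR : 0 ≤ R := (tsq_nonneg w).trans hw
  have hT := tsq_nonneg ζ
  have hM : 0 < M := hμ.trans_le hμM
  obtain ⟨hν, hwd, hc0, hc1, -⟩ := hp
  have i1 : 0 ≤ potUpper ν wd c0 c1 R := by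
    unfold potUpper
    positivity
  have i2 : 0 ≤ potUpper ν wd c0 c1 R * tsq ζ := mul_nonneg i1 hT
  have i3 : ‖val ζ‖ ^ 2 + μ * tsq ζ ≤ (1 + M) * tsq ζ := by
    have := mul_le_mul_of_nonneg_right hμM hT
    linarith [norm_val_sq_le ζ]
  have i4 : 0 ≤ 1 + 1 / ν * ((c0 + 1 + wd) + (c1 + 1 + wd) + 20 * R / (3 * c0)
      + 20 * R / (3 * c1)) := by positivity
  have i5 := mul_le_mul_of_nonneg_left i3 i4
  have i6 : 0 ≤ (1 + 1 / ν * ((c0 + 1 + wd) + (c1 + 1 + wd) + 20 * R / (3 * c0)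
      + 20 * R / (3 * c1))) * ((1 + M) * tsq ζ) := mul_nonneg i4 (by positivity)
  unfold initConst
  constructor <;> linarith

theorem norm_val_intErr_sq_le (m : Mesh) {v u : H1} (hu : HasH2Deriv v u) :
    ‖val (m.intErr v)‖ ^ 2 ≤ m.h ^ 4 * ‖dx u‖ ^ 2 := by
  have h := (m.norm_val_intErr_le v).trans
    (mul_le_mul_of_nonneg_left (m.norm_dx_intErr_le_of_H2 hu) m.h_nonneg)
  exact (pow_le_pow_left₀ (norm_nonneg _) h 2).trans_eq (by ring)

theorem norm_dx_intErr_sq_le (m : Mesh) {v u : H1} (hu : HasH2Deriv v u) :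
    ‖dx (m.intErr v)‖ ^ 2 ≤ m.h ^ 2 * ‖dx u‖ ^ 2 :=
  (pow_le_pow_left₀ (norm_nonneg _) (m.norm_dx_intErr_le_of_H2 hu) 2).trans_eq (by ring)

theorem hasDerivAt_weakFunctional {μ ν wd c0 c1 K L : ℝ} {w η ζ : ℝ → H1} {z ηt ζt : H1} {t : ℝ}
    (hw : HasDerivAt w z t) (hη : HasDerivAt η ηt t) (hζ : HasDerivAt ζ ζt t) :
    HasDerivAt (fun t => weakFunctional μ ν wd c0 c1 K L (w t) (η t) (ζ t))
      (weakFunctionalD μ ν wd c0 c1 K L (w t) z (η t) ηt (ζ t) ζt) t := by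
  have := (((((hasDerivAt_diffEnergy μ ν wd c0 c1 hw hζ).const_mul (1 / 2)).add
    ((hasDerivAt_val hη).inner ℝ (hasDerivAt_val hζ))).const_mul K).add
      ((hasDerivAt_diffPotential (ν := ν) (wd := wd) (c0 := c0) (c1 := c1) hw hζ).const_mul μ)).add
    ((hasDerivAt_val hη).norm_sq.const_mul L)
  refine this.congr_deriv ?_
  unfold weakFunctionalD
  ring

theorem hasDerivAt_strongFunctional {μ ν wd c0 c1 K L : ℝ} {w η ζ : ℝ → H1} {z ηt ζt : H1} {t : ℝ}
    (hw : HasDerivAt w z t) (hη : HasDerivAt η ηt t) (hζ : HasDerivAt ζ ζt t) :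
    HasDerivAt (fun t => strongFunctional μ ν wd c0 c1 K L (w t) (η t) (ζ t))
      (strongFunctionalD μ ν wd c0 c1 K L (w t) z (η t) ηt (ζ t) ζt) t := by
  have := ((((hasDerivAt_diffEnergy μ ν wd c0 c1 hw hζ).const_mul (1 / 2)).const_mul K).add
      (hasDerivAt_diffPotential (ν := ν) (wd := wd) (c0 := c0) (c1 := c1) hw hζ)).add
    (((hasDerivAt_dx hη).norm_sq.const_mul μ).const_mul L)
  refine this.congr_deriv ?_
  unfold strongFunctionalD
  ring

theorem potUpper_nonneg {ν wd c0 c1 κ R : ℝ} (hp : Params ν wd c0 c1 κ) (hR : 0 ≤ R) :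
    0 ≤ potUpper ν wd c0 c1 R := by
  obtain ⟨hν, hwd, hc0, hc1, -⟩ := hp
  unfold potUpper
  positivity

theorem potConst_nonneg {ν wd c0 c1 κ R M : ℝ} (hp : Params ν wd c0 c1 κ) (hR : 0 ≤ R)
    (hM : 0 ≤ M) : 0 ≤ potConst ν wd c0 c1 R M := by
  obtain ⟨hν, hwd, hc0, hc1, -⟩ := hp
  unfold potConst
  positivity

theorem diffConst_nonneg {ν wd c0 c1 κ R : ℝ} (hp : Params ν wd c0 c1 κ) (hR : 0 ≤ R) :
    0 ≤ diffConst ν c0 c1 κ R := by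
  obtain ⟨hν, hwd, hc0, hc1, hκ, -⟩ := hp
  unfold diffConst
  positivity

theorem initConst_nonneg {ν wd c0 c1 κ R M : ℝ} (hp : Params ν wd c0 c1 κ) (hR : 0 ≤ R)
    (hM : 0 ≤ M) : 0 ≤ initConst ν wd c0 c1 R M := by
  have := potUpper_nonneg hp hR
  obtain ⟨hν, hwd, hc0, hc1, -⟩ := hp
  unfold initConst
  positivity

theorem integral_weighted_const_mul (α k : ℝ) (f : ℝ → ℝ) (t : ℝ) :
    ∫ s in (0 : ℝ)..t, Real.exp (2 * α * s) * (k * f s) =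
      k * ∫ s in (0 : ℝ)..t, Real.exp (2 * α * s) * f s := by
  rw [← intervalIntegral.integral_const_mul]
  congr 1
  ext s
  ring

/-- `K` is fixed first, to dominate the potential, then `L` depending on `K`. The initial functional
is of order `h⁴`, since the discrete initial error is bounded by `‖η(0)‖` even in H¹; this is where
`w0` in H² is used. -/
theorem exists_weak_error {ν wd c0 c1 κ R M lam U : ℝ} (hp : Params ν wd c0 c1 κ) (hM : 0 < M)
    (hlam : 0 < lam) (hR : 0 ≤ R) (hU : 0 ≤ U) :
    ∃ C : ℝ, 0 ≤ C ∧ ∀ μ α : ℝ, 0 < μ → μ ≤ M → Rate μ ν wd c0 c1 α → ∀ (m : Mesh)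
      (w z wh zh : ℝ → H1), ErrorPair μ ν wd c0 c1 m w z wh zh → ErrorBound α R w z wh →
      ∀ u : H1, HasH2Deriv (w 0) u → ‖dx u‖ ^ 2 ≤ U →
      ‖discErr m (w 0) (wh 0)‖ ^ 2 ≤ (1 + lam) * ‖val (m.intErr (w 0))‖ ^ 2 → ∀ t : ℝ, 0 ≤ t →
      Real.exp (2 * α * t) * ‖val (w t - wh t)‖ ^ 2 ≤ C * (1 / μ * m.h ^ 4) := by
  obtain ⟨C0, hC0, hC0'⟩ := exists_tsq_le
  have hκ := hp.κ_pos
  have hν := hp.ν_pos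
  have hpu := potUpper_nonneg hp hR
  have hpc := potConst_nonneg (M := M) hp hR hM.le
  have hd := diffConst_nonneg hp hR
  have hic := initConst_nonneg (M := M) hp hR hM.le
  have hlc : 0 ≤ lowerConst wd R := by
    unfold lowerConst
    positivity
  set pu := potUpper ν wd c0 c1 R with hpud
  set p := potConst ν wd c0 c1 R M with hpd
  set d := diffConst ν c0 c1 κ R with hdd
  set ic := initConst ν wd c0 c1 R M with hicd
  set lc := lowerConst wd R with hlcd
  obtain ⟨K, hK1, hK⟩ : ∃ K : ℝ, 1 ≤ K ∧ ν * pu + M * p ≤ K * κ / 2 := by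
    refine ⟨2 * (ν * pu + M * p) / κ + 1, by
      have : 0 ≤ 2 * (ν * pu + M * p) / κ := by positivity
      linarith, ?_⟩
    have : (2 * (ν * pu + M * p) / κ + 1) * κ / 2 = ν * pu + M * p + κ / 2 := by
      field_simp
    linarith
  have hK0 : 0 ≤ K := by linarith
  obtain ⟨L, hL1, hL⟩ : ∃ L : ℝ, K + 1 ≤ L ∧ K / κ * (6 * ((1 + wd) ^ 2 + 6 * R)) * M + 2 * K ^ 2
      + K * ν ^ 2 / κ * M + 2 * ν ^ 2
      + (1 + 2 * ν) / 4 * (6 * ((1 + wd) ^ 2 + 6 * R)) * M ≤ L * ν / 2 := by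
    have hX : 0 ≤ K / κ * (6 * ((1 + wd) ^ 2 + 6 * R)) * M + 2 * K ^ 2
      + K * ν ^ 2 / κ * M + 2 * ν ^ 2 + (1 + 2 * ν) / 4 * (6 * ((1 + wd) ^ 2 + 6 * R)) * M := by
      positivity
    generalize K / κ * (6 * ((1 + wd) ^ 2 + 6 * R)) * M + 2 * K ^ 2
      + K * ν ^ 2 / κ * M + 2 * ν ^ 2 + (1 + 2 * ν) / 4 * (6 * ((1 + wd) ^ 2 + 6 * R)) * M = X at *
    refine ⟨2 * X / ν + (K + 1), by
      have : 0 ≤ 2 * X / ν := by positivity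
      linarith, ?_⟩
    have : (2 * X / ν + (K + 1)) * ν / 2 = X + (K + 1) * ν / 2 := by
      field_simp
    have : 0 ≤ (K + 1) * ν / 2 := by positivity
    linarith
  have hL0 : 0 ≤ L := by linarith
  -- The factor 4 comes from `K ≥ 1`: the energy of `ζ` is at most four times the functional.
  set k := (K * d + 2 * ν * p) * 4 with hk
  have hk0 : 0 ≤ k := by positivity
  set T := C0 * (1 + lam) with hT
  have hT0 : 0 ≤ T := by positivity
  set Y0 := K * (1 / 2 * (ic * T) + (1 + 1 / 4 * T)) + M * (ic * T) + L with hY0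
  have hY00 : 0 ≤ Y0 := by positivity
  refine ⟨10 * (Real.exp (k * ((M + 3) * R)) * (Y0 * U * M + (2 * L / ν + 2) * (lc * (2 * R)))),
    by positivity, ?_⟩
  intro μ α hμ hμM hα m w z wh zh h hb u hu hU' hi t ht
  have cw := h.flow.continuous
  have cz := h.flow.continuous_deriv
  have cwh := h.continuous
  have cη : Continuous fun t => m.intErr (w t) := m.intErr.continuous.comp cw
  have cζ := continuous_discErr m cw cwh
  have hα0 := hα.nonneg
  have cY : Continuous fun t =>
      weakFunctional μ ν wd c0 c1 K L (w t) (m.intErr (w t)) (discErr m (w t) (wh t)) := by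
    have i1 := continuous_diffEnergy μ ν wd c0 c1 cw cζ
    have i2 := continuous_diffPotential ν wd c0 c1 cw cζ
    have i3 : Continuous fun t => val (m.intErr (w t)) := continuous_val.comp cη
    have i4 : Continuous fun t => val (discErr m (w t) (wh t)) := continuous_val.comp cζ
    unfold weakFunctional
    fun_prop
  have lower := fun t => le_weakFunctional hp hμ hK0 hL1 (w t) (m.intErr (w t))
    (discErr m (w t) (wh t))
  have hE := fun t => diffEnergy_nonneg hp hμ (w t) (discErr m (w t) (wh t))
  have upE : ∀ t, diffEnergy μ ν wd c0 c1 (w t) (discErr m (w t) (wh t)) ≤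
      4 * weakFunctional μ ν wd c0 c1 K L (w t) (m.intErr (w t)) (discErr m (w t) (wh t)) := by
    intro t
    have := mul_le_mul_of_nonneg_right hK1 (hE t)
    linarith [lower t, sq_nonneg ‖val (m.intErr (w t))‖]
  have cg : Continuous fun t => tsq (w t) + tsq (wh t) + (M + 1) * tsq (z t) :=
    ((continuous_tsq.comp cw).add (continuous_tsq.comp cwh)).add
      ((continuous_tsq.comp cz).const_mul _)
  have hg0 : ∀ t, 0 ≤ tsq (w t) + tsq (wh t) + (M + 1) * tsq (z t) := fun t => by
    have h1 := tsq_nonneg (w t)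
    have h2 := tsq_nonneg (wh t)
    have h3 := tsq_nonneg (z t)
    positivity
  have key := gronwall_weighted (α := α)
    (φ := fun t => weakFunctional μ ν wd c0 c1 K L (w t) (m.intErr (w t)) (discErr m (w t) (wh t)))
    (φ' := fun t => weakFunctionalD μ ν wd c0 c1 K L (w t) (z t) (m.intErr (w t)) (m.intErr (z t))
      (discErr m (w t) (wh t)) (discErr m (z t) (zh t)))
    (G := fun t => k * (tsq (w t) + tsq (wh t) + (M + 1) * tsq (z t)))
    (B := fun t => 1 / μ * ((2 * L / ν + 2) * m.h ^ 4) * ‖lowerTerms wd (w t) (z t)‖ ^ 2)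
    (D := fun _ => 0) (A := k * ((M + 3) * R))
    (b := 1 / μ * ((2 * L / ν + 2) * m.h ^ 4) * (lc * (2 * R)))
    cY.continuousOn
    (fun t ht => hasDerivAt_weakFunctional (h.flow.hasDerivAt t)
      (hasDerivAt_intErr m (h.flow.hasDerivAt t))
      (hasDerivAt_discErr m (h.flow.hasDerivAt t) (h.hasDerivAt t ht)))
    (cg.const_mul _) (((continuous_lowerTerms wd cw cz).norm.pow 2).const_mul _)
    continuous_const (fun t => mul_nonneg hk0 (hg0 t)) (fun t => by positivity) (fun _ => le_rfl)
    (fun t => by linarith [upE t, hE t])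
    (fun t ht => by
      have mζ := discErr_mem (w := w t) (h.mem t ht.le)
      have mζt := discErr_mem (w := z t) (h.mem_deriv t ht)
      have := weakFunctional_dissipation hp hμ hμM hα (discErr_splitting m (w t) (z t) (wh t) (zh t))
        (h.flow.equation t ht.le) (h.equation t ht _ mζ) (h.equation t ht _ mζt)
        (m.inner_dx_intErr _ mζ) (m.inner_dx_intErr _ mζ) (m.inner_dx_intErr _ mζt)
        (m.inner_dx_intErr _ mζt) (hb.state_le hα0 ht.le) (hb.discrete_le hα0 ht.le)
        (interp_flux_le m (h.flow.equation t ht.le)).2 hK0 hK hL0 hL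
      have i1 := mul_le_mul_of_nonneg_left (upE t)
        (mul_nonneg (by positivity : 0 ≤ K * d + 2 * ν * p) (hg0 t))
      rw [hk]
      linarith)
    (fun t ht => by
      rw [intervalIntegral.integral_const_mul]
      exact mul_le_mul_of_nonneg_left (hb.int_growth hα0 hM.le cw cz cwh ht) hk0)
    (fun t ht => by
      rw [integral_weighted_const_mul]
      exact mul_le_mul_of_nonneg_left (hb.int_lowerTerms hα0 cw cz ht) (by positivity)) ht
  simp only [mul_zero, intervalIntegral.integral_zero, add_zero] at key
  have init : weakFunctional μ ν wd c0 c1 K L (w 0) (m.intErr (w 0)) (discErr m (w 0) (wh 0)) ≤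
      Y0 * U * M * (1 / μ * m.h ^ 4) := by
    obtain ⟨b0, b1⟩ := boundary_state_le (discErr_splitting m (w 0) 0 (wh 0) 0)
      (hb.discrete_le hα0 le_rfl)
    obtain ⟨i1, i2⟩ := diff_initial_le hp hμ hμM (hb.state_le hα0 le_rfl) b0 b1
    have i3 : tsq (discErr m (w 0) (wh 0)) ≤ T * ‖val (m.intErr (w 0))‖ ^ 2 := by
      have := mul_le_mul_of_nonneg_left hi hC0.le
      linarith [hC0' (discErr m (w 0) (wh 0))]
    have i4 := mul_le_mul_of_nonneg_left i3 hic
    have i5 := (abs_le.1 (abs_inner_le (val (m.intErr (w 0))) (val (discErr m (w 0) (wh 0)))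
      one_pos)).2
    have i6 := norm_val_sq_le (discErr m (w 0) (wh 0))
    have i7 : K * (1 / 2 * diffEnergy μ ν wd c0 c1 (w 0) (discErr m (w 0) (wh 0))
        + inner ℝ (val (m.intErr (w 0))) (val (discErr m (w 0) (wh 0)))) ≤
        K * ((1 / 2 * (ic * T) + (1 + 1 / 4 * T)) * ‖val (m.intErr (w 0))‖ ^ 2) := by
      refine mul_le_mul_of_nonneg_left ?_ hK0
      linarith
    have i8 : μ * diffPotential ν wd c0 c1 (w 0) (discErr m (w 0) (wh 0)) ≤
        M * (ic * T * ‖val (m.intErr (w 0))‖ ^ 2) := by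
      refine mul_le_mul hμM (by linarith) ?_ hM.le
      exact (mul_nonneg hκ.le (tsq_nonneg _)).trans (tsq_le_diffPotential hp _ _)
    have i9 : weakFunctional μ ν wd c0 c1 K L (w 0) (m.intErr (w 0)) (discErr m (w 0) (wh 0)) ≤
        Y0 * ‖val (m.intErr (w 0))‖ ^ 2 := by
      rw [hY0]
      unfold weakFunctional
      linarith
    refine i9.trans ?_
    have j1 : ‖val (m.intErr (w 0))‖ ^ 2 ≤ m.h ^ 4 * U :=
      (norm_val_intErr_sq_le m hu).trans (by gcongr)
    -- The initial error carries no negative power of `μ`; `1 ≤ M/μ` inserts one.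
    have j2 : m.h ^ 4 * U ≤ U * M * (1 / μ * m.h ^ 4) := by
      have : 1 ≤ M * (1 / μ) := by
        rw [mul_one_div, one_le_div hμ]
        exact hμM
      have := mul_le_mul_of_nonneg_right this (by positivity : 0 ≤ m.h ^ 4 * U)
      linarith
    have j3 := mul_le_mul_of_nonneg_left (j1.trans j2) hY00
    linarith
  -- With `Y` the functional, `2‖η‖² + 2‖ζ‖² ≤ 2Y + 8Y`.
  have fin : ‖val (w t - wh t)‖ ^ 2 ≤ 10 *
      weakFunctional μ ν wd c0 c1 K L (w t) (m.intErr (w t)) (discErr m (w t) (wh t)) := by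
    rw [sub_eq_intErr_add_discErr m, val_add]
    have i1 := norm_add_sq_le (val (m.intErr (w t))) (val (discErr m (w t) (wh t)))
    have i2 := (boundary_le_diffEnergy hp hμ (w t) (discErr m (w t) (wh t))).1
    have i3 := mul_nonneg (by positivity : 0 ≤ K / 4) (hE t)
    linarith [upE t, lower t]
  have k1 := mul_le_mul_of_nonneg_left fin (Real.exp_pos (2 * α * t)).le
  have k2 := mul_le_mul_of_nonneg_left init (Real.exp_pos (k * ((M + 3) * R))).le
  linarith

/-- The functional controls `ζ` uniformly in `μ`, but its `η`-part carries the factor `μ`. So `η_x`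
is bounded separately, by relaxation from its initial value. -/
theorem exists_strong_error {ν wd c0 c1 κ R M lam U : ℝ} (hp : Params ν wd c0 c1 κ) (hM : 0 < M)
    (hlam : 0 < lam) (hR : 0 ≤ R) (hU : 0 ≤ U) :
    ∃ C : ℝ, 0 ≤ C ∧ ∀ μ α : ℝ, 0 < μ → μ ≤ M → Rate μ ν wd c0 c1 α → ∀ (m : Mesh)
      (w z wh zh : ℝ → H1), ErrorPair μ ν wd c0 c1 m w z wh zh → ErrorBound α R w z wh →
      ∀ u : H1, HasH2Deriv (w 0) u → ‖dx u‖ ^ 2 ≤ U →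
      ‖discErr m (w 0) (wh 0)‖ ^ 2 ≤ (1 + lam) * ‖val (m.intErr (w 0))‖ ^ 2 → ∀ t : ℝ, 0 ≤ t →
      Real.exp (2 * α * t) * tsq (w t - wh t) ≤ C * m.h ^ 2 := by
  obtain ⟨C0, hC0, hC0'⟩ := exists_tsq_le
  have hκ := hp.κ_pos
  have hν := hp.ν_pos
  have hpu := potUpper_nonneg hp hR
  have hpc := potConst_nonneg (M := M) hp hR hM.le
  have hd := diffConst_nonneg hp hR
  have hic := initConst_nonneg (M := M) hp hR hM.le
  have hlc : 0 ≤ lowerConst wd R := by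
    unfold lowerConst
    positivity
  set pu := potUpper ν wd c0 c1 R with hpud
  set p := potConst ν wd c0 c1 R M with hpd
  set d := diffConst ν c0 c1 κ R with hdd
  set ic := initConst ν wd c0 c1 R M with hicd
  set lc := lowerConst wd R with hlcd
  obtain ⟨K, hK0, hK⟩ : ∃ K : ℝ, 0 ≤ K ∧ ν * pu + p ≤ K * κ / 2 := by
    refine ⟨2 * (ν * pu + p) / κ, by positivity, ?_⟩
    have : 2 * (ν * pu + p) / κ * κ / 2 = ν * pu + p := by
      field_simp
    linarith
  obtain ⟨L, hL0, hL⟩ : ∃ L : ℝ, 0 ≤ L ∧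
      (K / κ + 1) * (3 * ((1 + wd) ^ 2 + 4 * R)) ≤ L * ν / 2 := by
    refine ⟨2 * ((K / κ + 1) * (3 * ((1 + wd) ^ 2 + 4 * R))) / ν, by positivity, ?_⟩
    refine le_of_eq ?_
    field_simp
  set k := 2 * d + p / κ with hk
  have hk0 : 0 ≤ k := by positivity
  set T := C0 * (1 + lam) with hT
  have hT0 : 0 ≤ T := by positivity
  set Y0 := K * (1 / 2 * (ic * T)) + ic * T + L * M with hY0
  have hY00 : 0 ≤ Y0 := by positivity
  set J := 2 * L / ν + (K / κ + 1) with hJ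
  have hJ0 : 0 ≤ J := by positivity
  refine ⟨2 / κ * (Real.exp (k * ((M + 3) * R)) * (Y0 * U + J * (lc * (2 * R) + R)))
    + 2 * (U + 4 * (lc * (2 * R)) / ν ^ 2), by positivity, ?_⟩
  intro μ α hμ hμM hα m w z wh zh h hb u hu hU' hi t ht
  have cw := h.flow.continuous
  have cz := h.flow.continuous_deriv
  have cwh := h.continuous
  have cη : Continuous fun t => m.intErr (w t) := m.intErr.continuous.comp cw
  have cζ := continuous_discErr m cw cwh
  have hα0 := hα.nonneg
  have hh := m.h_nonneg
  have cX : Continuous fun t : ℝ => Real.exp (2 * α * t) := by fun_prop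
  have cf : Continuous fun t => ‖lowerTerms wd (w t) (z t)‖ ^ 2 :=
    (continuous_lowerTerms wd cw cz).norm.pow 2
  have ctz : Continuous fun t => tsq (z t) := continuous_tsq.comp cz
  have cY : Continuous fun t =>
      strongFunctional μ ν wd c0 c1 K L (w t) (m.intErr (w t)) (discErr m (w t) (wh t)) := by
    have i1 := continuous_diffEnergy μ ν wd c0 c1 cw cζ
    have i2 := continuous_diffPotential ν wd c0 c1 cw cζ
    have i3 : Continuous fun t => dx (m.intErr (w t)) := continuous_dx.comp cη
    unfold strongFunctional
    fun_prop
  have lower : ∀ t, κ * tsq (discErr m (w t) (wh t)) ≤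
      strongFunctional μ ν wd c0 c1 K L (w t) (m.intErr (w t)) (discErr m (w t) (wh t)) := by
    intro t
    have i1 := le_strongFunctional (K := K) hp hμ hL0 (w t) (m.intErr (w t)) (discErr m (w t) (wh t))
    have i2 := mul_nonneg (half_pos one_pos).le
      (mul_nonneg hK0 (diffEnergy_nonneg hp hμ (w t) (discErr m (w t) (wh t))))
    linarith
  have cg : Continuous fun t => tsq (w t) + tsq (wh t) + (M + 1) * tsq (z t) :=
    ((continuous_tsq.comp cw).add (continuous_tsq.comp cwh)).add (ctz.const_mul _)
  have hg0 : ∀ t, 0 ≤ tsq (w t) + tsq (wh t) + (M + 1) * tsq (z t) := fun t => by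
    have h1 := tsq_nonneg (w t)
    have h2 := tsq_nonneg (wh t)
    have h3 := tsq_nonneg (z t)
    positivity
  have key := gronwall_weighted (α := α)
    (φ := fun t =>
      strongFunctional μ ν wd c0 c1 K L (w t) (m.intErr (w t)) (discErr m (w t) (wh t)))
    (φ' := fun t => strongFunctionalD μ ν wd c0 c1 K L (w t) (z t) (m.intErr (w t))
      (m.intErr (z t)) (discErr m (w t) (wh t)) (discErr m (z t) (zh t)))
    (G := fun t => k * (tsq (w t) + tsq (wh t) + (M + 1) * tsq (z t)))
    (B := fun t => J * m.h ^ 2 * (‖lowerTerms wd (w t) (z t)‖ ^ 2 + tsq (z t)))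
    (D := fun _ => 0) (A := k * ((M + 3) * R)) (b := J * m.h ^ 2 * (lc * (2 * R) + R))
    cY.continuousOn
    (fun t ht => hasDerivAt_strongFunctional (h.flow.hasDerivAt t)
      (hasDerivAt_intErr m (h.flow.hasDerivAt t))
      (hasDerivAt_discErr m (h.flow.hasDerivAt t) (h.hasDerivAt t ht)))
    (cg.const_mul _) ((cf.add ctz).const_mul _)
    continuous_const (fun t => mul_nonneg hk0 (hg0 t))
    (fun t => mul_nonneg (by positivity) (add_nonneg (sq_nonneg _) (tsq_nonneg _)))
    (fun _ => le_rfl)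
    (fun t => (mul_nonneg hκ.le (tsq_nonneg _)).trans (lower t))
    (fun t ht => by
      have mζ := discErr_mem (w := w t) (h.mem t ht.le)
      have mζt := discErr_mem (w := z t) (h.mem_deriv t ht)
      have tz := tsq_nonneg (z t)
      have b1 : ‖μ • dx (m.intErr (z t)) + ν • dx (m.intErr (w t))‖ ^ 2 ≤
          m.h ^ 2 * (‖lowerTerms wd (w t) (z t)‖ ^ 2 + tsq (z t)) :=
        (interp_flux_le m (h.flow.equation t ht.le)).1.trans
          (mul_le_mul_of_nonneg_left (by linarith) (by positivity))
      have b2 : ‖val (m.intErr (z t))‖ ^ 2 ≤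
          m.h ^ 2 * (‖lowerTerms wd (w t) (z t)‖ ^ 2 + tsq (z t)) := by
        refine (pow_le_pow_left₀ (norm_nonneg _) (m.norm_val_intErr_le' (z t)) 2).trans ?_
        rw [mul_pow]
        refine mul_le_mul_of_nonneg_left ?_ (by positivity)
        linarith [norm_dx_sq_le (z t), sq_nonneg ‖lowerTerms wd (w t) (z t)‖]
      have := strongFunctional_dissipation hp hμ hμM hα
        (discErr_splitting m (w t) (z t) (wh t) (zh t))
        (h.flow.equation t ht.le) (h.equation t ht _ mζ) (h.equation t ht _ mζt)
        (m.inner_dx_intErr _ mζ) (m.inner_dx_intErr _ mζ) (m.inner_dx_intErr _ mζt)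
        (m.inner_dx_intErr _ mζt) (hb.state_le hα0 ht.le) (hb.discrete_le hα0 ht.le)
        b1 b2 hK0 hK hL0 hL
      linarith)
    (fun t ht => by
      rw [intervalIntegral.integral_const_mul]
      exact mul_le_mul_of_nonneg_left (hb.int_growth hα0 hM.le cw cz cwh ht) hk0)
    (fun t ht => by
      rw [integral_weighted_const_mul]
      refine mul_le_mul_of_nonneg_left ?_ (by positivity)
      simp only [mul_add]
      have i1 : Continuous fun s => Real.exp (2 * α * s) * ‖lowerTerms wd (w s) (z s)‖ ^ 2 :=
        cX.mul cf
      have i2 : Continuous fun s => Real.exp (2 * α * s) * tsq (z s) := cX.mul ctz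
      rw [intervalIntegral.integral_add (i1.intervalIntegrable _ _) (i2.intervalIntegrable _ _)]
      exact add_le_add (hb.int_lowerTerms hα0 cw cz ht) (hb.int_deriv t ht)) ht
  simp only [mul_zero, intervalIntegral.integral_zero, add_zero] at key
  have hη0 : ‖dx (m.intErr (w 0))‖ ^ 2 ≤ m.h ^ 2 * U :=
    (norm_dx_intErr_sq_le m hu).trans (by gcongr)
  have init : strongFunctional μ ν wd c0 c1 K L (w 0) (m.intErr (w 0)) (discErr m (w 0) (wh 0)) ≤
      Y0 * U * m.h ^ 2 := by
    obtain ⟨b0, b1⟩ := boundary_state_le (discErr_splitting m (w 0) 0 (wh 0) 0)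
      (hb.discrete_le hα0 le_rfl)
    obtain ⟨i1, i2⟩ := diff_initial_le hp hμ hμM (hb.state_le hα0 le_rfl) b0 b1
    have i3 : tsq (discErr m (w 0) (wh 0)) ≤ T * (m.h ^ 2 * U) := by
      have j1 := mul_le_mul_of_nonneg_left hi hC0.le
      have j2 : ‖val (m.intErr (w 0))‖ ^ 2 ≤ m.h ^ 2 * U := by
        refine (pow_le_pow_left₀ (norm_nonneg _) ((m.norm_val_intErr_le (w 0)).trans
          (mul_le_of_le_one_left (norm_nonneg _) m.h_le_one)) 2).trans hη0
      have j3 := mul_le_mul_of_nonneg_left j2 hT0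
      linarith [hC0' (discErr m (w 0) (wh 0))]
    have i4 := mul_le_mul_of_nonneg_left i3 hic
    have i7 : K * (1 / 2 * diffEnergy μ ν wd c0 c1 (w 0) (discErr m (w 0) (wh 0))) ≤
        K * (1 / 2 * (ic * T) * (m.h ^ 2 * U)) := by
      refine mul_le_mul_of_nonneg_left ?_ hK0
      linarith
    have i8 : L * (μ * ‖dx (m.intErr (w 0))‖ ^ 2) ≤ L * (M * (m.h ^ 2 * U)) := by gcongr
    rw [hY0]
    unfold strongFunctional
    linarith
  have hηt : Real.exp (2 * α * t) * ‖dx (m.intErr (w t))‖ ^ 2 ≤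
      ‖dx (m.intErr (w 0))‖ ^ 2 + 4 * (m.h ^ 2 * (lc * (2 * R))) / ν ^ 2 := by
    refine relaxation_bound hμ hν hα.mul_le (x := fun t => dx (m.intErr (w t)))
      (fun t => hasDerivAt_dx (hasDerivAt_intErr m (h.flow.hasDerivAt t))) (fun s hs => ?_) ht
    have j1 := mul_le_mul_of_nonneg_left (interp_flux_le m (h.flow.equation s hs)).1
      (Real.exp_pos (2 * α * s)).le
    have j2 := mul_le_mul_of_nonneg_left (hb.lowerTerms_le (wd := wd) hα0 hs)
      (by positivity : 0 ≤ m.h ^ 2)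
    linarith
  have fin : tsq (w t - wh t) ≤ 2 / κ * strongFunctional μ ν wd c0 c1 K L (w t) (m.intErr (w t))
      (discErr m (w t) (wh t)) + 2 * ‖dx (m.intErr (w t))‖ ^ 2 := by
    have i1 := norm_add_sq_le (dx (m.intErr (w t))) (dx (discErr m (w t) (wh t)))
    have i2 : tsq (w t - wh t) ≤ 2 * tsq (discErr m (w t) (wh t))
        + 2 * ‖dx (m.intErr (w t))‖ ^ 2 := by
      rw [sub_eq_intErr_add_discErr m]
      unfold tsq
      rw [dx_add, at0_add, at1_add, m.at0_intErr, m.at1_intErr, zero_add, zero_add]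
      linarith [sq_nonneg (at0 (discErr m (w t) (wh t))), sq_nonneg (at1 (discErr m (w t) (wh t)))]
    have i3 := mul_le_mul_of_nonneg_left (lower t) (by positivity : 0 ≤ 2 / κ)
    have i4 : 2 / κ * (κ * tsq (discErr m (w t) (wh t))) = 2 * tsq (discErr m (w t) (wh t)) := by
      field_simp
    linarith
  have k1 := mul_le_mul_of_nonneg_left fin (Real.exp_pos (2 * α * t)).le
  have k2 := mul_le_mul_of_nonneg_left init (Real.exp_pos (k * ((M + 3) * R))).le
  have k3 := mul_le_mul_of_nonneg_left (key.trans (by linarith :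
    Real.exp (k * ((M + 3) * R)) * (strongFunctional μ ν wd c0 c1 K L (w 0) (m.intErr (w 0))
      (discErr m (w 0) (wh 0)) + J * m.h ^ 2 * (lc * (2 * R) + R)) ≤
    Real.exp (k * ((M + 3) * R)) * (Y0 * U + J * (lc * (2 * R) + R)) * m.h ^ 2))
    (by positivity : 0 ≤ 2 / κ)
  have k4 : 4 * (m.h ^ 2 * (lc * (2 * R))) / ν ^ 2 = 4 * (lc * (2 * R)) / ν ^ 2 * m.h ^ 2 := by
    ring
  linarith

/-! ### The initial time derivative -/

/-- For compatible initial data the initial time derivative is bounded uniformly in `μ`. -/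
theorem IsCompatible.initial_deriv_le {ν wd c0 c1 : ℝ} (hν : 0 < ν) (hwd : 0 ≤ wd) (hc0 : 0 < c0)
    (hc1 : 0 < c1) {w0 : H1} (h : IsCompatible ν wd c0 c1 w0) :
    ∃ R1 : ℝ, ∀ μ : ℝ, 0 < μ → ∀ z : H1, (∀ χ, weakForm μ ν wd c0 c1 w0 z χ = 0) →
      ‖val z‖ ^ 2 + μ * tsq z ≤ R1 := by
  obtain ⟨u, hu, h0, h1⟩ := h
  set F := (1 + wd) • dx w0 + pmul w0 (dx w0) - ν • dx u with hF
  refine ⟨(2 + ν) * ‖F‖ ^ 2, fun μ hμ z hz => ?_⟩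
  have e := hz z
  rw [weakForm_eq_add, massForm_apply, loadForm_apply] at e
  -- Integrating `ν w0_x` by parts, compatibility makes the boundary values cancel the feedback
  -- terms exactly. What remains is an L² function tested with `z`, hence a bound without inverse
  -- powers of `μ`.
  have p := inner_dx_val_add u z
  rw [hu, h0, h1, K0, K1] at p
  have eF : inner ℝ F (val z) = (1 + wd) * inner ℝ (dx w0) (val z)
      + inner ℝ (pmul w0 (dx w0)) (val z) - ν * inner ℝ (dx u) (val z) := by
    rw [hF, inner_sub_left, inner_add_left, real_inner_smul_left, real_inner_smul_left]
  have p' : ν * inner ℝ (dx u) (val z) + ν * inner ℝ (dx w0) (dx z) =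
      -(bdry wd c1 (at1 w0) * at1 z) - bdry wd c0 (at0 w0) * at0 z := by
    rw [← mul_add, p]
    field_simp
  have y := (abs_le.1 (abs_inner_le F (val z) (ε := 1 / 2) (by norm_num))).1
  rw [real_inner_self_eq_norm_sq, real_inner_self_eq_norm_sq] at e
  have q0 : μ / ν * at0 z ^ 2 ≤
      μ / ν * ((c0 + 1 + wd) + 2 / (3 * c0) * at0 w0 ^ 2) * (at0 z * at0 z) := by
    rw [← sq, mul_assoc]
    refine mul_le_mul_of_nonneg_left (le_mul_of_one_le_left (sq_nonneg _) ?_) (by positivity)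
    have : 0 ≤ 2 / (3 * c0) * at0 w0 ^ 2 := by positivity
    linarith
  have q1 : μ / ν * at1 z ^ 2 ≤
      μ / ν * ((c1 + 1 + wd) + 2 / (3 * c1) * at1 w0 ^ 2) * (at1 z * at1 z) := by
    rw [← sq, mul_assoc]
    refine mul_le_mul_of_nonneg_left (le_mul_of_one_le_left (sq_nonneg _) ?_) (by positivity)
    have : 0 ≤ 2 / (3 * c1) * at1 w0 ^ 2 := by positivity
    linarith
  have f0 : μ * at0 z ^ 2 = ν * (μ / ν * at0 z ^ 2) := by field_simp
  have f1 : μ * at1 z ^ 2 = ν * (μ / ν * at1 z ^ 2) := by field_simp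
  have n0 : 0 ≤ μ / ν * at0 z ^ 2 := by positivity
  have n1 : 0 ≤ μ / ν * at1 z ^ 2 := by positivity
  have n2 : 0 ≤ μ * ‖dx z‖ ^ 2 := by positivity
  have n3 := sq_nonneg ‖val z‖
  have tot : 1 / 2 * ‖val z‖ ^ 2 + μ * ‖dx z‖ ^ 2 + (μ / ν * at0 z ^ 2 + μ / ν * at1 z ^ 2) ≤
      1 / 2 * ‖F‖ ^ 2 := by
    linarith
  have t1 := mul_le_mul_of_nonneg_left (by linarith : μ / ν * at0 z ^ 2 + μ / ν * at1 z ^ 2 ≤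
    1 / 2 * ‖F‖ ^ 2) hν.le
  have n4 := mul_nonneg hν.le (sq_nonneg ‖F‖)
  unfold tsq
  linarith

/-! ### The error bounds -/

/-- Square roots turn the weight `2α` into `α`, and any smaller rate `β` follows. The estimates are
thus needed only at the largest admissible rate. -/
theorem le_of_weighted_sq_le {α β t x y C D : ℝ} (hβ : β ≤ α) (ht : 0 ≤ t)
    (hy : 0 ≤ y) (hCD : √C ≤ D) (h : Real.exp (2 * α * t) * x ^ 2 ≤ C * y ^ 2) :
    x ≤ D * (y * Real.exp (-β * t)) := by
  have e : Real.exp (2 * α * t) * x ^ 2 = (Real.exp (α * t) * x) ^ 2 := by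
    rw [mul_pow, ← Real.exp_nat_mul]
    congr 2
    push_cast
    ring
  rw [e] at h
  have h1 : Real.exp (α * t) * x ≤ √C * y := by
    have := Real.abs_le_sqrt h
    rw [mul_comm C, Real.sqrt_mul (sq_nonneg y), Real.sqrt_sq hy, mul_comm y] at this
    exact (le_abs_self _).trans this
  have h2 : x = Real.exp (-α * t) * (Real.exp (α * t) * x) := by
    rw [← mul_assoc, ← Real.exp_add]
    simp
  have h3 : Real.exp (-α * t) ≤ Real.exp (-β * t) := by
    apply Real.exp_le_exp.2
    have := mul_le_mul_of_nonneg_right hβ ht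
    linarith
  rw [h2]
  calc Real.exp (-α * t) * (Real.exp (α * t) * x) ≤ Real.exp (-α * t) * (√C * y) := by gcongr
    _ ≤ Real.exp (-β * t) * (D * y) := by gcongr
    _ = _ := by ring

/-- The only hypothesis involving `μ` besides `μ ≤ M` is the bound `R1` on the initial time
derivative. Both parts of the theorem are instances. -/
theorem exists_errorBounds {ν wd c0 c1 lam : ℝ} (hν : 0 < ν) (hwd : 0 ≤ wd) (hc0 : 0 < c0)
    (hc1 : 0 < c1) (hlam : 0 < lam) {w0 u : H1} (hu : HasH2Deriv w0 u) {M : ℝ} (hM : 0 < M)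
    (R1 : ℝ) : ∃ C : ℝ, 0 < C ∧ ∀ μ : ℝ, 0 < μ → μ ≤ M →
      (∀ z, (∀ χ, weakForm μ ν wd c0 c1 w0 z χ = 0) → ‖val z‖ ^ 2 + μ * tsq z ≤ R1) →
      ErrorBounds μ ν wd c0 c1 lam w0 C := by
  obtain ⟨κ, hp⟩ := exists_params hν hwd hc0 hc1
  obtain ⟨R, hR0, hR⟩ := flow_bounds hp M ‖w0‖ R1
  obtain ⟨R', hR0', hR'⟩ := traj_bounds hp M ((4 + lam) * ‖w0‖)
  obtain ⟨C1, hC1, weak⟩ := exists_weak_error (R := R + R') hp hM hlam (by positivity)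
    (sq_nonneg ‖dx u‖)
  obtain ⟨C2, hC2, strong⟩ := exists_strong_error (R := R + R') hp hM hlam (by positivity)
    (sq_nonneg ‖dx u‖)
  refine ⟨1 + √C1 + √(2 * C2 * M) + √C2, by positivity, ?_⟩
  intro μ hμ hμM hz w hw m wh hwh β _ hβ t ht
  obtain ⟨W, Z, hflow, hW0, hWw⟩ := hw.exists_flow hμ hν hwd hc0 hc1
  have hα := rate_alphaMax hμ hν hwd hc0 hc1
  set α := alphaMax μ ν wd c0 c1
  have pair := hwh.errorPair hflow
  have hZ0 : ‖val (Z 0)‖ ^ 2 + μ * tsq (Z 0) ≤ R1 := hz _ fun χ => by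
    rw [← hW0]
    exact hflow.equation 0 le_rfl χ
  have b1 := hR μ α hμ hμM hα W Z hflow (by rw [hW0]) hZ0
  obtain ⟨b2, b3, -⟩ := hR' μ α hμ hμM hα _ _ pair.isTraj (by
    simpa only [max_self] using hwh.initial.norm_le hlam)
  have hb : ErrorBound α (R + R') W Z (fun t => wh (max t 0)) :=
    ⟨fun t ht => by linarith [(b1 t ht).1], fun t ht => by linarith [b2 t ht],
      fun t ht => by linarith [(b1 t ht).2.1], fun t ht => by linarith [(b1 t ht).2.2.1],
      fun t ht => by linarith [b3 t ht], fun t ht => by linarith [(b1 t ht).2.2.2]⟩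
  have hu' : HasH2Deriv (W 0) u := by rwa [hW0]
  have hi : ‖discErr m (W 0) (wh (max 0 0))‖ ^ 2 ≤ (1 + lam) * ‖val (m.intErr (W 0))‖ ^ 2 := by
    rw [max_self, hW0]
    exact hwh.initial.error_le hlam
  have e1 := weak μ α hμ hμM hα m W Z _ _ pair hb u hu' le_rfl hi t ht
  have e2 := strong μ α hμ hμM hα m W Z _ _ pair hb u hu' le_rfl hi t ht
  simp only [max_eq_left ht, hWw t ht] at e1 e2
  have hh := m.h_nonneg
  have sμ : (1 / √μ) ^ 2 = 1 / μ := by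
    rw [div_pow, one_pow, Real.sq_sqrt hμ.le]
  have s1 := Real.sqrt_nonneg C1
  have s2 := Real.sqrt_nonneg C2
  have s3 := Real.sqrt_nonneg (2 * C2 * M)
  refine ⟨le_of_weighted_sq_le (C := C1) hβ ht (by positivity) (by linarith) ?_,
    le_of_weighted_sq_le (C := 2 * C2 * M) hβ ht (by positivity) (by linarith) ?_,
    le_of_weighted_sq_le (C := C2) hβ ht hh (by linarith) ?_⟩
  · rw [mul_pow, sμ]
    refine e1.trans_eq ?_
    ring
  · rw [mul_pow, sμ]
    have i1 := mul_le_mul_of_nonneg_left (norm_sq_le_tsq (w t - wh t))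
      (Real.exp_pos (2 * α * t)).le
    -- The H¹ bound holds without `μ^{-1/2}`; the factor is inserted at the cost of `√M`.
    have i2 : 1 ≤ M * (1 / μ) := by
      rw [mul_one_div, one_le_div hμ]
      exact hμM
    have i3 := mul_le_mul_of_nonneg_left i2 (by positivity : 0 ≤ 2 * C2 * m.h ^ 2)
    linarith
  · rw [tnorm_sq]
    exact e2

end BBMB

end

theorem mainTheorem1 (ν wd c0 c1 lam : ℝ) (hν : 0 < ν) (hwd : 0 ≤ wd) (hc0 : 0 < c0) (hc1 : 0 < c1)
    (hlam : 0 < lam) (w0 : BBMB.H1) (hw0 : ∃ u : BBMB.H1, BBMB.HasH2Deriv w0 u) :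
    (∀ μ : ℝ, 0 < μ → ∃ C : ℝ, 0 < C ∧ BBMB.ErrorBounds μ ν wd c0 c1 lam w0 C) ∧
    (BBMB.IsCompatible ν wd c0 c1 w0 → ∀ M : ℝ, 0 < M → ∃ C : ℝ, 0 < C ∧
      ∀ μ : ℝ, 0 < μ → μ ≤ M → BBMB.ErrorBounds μ ν wd c0 c1 lam w0 C) := by
  obtain ⟨u, hu⟩ := hw0
  refine ⟨fun μ hμ => ?_, fun hc M hM => ?_⟩
  · obtain ⟨z, hz⟩ := BBMB.exists_weakForm_eq_zero hμ hν hwd hc0 hc1 w0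
    obtain ⟨C, hC, h⟩ := BBMB.exists_errorBounds hν hwd hc0 hc1 hlam hu hμ
      (‖BBMB.val z‖ ^ 2 + μ * BBMB.tsq z)
    refine ⟨C, hC, h μ hμ le_rfl fun z' hz' => ?_⟩
    rw [BBMB.weakForm_unique hμ hν hwd hc0 hc1 hz' hz]
  · obtain ⟨R1, hR1⟩ := hc.initial_deriv_le hν hwd hc0 hc1
    obtain ⟨C, hC, h⟩ := BBMB.exists_errorBounds hν hwd hc0 hc1 hlam hu hM R1
    exact ⟨C, hC, fun μ hμ hμM => h μ hμ hμM (hR1 μ hμ)⟩
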